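/- Let $T$ be a nonempty (for instance infinite) totally ordered set of truth-values. Regular non-clausal formulas are built from regular constants $\alpha\ge\beta$, positive literals $X^{\ge\alpha}$ and negative literals $X_{\le\alpha}$ ($X$ a proposition, $\alpha,\beta\in T$) by finite conjunctions $\{\wedge\,\varphi_1\dots\varphi_k\}$ and disjunctions $(\vee\,\varphi_1\dots\varphi_k)$, $k\ge 0$. An interpretation $I$ assigns a truth-value to each proposition; the constant $\alpha\ge\beta$ is true iff $\alpha\ge\beta$ in $T$, $X^{\ge\alpha}$ is true iff $I(X)\ge\alpha$, $X_{\le\alpha}$ is true iff $I(X)\le\alpha$, and $\wedge,\vee$ are classical (so $\{\wedge\}$ is true and $(\vee)$ is false). A formula is satisfiable if some interpretation makes it true. It is Horn-NC if each disjunction occurring in it has at most one disjunct that contains positive literals. Reg-Horn-NC-SAT is the problem of deciding whether a given Horn-NC formula is satisfiable. In inputs, propositions and truth-values are given by names, which are words over finite alphabets (a name denotes one truth-value), and the comparison of two named truth-values is assumed to be computable in polynomial time; formulas are written as strings with delimiters, in prefix notation. The calculus $RUR_{NC}$ rewrites formulas by the following rules. ($RUR$) If the formula is a conjunction having a conjunct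 $X^{\ge\alpha}$ and another conjunct $\Pi$, then in some disjunction $(\vee\dots C\dots)$ occurring in $\Pi$ a disjunct $C$ is removed, where $C$ is a literal $X_{\le\beta}$ with $\alpha>\beta$ or contains an occurrence of such a literal under conjunctions only. The other rules apply to any sub-formula occurrence: ($\vee\bot$) remove a disjunct $(\vee)$ from a disjunction; ($\wedge\bot$) replace a conjunction having a conjunct $(\vee)$ by $(\vee)$; ($\odot_{k+1}$) replace an immediate sub-formula $\langle\odot\,\varphi\rangle$ of a conjunction or disjunction by $\varphi$, where $\odot\in\{\wedge,\vee\}$; ($\odot_{k+n}$) merge a conjunction into an enclosing conjunction, or a disjunction into an enclosing disjunction; ($\bot^\alpha_\beta$) replace a conjunction having conjuncts $X^{\ge\alpha}$ and $X_{\le\beta}$ with $\alpha>\beta$ by $(\vee)$; ($\max$) replace two conjuncts $X^{\ge\alpha}$, $X^{\ge\beta}$ of a conjunction by the single conjunct $X^{\ge\max(\alpha,\beta)}$. Lemma. (1) Reg-Horn-NC-SAT is decidable in polynomial time: some Turing machine decides, for every Horn-NC formula given as a string, whether it is satisfiable, in time polynomial in the length of the string. (2) Let $\varphi$ be a Horn-NC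 formula without regular constants that is a conjunction. Then $\varphi$ is unsatisfiable iff $RUR_{NC}$ derives $(\vee)$ from $\varphi$; moreover, if $\psi$ is any formula derived from $\varphi$ to which no rule applies, then $\varphi$ is unsatisfiable iff $\psi=(\vee)$; and every derivation from $\varphi$ has at most $|\varphi|$ inferences, where $|\varphi|$ is the number of occurrences of atoms and connectives in $\varphi$ (a linear bound). (3) Each inference takes polynomial time: there is a polynomial-time computable function that maps each formula to a formula obtained from it by one inference of $RUR_{NC}$, and whose string is not longer, or reports that no rule applies (which it does only if none applies). -/

import Mathlib

/-- The two connectives. -/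
inductive Conn where
  | and
  | or

/-- Regular non-clausal formulas over propositions `P` and truth-values (or truth-value names) `V`:
regular constants `α ≥ β`, positive literals `X ≥ α`, negative literals `X ≤ α`, and
conjunctions / disjunctions `⟨o φ₁ … φₖ⟩` of finite lists of formulas (`k = 0` is allowed). -/
inductive NC (P V : Type*) where
  | const (α β : V) : NC P V
  | pos (X : P) (α : V) : NC P V
  | neg (X : P) (α : V) : NC P V
  | node (o : Conn) (φs : List (NC P V)) : NC P V

namespace NC

/-- Apply a map to all truth-values of a formula. -/
def map {P V W : Type*} (f : V → W) : NC P V → NC P W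
  | const α β => const (f α) (f β)
  | pos X α => pos X (f α)
  | neg X α => neg X (f α)
  | node o φs => node o (φs.map (map f))

/-- The size of a formula: its number of occurrences of atoms and connectives. -/
def size {P V : Type*} : NC P V → ℕ
  | const _ _ => 1
  | pos _ _ => 1
  | neg _ _ => 1
  | node _ φs => 1 + (φs.map size).sum

/-- Truth of a formula under an interpretation `I` of the propositions. A disjunction is true when
some disjunct is (so `(∨)` is false) and a conjunction when all conjuncts are (so `{∧}` is true). -/
def Holds {P T : Type*} [LinearOrder T] (I : P → T) : NC P T → Prop
  | const α β => β ≤ α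
  | pos X α => α ≤ I X
  | neg X α => I X ≤ α
  | node Conn.and φs => ∀ φ ∈ φs, Holds I φ
  | node Conn.or φs => ∃ φ, ∃ _ : φ ∈ φs, Holds I φ

/-- A formula is satisfiable when it has a model. -/
def Sat {P T : Type*} [LinearOrder T] (φ : NC P T) : Prop :=
  ∃ I : P → T, Holds I φ

/-- `IsSub ψ φ`: `ψ` is a sub-formula of `φ`. -/
inductive IsSub {P V : Type*} : NC P V → NC P V → Prop where
  | refl (φ : NC P V) : IsSub φ φ
  | node {ψ φ : NC P V} {o : Conn} {φs : List (NC P V)} (h : φ ∈ φs) (hs : IsSub ψ φ) :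
      IsSub ψ (node o φs)

/-- The formula has (at least one occurrence of) a positive literal. -/
def HasPos {P V : Type*} (φ : NC P V) : Prop :=
  ∃ X α, IsSub (pos X α) φ

/-- Horn-NC formulas: every disjunction occurring in `φ` has at most one disjunct having positive
literals (disjuncts at different positions count as different). -/
def IsHNC {P V : Type*} (φ : NC P V) : Prop :=
  ∀ φs, IsSub (node Conn.or φs) φ → φs.Pairwise fun ψ χ => ¬ (HasPos ψ ∧ HasPos χ)

/-- No regular constant `α ≥ β` occurs in the formula. -/
def ConstFree {P V : Type*} (φ : NC P V) : Prop :=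
  ∀ α β, ¬ IsSub (const α β) φ

/-- `ConjWith ℓ C`: `C` is `ℓ`, or a conjunction one of whose conjuncts is again of this form; so
`C` contains the occurrence of `ℓ` under conjunctions only and is equivalent to some `ℓ ∧ ψ`. -/
inductive ConjWith {P V : Type*} (ℓ : NC P V) : NC P V → Prop where
  | lit : ConjWith ℓ ℓ
  | conj {φ : NC P V} {φs : List (NC P V)} (h : φ ∈ φs) (hc : ConjWith ℓ φ) :
      ConjWith ℓ (node Conn.and φs)

/-- `Cut X α Π Π'`: some sub-formula occurrence `(∨ C D)` of `Π`, where `C` is the part of the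
disjunction that becomes false with a literal `X ≤ β`, `α > β`, is replaced with `D`. -/
inductive Cut {P T : Type*} [LinearOrder T] (X : P) (α : T) : NC P T → NC P T → Prop where
  | here {β : T} {C : NC P T} (l r : List (NC P T)) (hβ : β < α) (hC : ConjWith (neg X β) C) :
      Cut X α (node Conn.or (l ++ C :: r)) (node Conn.or (l ++ r))
  | deep {φ φ' : NC P T} (o : Conn) (l r : List (NC P T)) (h : Cut X α φ φ') :
      Cut X α (node o (l ++ φ :: r)) (node o (l ++ φ' :: r))

/-- Regular non-clausal unit-resolution (rule `RUR`): the formula is a conjunction with a conjunct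
`X ≥ α` and another conjunct `Π`, to which `Cut` is applied. -/
inductive RUR {P T : Type*} [LinearOrder T] : NC P T → NC P T → Prop where
  | mk {X : P} {α : T} {φ φ' : NC P T} (l r : List (NC P T))
      (hu : pos X α ∈ l ++ r) (hcut : Cut X α φ φ') :
      RUR (node Conn.and (l ++ φ :: r)) (node Conn.and (l ++ φ' :: r))

/-- The simplification rules, applied at the root. -/
inductive SimpRule {P T : Type*} [LinearOrder T] : NC P T → NC P T → Prop where
  /-- Rule `∨⊥`: remove a disjunct `(∨)`. -/
  | orBot (l r : List (NC P T)) :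
      SimpRule (node Conn.or (l ++ node Conn.or [] :: r)) (node Conn.or (l ++ r))
  /-- Rule `∧⊥`: a conjunction with a conjunct `(∨)` becomes `(∨)`. -/
  | andBot (l r : List (NC P T)) :
      SimpRule (node Conn.and (l ++ node Conn.or [] :: r)) (node Conn.or [])
  /-- Rule `⊙_{k+1}`: remove a connective that is applied to a single sub-formula. -/
  | single (o₂ o₁ : Conn) (φ : NC P T) (l r : List (NC P T)) :
      SimpRule (node o₂ (l ++ node o₁ [φ] :: r)) (node o₂ (l ++ φ :: r))
  /-- Rule `⊙_{k+n}`: merge nested equal connectives. -/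
  | merge (o : Conn) (φs l r : List (NC P T)) :
      SimpRule (node o (l ++ node o φs :: r)) (node o (l ++ φs ++ r))
  /-- Rule `⊥^α_β`: a conjunction with conjuncts `X ≥ α` and `X ≤ β`, `α > β`, becomes `(∨)`. -/
  | clash {X : P} {α β : T} {φs : List (NC P T)} (hp : pos X α ∈ φs) (hn : neg X β ∈ φs)
      (h : β < α) : SimpRule (node Conn.and φs) (node Conn.or [])
  /-- Rule `max`: two conjuncts `X ≥ α`, `X ≥ β` of a conjunction become `X ≥ max α β`. -/
  | max (X : P) (α β : T) (l m r : List (NC P T)) :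
      SimpRule (node Conn.and (l ++ pos X α :: m ++ pos X β :: r))
        (node Conn.and (l ++ pos X (Max.max α β) :: m ++ r))

/-- A simplification rule applied to some sub-formula occurrence. -/
inductive Simplify {P T : Type*} [LinearOrder T] : NC P T → NC P T → Prop where
  | here {φ φ' : NC P T} (h : SimpRule φ φ') : Simplify φ φ'
  | deep {φ φ' : NC P T} (o : Conn) (l r : List (NC P T)) (h : Simplify φ φ') :
      Simplify (node o (l ++ φ :: r)) (node o (l ++ φ' :: r))

/-- One inference of the calculus `RUR_NC`. -/
def Infer {P T : Type*} [LinearOrder T] (φ ψ : NC P T) : Prop :=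
  RUR φ ψ ∨ Simplify φ ψ

/-- `ψ` is derived from `φ` by a finite number of inferences of `RUR_NC`. -/
def Derives {P T : Type*} [LinearOrder T] (φ ψ : NC P T) : Prop :=
  Relation.ReflTransGen Infer φ ψ

/-- No inference of `RUR_NC` applies to `φ`. -/
def Irreducible {P T : Type*} [LinearOrder T] (φ : NC P T) : Prop :=
  ∀ ψ, ¬ Infer φ ψ

/-- The input alphabet: structural symbols, and the symbols used for writing propositions and
truth-values. -/
inductive Tok (A B : Type) where
  | const
  | pos
  | neg
  | sep
  | fin
  | opn (o : Conn)
  | cls (o : Conn)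
  | prop (a : A)
  | val (b : B)

/-- The string that represents a formula, written with delimiters in prefix notation, given string
representations of propositions and truth-values. -/
def encodeWith {P D A B : Type} (eP : P → List A) (eD : D → List B) : NC P D → List (Tok A B)
  | const α β => Tok.const :: (eD α).map Tok.val ++ Tok.sep :: (eD β).map Tok.val ++ [Tok.fin]
  | pos X α => Tok.pos :: (eP X).map Tok.prop ++ Tok.sep :: (eD α).map Tok.val ++ [Tok.fin]
  | neg X α => Tok.neg :: (eP X).map Tok.prop ++ Tok.sep :: (eD α).map Tok.val ++ [Tok.fin]
  | node o φs => Tok.opn o :: (φs.map (encodeWith eP eD)).flatten ++ [Tok.cls o]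

/-- The string for an optional formula: empty if there is none. -/
def optEncodeWith {P D A B : Type} (eP : P → List A) (eD : D → List B) :
    Option (NC P D) → List (Tok A B)
  | none => []
  | some φ => encodeWith eP eD φ

end NC

/-- `f` is computable by a Turing machine in time polynomial in the length of the encoded input. -/
def PolyTime {α β A B : Type} (ea : α → List A) (eb : β → List B) (f : α → β) : Prop :=
  Nonempty (Turing.TM2ComputableInPolyTime ea eb f)

/-- The string for a pair: both strings, separated by an extra symbol. -/
def encodePair {D B : Type} (eD : D → List B) (p : D × D) : List (Option B) :=
  (eD p.1).map some ++ none :: (eD p.2).map some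

open Classical in
/-- Comparison of truth-values that are given by names. -/
noncomputable def nameLE {D T : Type*} [LinearOrder T] (val : D → T) (p : D × D) : Bool :=
  decide (val p.1 ≤ val p.2)

open Classical in
/-- The problem Reg-Horn-NC-SAT: the instances are the Horn-NC formulas (with truth-values given by
names), and the answer is whether the formula is satisfiable. -/
noncomputable def regHornNCSat {P D T : Type*} [LinearOrder T] (val : D → T)
    (φ : {φ : NC P D // NC.IsHNC φ}) : Bool :=
  decide (NC.Sat (NC.map val φ.1))

/-!
**The calculus.** Every rule preserves the models of a formula and makes the formula smaller, so
derivations have linear length (`NC.length_le_size`), and to unsatisfiable formulas only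
unsatisfiable ones are derived. Rules also preserve the Horn condition and the absence of constants
(`NC.Tame`). It remains that an irreducible conjunction has a model (`NC.Irreducible.sat`). Give
each proposition the largest value demanded by a unit `X ≥ α`, and without units a lower bound of
the values in its negative literals, of which there are finitely many. A negative literal that is
false in this interpretation would allow a clash, a merge or an application of `RUR`, so all
negative literals hold. Each remaining conjunct is a disjunction of at least two disjuncts; by the
Horn condition one of them has no positive literals, and it holds since no `(∨)` occurs in it.

**Polynomial time.** Mathlib's `TM2ComputableInPolyTime` has no closure properties, so a small
theory of polynomial time is developed. While-programs over registers, with calls of a given Turing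
machine as a subroutine, are compiled to Turing machines step by step (`Prog.runs_code`). Data are
binary trees, written to registers in prefix notation. `PTime O f` says that `f` is computed on such
trees by a program in polynomial time, where `O` stands for the subroutine that compares
truth-values. The class has the closure properties of a functional language in which recursion is
bounded by the size of its results: composition, pairs, case distinction, iteration over lists
(`PTime.foldl`), iteration as often as the size of the input says (`PTime.iterate`), search in a
list (`PTime.search`), and recursion on formulas by means of an explicit stack (`PTime.para`).

**The algorithms.** `NC.next` looks for an applicable rule by recursion on the formula, and reports
that there is none only if this is so (`NC.next_spec`). For the decision problem, constants are
replaced by `{∧}` or `(∨)`, the formula is made a conjunction, and `NC.next` is iterated; since the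
size decreases, as many iterations as the size of the formula lead to an irreducible formula, which
is compared with `(∨)` (`NC.sat_iff_iterate_step`). A parser and a printer connect strings and
trees; names are represented by words, which are compared letter by letter in the case of
propositions, and by the given machine in the case of truth-values.
-/

namespace NC

/-! ### The calculus is sound, terminating and refutation-complete -/

section Calculus

variable {P V T : Type*}

/-- Structural induction on formulas, with the induction hypothesis for all members of the list. -/
theorem induct {motive : NC P V → Prop} (const : ∀ α β, motive (const α β))
    (pos : ∀ X α, motive (pos X α)) (neg : ∀ X α, motive (neg X α))
    (node : ∀ o φs, (∀ φ ∈ φs, motive φ) → motive (node o φs)) : ∀ φ, motive φ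
  | .const α β => const α β
  | .pos X α => pos X α
  | .neg X α => neg X α
  | .node o φs => node o φs fun φ _ => induct const pos neg node φ

theorem size_pos (φ : NC P V) : 0 < size φ := by
  cases φ <;> simp [size]

@[simp]
theorem isSub_node_iff {ψ : NC P V} {o : Conn} {φs : List (NC P V)} :
    IsSub ψ (node o φs) ↔ ψ = node o φs ∨ ∃ φ ∈ φs, IsSub ψ φ := by
  constructor
  · rintro (_ | ⟨h, hs⟩)
    · exact .inl rfl
    · exact .inr ⟨_, h, hs⟩
  · rintro (rfl | ⟨φ, h, hs⟩)
    · exact .refl _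
    · exact .node h hs

@[simp]
theorem isSub_const_iff {ψ : NC P V} {α β : V} : IsSub ψ (const α β) ↔ ψ = const α β :=
  ⟨fun h => by cases h; rfl, fun h => h ▸ .refl _⟩

@[simp]
theorem isSub_pos_iff {ψ : NC P V} {X : P} {α : V} : IsSub ψ (pos X α) ↔ ψ = pos X α :=
  ⟨fun h => by cases h; rfl, fun h => h ▸ .refl _⟩

@[simp]
theorem isSub_neg_iff {ψ : NC P V} {X : P} {α : V} : IsSub ψ (neg X α) ↔ ψ = neg X α :=
  ⟨fun h => by cases h; rfl, fun h => h ▸ .refl _⟩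

@[simp]
theorem hasPos_node {o : Conn} {φs : List (NC P V)} :
    HasPos (node o φs) ↔ ∃ φ ∈ φs, HasPos φ := by
  simp only [HasPos, isSub_node_iff, reduceCtorEq, false_or]
  exact ⟨fun ⟨X, α, φ, h, hs⟩ => ⟨φ, h, X, α, hs⟩, fun ⟨φ, h, X, α, hs⟩ => ⟨X, α, φ, h, hs⟩⟩

@[simp]
theorem hasPos_pos {X : P} {α : V} : HasPos (pos X α) := ⟨X, α, .refl _⟩

@[simp]
theorem hasPos_const {α β : V} : ¬ HasPos (P := P) (const α β) := by simp [HasPos]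

@[simp]
theorem hasPos_neg {X : P} {α : V} : ¬ HasPos (neg X α) := by simp [HasPos]

@[simp]
theorem constFree_node {o : Conn} {φs : List (NC P V)} :
    ConstFree (node o φs) ↔ ∀ φ ∈ φs, ConstFree φ := by
  simp only [ConstFree, isSub_node_iff, reduceCtorEq, false_or, not_exists, not_and]
  exact ⟨fun h φ hφ α β => h α β φ hφ, fun h α β φ hφ => h φ hφ α β⟩

@[simp]
theorem constFree_pos {X : P} {α : V} : ConstFree (pos X α) := by simp [ConstFree]

@[simp]
theorem constFree_neg {X : P} {α : V} : ConstFree (neg X α) := by simp [ConstFree]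

@[simp]
theorem not_constFree_const {α β : V} : ¬ ConstFree (P := P) (const α β) := by simp [ConstFree]

@[simp]
theorem isHNC_and {φs : List (NC P V)} :
    IsHNC (node Conn.and φs) ↔ ∀ φ ∈ φs, IsHNC φ := by
  simp only [IsHNC, isSub_node_iff, node.injEq, reduceCtorEq, false_and, false_or]
  exact ⟨fun h φ hφ ψs hψ => h ψs ⟨φ, hφ, hψ⟩, fun h ψs ⟨φ, hφ, hψ⟩ => h φ hφ ψs hψ⟩

@[simp]
theorem isHNC_or {φs : List (NC P V)} :
    IsHNC (node Conn.or φs) ↔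
      (φs.Pairwise fun ψ χ => ¬ (HasPos ψ ∧ HasPos χ)) ∧ ∀ φ ∈ φs, IsHNC φ := by
  simp only [IsHNC, isSub_node_iff, node.injEq, true_and]
  constructor
  · exact fun h => ⟨h _ (.inl rfl), fun φ hφ ψs hψ => h ψs (.inr ⟨φ, hφ, hψ⟩)⟩
  · rintro ⟨h₁, h₂⟩ ψs (rfl | ⟨φ, hφ, hψ⟩)
    · exact h₁
    · exact h₂ φ hφ ψs hψ

@[simp]
theorem isHNC_const {α β : V} : IsHNC (P := P) (const α β) := by simp [IsHNC]

@[simp]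
theorem isHNC_pos {X : P} {α : V} : IsHNC (pos X α) := by simp [IsHNC]

@[simp]
theorem isHNC_neg {X : P} {α : V} : IsHNC (neg X α) := by simp [IsHNC]

theorem size_node_append_cons (o : Conn) (l r : List (NC P V)) (φ : NC P V) :
    size (node o (l ++ φ :: r)) = size φ + size (node o (l ++ r)) := by
  simp [size]; omega

/-- `Tame φ' φ`: passing from `φ` to `φ'` introduces neither positive literals nor constants nor
violations of the Horn condition. -/
def Tame (φ' φ : NC P V) : Prop :=
  (HasPos φ' → HasPos φ) ∧ (IsHNC φ → IsHNC φ') ∧ (ConstFree φ → ConstFree φ')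

theorem tame_bot (φ : NC P V) : Tame (.node Conn.or []) φ := by simp [Tame]

theorem Tame.node {φ φ' : NC P V} (h : Tame φ' φ) (o : Conn) (l r : List (NC P V)) :
    Tame (node o (l ++ φ' :: r)) (node o (l ++ φ :: r)) := by
  obtain ⟨h₁, h₂, h₃⟩ := h
  refine ⟨?_, ?_, ?_⟩
  · simp only [hasPos_node, List.mem_append, List.mem_cons]
    rintro ⟨φ₀, h | rfl | h, hp⟩
    · exact ⟨φ₀, .inl h, hp⟩
    · exact ⟨φ, .inr (.inl rfl), h₁ hp⟩
    · exact ⟨φ₀, .inr (.inr h), hp⟩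
  · cases o
    · simp only [isHNC_and, List.forall_mem_append, List.forall_mem_cons]
      tauto
    · simp only [isHNC_or, List.forall_mem_append, List.forall_mem_cons,
        List.pairwise_append, List.pairwise_cons]
      rintro ⟨⟨a₁, ⟨a₂, a₃⟩, a₄⟩, a₅, a₆, a₇⟩
      exact ⟨⟨a₁, ⟨fun a ha h => a₂ a ha ⟨h₁ h.1, h.2⟩, a₃⟩,
        fun a ha => ⟨fun h => (a₄ a ha).1 ⟨h.1, h₁ h.2⟩, (a₄ a ha).2⟩⟩, a₅, h₂ a₆, a₇⟩
  · simp only [constFree_node, List.forall_mem_append, List.forall_mem_cons]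
    tauto

theorem tame_drop (φ : NC P V) (l r : List (NC P V)) :
    Tame (node Conn.or (l ++ r)) (node Conn.or (l ++ φ :: r)) := by
  refine ⟨?_, ?_, ?_⟩
  · simp only [hasPos_node, List.mem_append, List.mem_cons]
    rintro ⟨φ₀, h | h, hp⟩ <;> exact ⟨φ₀, by simp [h], hp⟩
  · simp only [isHNC_or, List.forall_mem_append, List.forall_mem_cons,
      List.pairwise_append, List.pairwise_cons]
    rintro ⟨⟨a₁, ⟨a₂, a₃⟩, a₄⟩, a₅, a₆, a₇⟩
    exact ⟨⟨a₁, a₃, fun a ha => (a₄ a ha).2⟩, a₅, a₇⟩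
  · simp only [constFree_node, List.forall_mem_append, List.forall_mem_cons]
    tauto

variable [LinearOrder T]

@[simp]
theorem holds_and {I : P → T} {φs : List (NC P T)} :
    Holds I (node Conn.and φs) ↔ ∀ φ ∈ φs, Holds I φ := by
  simp [Holds]

@[simp]
theorem holds_or {I : P → T} {φs : List (NC P T)} :
    Holds I (node Conn.or φs) ↔ ∃ φ ∈ φs, Holds I φ := by
  simp [Holds]

@[simp]
theorem holds_pos {I : P → T} {X : P} {α : T} : Holds I (pos X α) ↔ α ≤ I X := by
  simp [Holds]

@[simp]
theorem holds_neg {I : P → T} {X : P} {α : T} : Holds I (neg X α) ↔ I X ≤ α := by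
  simp [Holds]

theorem holds_node_congr {I : P → T} {φ φ' : NC P T} (h : Holds I φ ↔ Holds I φ') (o : Conn)
    (l r : List (NC P T)) :
    Holds I (node o (l ++ φ :: r)) ↔ Holds I (node o (l ++ φ' :: r)) := by
  cases o <;> simp [or_imp, forall_and, or_and_right, exists_or, h]

theorem ConjWith.holds {I : P → T} {ℓ C : NC P T} (h : ConjWith ℓ C) (hC : Holds I C) :
    Holds I ℓ := by
  induction h with
  | lit => exact hC
  | conj h _ ih => exact ih (holds_and.1 hC _ h)

theorem Cut.holds_iff {I : P → T} {X : P} {α : T} {φ φ' : NC P T} (h : Cut X α φ φ')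
    (hI : α ≤ I X) : Holds I φ ↔ Holds I φ' := by
  induction h with
  | @here β C l r hβ hC =>
    have : ¬ Holds I C := fun h => not_le_of_gt hβ (hI.trans (holds_neg.1 (hC.holds h)))
    simp [or_and_right, exists_or, this]
  | deep o l r _ ih => exact holds_node_congr ih o l r

theorem RUR.holds_iff {I : P → T} {φ φ' : NC P T} (h : RUR φ φ') : Holds I φ ↔ Holds I φ' := by
  obtain @⟨X, α, φ, φ', l, r, hu, hcut⟩ := h
  by_cases hI : α ≤ I X
  · exact holds_node_congr (hcut.holds_iff hI) _ l r
  · have key : ∀ ψ, ¬ Holds I (node Conn.and (l ++ ψ :: r)) := fun ψ hψ => hI <|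
      holds_pos.1 (holds_and.1 hψ _ (by
        rcases List.mem_append.1 hu with h | h <;> simp [h]))
    exact iff_of_false (key _) (key _)

theorem SimpRule.holds_iff {I : P → T} {φ φ' : NC P T} (h : SimpRule φ φ') :
    Holds I φ ↔ Holds I φ' := by
  cases h with
  | orBot l r => simp [or_and_right, exists_or]
  | andBot l r => simp [or_imp, forall_and]
  | single o₂ o₁ φ l r => exact holds_node_congr (by cases o₁ <;> simp) _ l r
  | merge o φs l r =>
    cases o
    · simp [or_imp, forall_and]
    · simp [or_and_right, exists_or]
  | clash hp hn h =>
    simp only [holds_and, holds_or, List.not_mem_nil, false_and, exists_false, iff_false]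
    exact fun hI => not_le_of_gt h
      ((holds_pos.1 (hI _ hp)).trans (holds_neg.1 (hI _ hn)))
  | max X α β l m r => simp [or_imp, forall_and]; tauto

theorem Simplify.holds_iff {I : P → T} {φ φ' : NC P T} (h : Simplify φ φ') :
    Holds I φ ↔ Holds I φ' := by
  induction h with
  | here h => exact h.holds_iff
  | deep o l r _ ih => exact holds_node_congr ih o l r

theorem Infer.sat_iff {φ φ' : NC P T} (h : Infer φ φ') : Sat φ ↔ Sat φ' :=
  exists_congr fun _ => h.elim RUR.holds_iff Simplify.holds_iff

theorem Derives.sat_iff {φ φ' : NC P T} (h : Derives φ φ') : Sat φ ↔ Sat φ' := by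
  induction h with
  | refl => rfl
  | tail _ h ih => exact ih.trans h.sat_iff

theorem Cut.tame {X : P} {α : T} {φ φ' : NC P T} (h : Cut X α φ φ') : Tame φ' φ := by
  induction h with
  | here l r _ _ => exact tame_drop _ l r
  | deep o l r _ ih => exact ih.node o l r

theorem SimpRule.tame {φ φ' : NC P T} (h : SimpRule φ φ') : Tame φ' φ := by
  cases h with
  | andBot l r => exact tame_bot _
  | clash hp hn h => exact tame_bot _
  | single o₂ o₁ φ l r =>
    exact Tame.node (by cases o₁ <;> simp [Tame]) _ l r
  | orBot l r => exact tame_drop _ l r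
  | merge o φs l r =>
    refine ⟨?_, ?_, ?_⟩
    · simp only [hasPos_node, List.mem_append, List.mem_cons]
      rintro ⟨φ₀, (h | h) | h, hp⟩
      · exact ⟨φ₀, .inl h, hp⟩
      · exact ⟨_, .inr (.inl rfl), by simpa using ⟨φ₀, h, hp⟩⟩
      · exact ⟨φ₀, .inr (.inr h), hp⟩
    · cases o
      · simp only [isHNC_and, List.forall_mem_append, List.forall_mem_cons]
        tauto
      · simp only [isHNC_or, List.forall_mem_append, List.forall_mem_cons,
          List.pairwise_append, List.pairwise_cons, hasPos_node]
        rintro ⟨⟨h₁, ⟨h₂, h₃⟩, h₄⟩, h₆, ⟨h₇, h₈⟩, h₉⟩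
        exact ⟨⟨⟨h₁, h₇, fun a ha b hb hab => (h₄ a ha).1 ⟨hab.1, b, hb, hab.2⟩⟩, h₃,
          fun a ha => (h₄ a ha).2, fun a ha b hb hab => h₂ b hb ⟨⟨a, ha, hab.1⟩, hab.2⟩⟩,
          ⟨h₆, h₈⟩, h₉⟩
    · simp only [constFree_node, List.forall_mem_append, List.forall_mem_cons]
      tauto
  | max X α β l m r =>
    refine ⟨?_, ?_, ?_⟩
    · exact fun _ => hasPos_node.2 ⟨pos X α, by simp, hasPos_pos⟩
    · simp only [isHNC_and, List.forall_mem_append, List.forall_mem_cons, isHNC_pos]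
      tauto
    · simp only [constFree_node, List.forall_mem_append, List.forall_mem_cons,
        constFree_pos]
      tauto

theorem Infer.tame {φ φ' : NC P T} (h : Infer φ φ') : Tame φ' φ := by
  rcases h with ⟨l, r, _, hcut⟩ | h
  · exact hcut.tame.node _ l r
  · induction h with
    | here h => exact h.tame
    | deep o l r _ ih => exact ih.node o l r

theorem Cut.size_lt {X : P} {α : T} {φ φ' : NC P T} (h : Cut X α φ φ') : size φ' < size φ := by
  induction h with
  | here l r _ _ => rw [size_node_append_cons]; have := size_pos (P := P) (V := T); grind
  | deep o l r _ ih => simp only [size_node_append_cons]; omega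

theorem SimpRule.size_lt {φ φ' : NC P T} (h : SimpRule φ φ') : size φ' < size φ := by
  cases h with
  | andBot l r => simp [size]
  | clash hp hn h =>
    obtain ⟨l, r, rfl⟩ := List.append_of_mem hp
    simp [size]
  | single o₂ o₁ φ l r => simp [size]
  | orBot l r => simp [size]
  | merge o φs l r => simp [size]
  | max X α β l m r => simp [size]

theorem Infer.size_lt {φ φ' : NC P T} (h : Infer φ φ') : size φ' < size φ := by
  rcases h with ⟨l, r, _, hcut⟩ | h
  · have := hcut.size_lt
    simp only [size_node_append_cons]; omega
  · induction h with
    | here h => exact h.size_lt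
    | deep o l r _ ih => simp only [size_node_append_cons]; omega

theorem exists_derives_irreducible (φ : NC P T) : ∃ ψ, Derives φ ψ ∧ Irreducible ψ := by
  induction hn : size φ using Nat.strong_induction_on generalizing φ with
  | _ n ih =>
    by_cases h : Irreducible φ
    · exact ⟨φ, .refl, h⟩
    · simp only [Irreducible, not_forall, not_not] at h
      obtain ⟨ψ, hψ⟩ := h
      obtain ⟨χ, h₁, h₂⟩ := ih _ (hn ▸ hψ.size_lt) ψ rfl
      exact ⟨χ, .head hψ h₁, h₂⟩

/-- Only rules that yield `(∨)` change the connective of a conjunction. -/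
theorem Infer.isConj_or_bot {φs : List (NC P T)} {φ' : NC P T}
    (h : Infer (node Conn.and φs) φ') :
    (∃ φs', φ' = node Conn.and φs') ∨ φ' = node Conn.or [] := by
  generalize hφ : node Conn.and φs = φ at h
  rcases h with ⟨l, r, _, hcut⟩ | h
  · exact .inl ⟨_, rfl⟩
  · cases h with
    | deep o l r h => cases hφ; exact .inl ⟨_, rfl⟩
    | here h =>
      cases h <;> cases hφ <;> simp

theorem bot_irreducible : Irreducible (node Conn.or [] : NC P T) := by
  intro ψ h
  have := h.size_lt
  have := size_pos ψ
  simp [size] at *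
  omega

theorem Derives.isConj_or_bot {φs : List (NC P T)} {φ' : NC P T}
    (h : Derives (node Conn.and φs) φ') :
    (∃ φs', φ' = node Conn.and φs') ∨ φ' = node Conn.or [] := by
  induction h with
  | refl => exact .inl ⟨_, rfl⟩
  | tail _ h ih =>
    rcases ih with ⟨φs', rfl⟩ | rfl
    · exact h.isConj_or_bot
    · exact absurd h (bot_irreducible _)

theorem Derives.tame {φ φ' : NC P T} (h : Derives φ φ') : Tame φ' φ := by
  induction h with
  | refl => exact ⟨id, id, id⟩
  | tail _ h ih =>
    have := h.tame
    exact ⟨ih.1 ∘ this.1, this.2.1 ∘ ih.2.1, this.2.2 ∘ ih.2.2⟩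

/-- A negative literal that a unit `X ≥ α` falsifies is either under conjunctions only, or lies in a
disjunct that can be cut. -/
theorem conjWith_or_cut {X : P} {α β : T} (hβ : β < α) {φ : NC P T} (h : IsSub (neg X β) φ) :
    ConjWith (neg X β) φ ∨ ∃ φ', Cut X α φ φ' := by
  induction φ using NC.induct with
  | const _ _ => simp at h
  | pos _ _ => simp at h
  | neg _ _ => rw [isSub_neg_iff] at h; exact .inl (h ▸ .lit)
  | node o φs ih =>
    simp only [isSub_node_iff, reduceCtorEq, false_or] at h
    obtain ⟨φ, hφ, hs⟩ := h
    rcases ih φ hφ hs with hc | ⟨φ', hc⟩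
    · cases o
      · exact .inl (.conj hφ hc)
      · obtain ⟨l, r, rfl⟩ := List.append_of_mem hφ
        exact .inr ⟨_, .here l r hβ hc⟩
    · obtain ⟨l, r, rfl⟩ := List.append_of_mem hφ
      exact .inr ⟨_, .deep o l r hc⟩

/-- In a simplified formula other than `(∨)` no `(∨)` occurs, so a formula without positive literals
holds as soon as all its negative literals do. -/
theorem holds_of_neg {I : P → T} {φ : NC P T} (hs : ∀ ψ, ¬ Simplify φ ψ)
    (hbot : φ ≠ node Conn.or []) (hcf : ConstFree φ) (hp : ¬ HasPos φ)
    (hn : ∀ X β, IsSub (neg X β) φ → I X ≤ β) : Holds I φ := by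
  induction φ using NC.induct with
  | const _ _ => simp at hcf
  | pos _ _ => simp at hp
  | neg X β => exact holds_neg.2 (hn X β (.refl _))
  | node o φs ih =>
    have key : ∀ φ ∈ φs, Holds I φ := by
      intro φ hφ
      obtain ⟨l, r, rfl⟩ := List.append_of_mem hφ
      refine ih φ hφ (fun ψ h => hs _ (.deep o l r h)) ?_ (constFree_node.1 hcf φ hφ)
        (fun h => hp (hasPos_node.2 ⟨φ, hφ, h⟩)) (fun X β h => hn X β (.node hφ h))
      rintro rfl
      cases o
      · exact hs _ (.here (.andBot l r))
      · exact hs _ (.here (.orBot l r))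
    cases o
    · exact holds_and.2 key
    · cases φs with
      | nil => exact absurd rfl hbot
      | cons φ l => exact holds_or.2 ⟨φ, by simp, key φ (by simp)⟩

/-- The negative literals of a proposition have a lower bound, because there are finitely many and
the order is total. -/
theorem exists_le_neg [Nonempty T] (X : P) (φ : NC P T) :
    ∃ m, ∀ β, IsSub (neg X β) φ → m ≤ β := by
  induction φ using NC.induct with
  | const _ _ => simp
  | pos _ _ => simp
  | neg Y β =>
    refine ⟨β, fun γ h => ?_⟩
    cases h
    exact le_rfl
  | node o φs ih =>
    simp only [isSub_node_iff, reduceCtorEq, false_or]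
    induction φs with
    | nil => simp
    | cons φ l ihl =>
      obtain ⟨m₁, h₁⟩ := ihl fun φ hφ => ih φ (by simp [hφ])
      obtain ⟨m₂, h₂⟩ := ih φ (by simp)
      refine ⟨min m₁ m₂, ?_⟩
      rintro β ⟨ψ, hψ, hs⟩
      rcases List.mem_cons.1 hψ with rfl | hψ
      · exact (min_le_right _ _).trans (h₂ β hs)
      · exact (min_le_left _ _).trans (h₁ β ⟨ψ, hψ, hs⟩)

/-- The model: a proposition gets the largest value that a unit demands, and without a unit a value
below those of all its negative literals. No negative literal is then false, since `RUR` or a clash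
would apply to it, and every disjunction has a disjunct without positive literals. -/
theorem Irreducible.sat [Nonempty T] {φs : List (NC P T)} (hirr : Irreducible (node Conn.and φs))
    (hh : IsHNC (node Conn.and φs)) (hcf : ConstFree (node Conn.and φs)) :
    Sat (node Conn.and φs) := by
  have hval : ∀ X : P, ∃ v : T, (∀ α, pos X α ∈ φs → α ≤ v) ∧
      (pos X v ∈ φs ∨ ∀ β, IsSub (neg X β) (node Conn.and φs) → v ≤ β) := by
    intro X
    by_cases hX : ∃ α, pos X α ∈ φs
    · have hfin : {α | pos X α ∈ φs}.Finite :=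
        (List.finite_toSet φs).preimage fun a _ b _ h => by simpa using h
      obtain ⟨v, hv, hmax⟩ := Set.exists_max_image _ id hfin hX
      exact ⟨v, hmax, .inl hv⟩
    · obtain ⟨m, hm⟩ := exists_le_neg X (node Conn.and φs)
      exact ⟨m, fun α h => absurd ⟨α, h⟩ hX, .inr hm⟩
  choose I hpos hI using hval
  have hneg : ∀ φ ∈ φs, ∀ X β, IsSub (neg X β) φ → I X ≤ β := by
    intro φ hφ X β hs
    by_contra hlt
    rw [not_le] at hlt
    rcases hI X with hu | hm
    · rcases conjWith_or_cut hlt hs with hc | ⟨φ', hc⟩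
      · cases hc with
        | lit => exact hirr _ (.inr (.here (.clash hu hφ hlt)))
        | conj _ _ =>
          -- `φ` is a conjunction, which could be merged with the formula
          obtain ⟨l, r, rfl⟩ := List.append_of_mem hφ
          exact hirr _ (.inr (.here (.merge Conn.and _ l r)))
      · obtain ⟨l, r, rfl⟩ := List.append_of_mem hφ
        have hu' : pos X (I X) ∈ l ++ r := by
          simp only [List.mem_append, List.mem_cons] at hu ⊢
          rcases hu with hu | hu | hu
          · exact .inl hu
          -- `φ` is not the unit itself, since nothing can be cut from a literal
          · subst hu; cases hc
          · exact .inr hu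
        exact hirr _ (.inl (.mk l r hu' hc))
    · exact absurd (hm β (.node hφ hs)) (not_le_of_gt hlt)
  refine ⟨I, holds_and.2 fun φ hφ => ?_⟩
  have hsimp : ∀ ψ, ¬ Simplify φ ψ := by
    intro ψ h
    obtain ⟨l, r, rfl⟩ := List.append_of_mem hφ
    exact hirr _ (.inr (.deep _ l r h))
  cases φ with
  | const α β => exact absurd (constFree_node.1 hcf _ hφ) not_constFree_const
  | pos X α => exact holds_pos.2 (hpos X α hφ)
  | neg X β => exact holds_neg.2 (hneg _ hφ X β (.refl _))
  | node o ψs =>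
    have hφ' := hφ
    obtain ⟨l, r, rfl⟩ := List.append_of_mem hφ
    cases o with
    | and => exact absurd (.inr (.here (.merge Conn.and _ l r))) (hirr _)
    | or =>
      match ψs, hφ', hsimp with
      | [], _, _ => exact absurd (.inr (.here (.andBot l r))) (hirr _)
      | [ψ], _, _ => exact absurd (.inr (.here (.single _ _ ψ l r))) (hirr _)
      | ψ₁ :: ψ₂ :: ψs, hφ', hsimp =>
        -- a disjunct without positive literals holds, and one of the first two is such
        have key : ∀ ψ ∈ ψ₁ :: ψ₂ :: ψs, ¬ HasPos ψ → Holds I ψ := by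
          intro ψ hψ hp
          obtain ⟨l', r', hlr⟩ := List.append_of_mem hψ
          refine holds_of_neg
            (fun χ h => hsimp (node _ (l' ++ χ :: r')) (by rw [hlr]; exact .deep _ l' r' h)) ?_
            (constFree_node.1 (constFree_node.1 hcf _ hφ') _ hψ) hp
            fun X β h => hneg _ hφ' X β (.node hψ h)
          rintro rfl
          exact hsimp (node _ (l' ++ r')) (by rw [hlr]; exact .here (.orBot l' r'))
        have hpair := ((isHNC_or.1 (isHNC_and.1 hh _ hφ')).1 : List.Pairwise _ _)
        rw [List.pairwise_cons] at hpair
        have h₁₂ := hpair.1 ψ₂ (by simp)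
        by_cases h₁ : HasPos ψ₁
        · exact holds_or.2 ⟨ψ₂, by simp, key ψ₂ (by simp) fun h => h₁₂ ⟨h₁, h⟩⟩
        · exact holds_or.2 ⟨ψ₁, by simp, key ψ₁ (by simp) h₁⟩

theorem not_sat_bot : ¬ Sat (node Conn.or [] : NC P T) := by simp [Sat]

theorem Derives.not_sat_iff [Nonempty T] {φs : List (NC P T)} (hh : IsHNC (node Conn.and φs))
    (hcf : ConstFree (node Conn.and φs)) {ψ : NC P T} (hd : Derives (node Conn.and φs) ψ)
    (hirr : Irreducible ψ) : ¬ Sat (node Conn.and φs) ↔ ψ = node Conn.or [] := by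
  rw [hd.sat_iff]
  constructor
  · intro h
    rcases hd.isConj_or_bot with ⟨φs', rfl⟩ | h'
    · exact absurd (hirr.sat (hd.tame.2.1 hh) (hd.tame.2.2 hcf)) h
    · exact h'
  · rintro rfl
    exact not_sat_bot

theorem not_sat_iff_derives [Nonempty T] {φs : List (NC P T)} (hh : IsHNC (node Conn.and φs))
    (hcf : ConstFree (node Conn.and φs)) :
    ¬ Sat (node Conn.and φs) ↔ Derives (node Conn.and φs) (node Conn.or []) := by
  constructor
  · intro h
    obtain ⟨ψ, hd, hirr⟩ := exists_derives_irreducible (node Conn.and φs)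
    exact (hd.not_sat_iff hh hcf hirr).1 h ▸ hd
  · exact fun hd => (hd.not_sat_iff hh hcf bot_irreducible).2 rfl

/-- Each inference makes the formula smaller. -/
theorem length_le_size {n : ℕ} {s : ℕ → NC P T} (h : ∀ i < n, Infer (s i) (s (i + 1))) :
    n ≤ size (s 0) := by
  have key : ∀ k ≤ n, k + size (s k) ≤ size (s 0) := by
    intro k
    induction k with
    | zero => simp
    | succ k ih =>
      intro hk
      have := ih (by omega)
      have := (h k (by omega)).size_lt
      omega
  have := key n le_rfl
  omega

end Calculus

end NC

open Turing

/-! ### While-programs over registers, compiled to Turing machines -/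

/-- While-programs that work on registers `0, 1, 2, …`, each of which holds a stack of symbols: push
a symbol, pop a symbol and continue according to what it was, compose, loop as long as a register
has a top symbol that passes a test, and replace the contents of a register with the result of an
external subroutine. -/
inductive Prog (Γ : Type) where
  | skip
  | push (r : ℕ) (a : Γ)
  | pop (r : ℕ) (k : Option Γ → Prog Γ)
  | seq (p q : Prog Γ)
  | loop (r : ℕ) (test : Γ → Bool) (p : Prog Γ)
  | call (r : ℕ)

/-- `Exec O p s s' t`: started with register contents `s`, the program `p` ends with `s'` in time
`t`. Here `O x y t` says that the subroutine turns `x` into `y` in time `t`; this time has to cover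
the length of `y`, so that registers grow by at most one symbol in each unit of time. -/
inductive Exec {Γ : Type} (O : List Γ → List Γ → ℕ → Prop) :
    Prog Γ → (ℕ → List Γ) → (ℕ → List Γ) → ℕ → Prop where
  | skip (s) : Exec O .skip s s 1
  | push (r a s) : Exec O (.push r a) s (Function.update s r (a :: s r)) 1
  | pop {r k s s' t} (h : Exec O (k (s r).head?) (Function.update s r (s r).tail) s' t) :
      Exec O (.pop r k) s s' (1 + t)
  | seq {p q s₁ s₂ s₃ t₁ t₂} (h₁ : Exec O p s₁ s₂ t₁) (h₂ : Exec O q s₂ s₃ t₂) :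
      Exec O (.seq p q) s₁ s₃ (t₁ + t₂)
  | done {r test p s} (h : (s r).head?.any test = false) : Exec O (.loop r test p) s s 1
  | loop {r test p s₁ s₂ s₃ t₁ t₂} (h : (s₁ r).head?.any test = true) (h₁ : Exec O p s₁ s₂ t₁)
      (h₂ : Exec O (.loop r test p) s₂ s₃ t₂) : Exec O (.loop r test p) s₁ s₃ (1 + t₁ + t₂)
  | call {r s y t} (h : O (s r) y t) (hy : y.length ≤ t) : Exec O (.call r) s
      (Function.update s r y) t

/-- All registers that the program mentions are at most `N`. -/
def Prog.Below {Γ : Type} (N : ℕ) : Prog Γ → Prop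
  | .skip => True
  | .push r _ => r ≤ N
  | .pop r k => r ≤ N ∧ ∀ o, (k o).Below N
  | .seq p q => p.Below N ∧ q.Below N
  | .loop r _ p => r ≤ N ∧ p.Below N
  | .call r => r ≤ N

theorem Prog.Below.mono {Γ : Type} {N N' : ℕ} (h : N ≤ N') {p : Prog Γ} (hp : p.Below N) :
    p.Below N' := by
  induction p with
  | skip => trivial
  | push r a => exact le_trans hp h
  | pop r k ih => exact ⟨hp.1.trans h, fun o => ih o (hp.2 o)⟩
  | seq p q ih₁ ih₂ => exact ⟨ih₁ hp.1, ih₂ hp.2⟩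
  | loop r test p ih => exact ⟨hp.1.trans h, ih hp.2⟩
  | call r => exact le_trans hp h

theorem Prog.exists_below {Γ : Type} [Finite Γ] (p : Prog Γ) : ∃ N, p.Below N := by
  induction p with
  | skip => exact ⟨0, trivial⟩
  | push r a => exact ⟨r, le_rfl⟩
  | pop r k ih =>
    choose N hN using ih
    obtain ⟨M, hM⟩ := (Set.finite_range N).bddAbove
    exact ⟨max r M, le_max_left _ _,
      fun o => (hN o).mono ((hM ⟨o, rfl⟩).trans (le_max_right _ _))⟩
  | seq p q ih₁ ih₂ =>
    obtain ⟨N, hN⟩ := ih₁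
    obtain ⟨M, hM⟩ := ih₂
    exact ⟨max N M, hN.mono (le_max_left _ _), hM.mono (le_max_right _ _)⟩
  | loop r test p ih =>
    obtain ⟨N, hN⟩ := ih
    exact ⟨max r N, le_max_left _ _, hN.mono (le_max_right _ _)⟩
  | call r => exact ⟨r, le_rfl⟩

namespace Prog

section Compile

variable {Γ : Type} (tm : FinTM2) (ΓI ΓO : Type) (N : ℕ)

/-- The stacks of the compiled machine: input, output, the registers up to `N`, and the stacks of
the subroutine. -/
abbrev Stk : Type := Bool ⊕ Fin (N + 1) ⊕ tm.K

variable (Γ) in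
/-- The stack alphabets of the compiled machine. -/
abbrev Alph : Stk tm N → Type
  | .inl false => ΓI
  | .inl true => ΓO
  | .inr (.inl _) => Γ
  | .inr (.inr k) => tm.Γ k

/-- The control labels for a program; those of a call contain the labels of the subroutine. -/
def Lab : Prog Γ → Type
  | .skip => Unit
  | .push _ _ => Unit
  | .pop _ k => Option (Σ o, (k o).Lab)
  | .seq p q => p.Lab ⊕ q.Lab
  | .loop _ _ p => Option p.Lab
  | .call _ => Bool ⊕ tm.Λ

/-- The label at which a program starts. -/
def entry : (p : Prog Γ) → p.Lab tm
  | .skip => ()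
  | .push _ _ => ()
  | .pop _ _ => none
  | .seq p _ => .inl p.entry
  | .loop _ _ _ => none
  | .call _ => .inl false

theorem finite_lab [Finite Γ] (p : Prog Γ) : Finite (p.Lab tm) := by
  have := tm.ΛFin
  induction p with
  | skip => exact inferInstanceAs (Finite Unit)
  | push r a => exact inferInstanceAs (Finite Unit)
  | pop r k ih => exact inferInstanceAs (Finite (Option (Σ o, (k o).Lab tm)))
  | seq p q ih₁ ih₂ => exact inferInstanceAs (Finite (p.Lab tm ⊕ q.Lab tm))
  | loop r test p ih => exact inferInstanceAs (Finite (Option (p.Lab tm)))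
  | call r => exact inferInstanceAs (Finite (Bool ⊕ tm.Λ))

variable {ΓI ΓO}

/-- A statement of the subroutine as a statement of the compiled machine; halting becomes a jump. -/
def embed {L : Type} (emb : tm.Λ → L) (exit : L) :
    TM2.Stmt tm.Γ tm.Λ tm.σ → TM2.Stmt (Alph Γ tm ΓI ΓO N) L (tm.σ × Option Γ)
  | .push k f q => .push (.inr (.inr k)) (fun v => f v.1) (embed emb exit q)
  | .peek k f q => .peek (.inr (.inr k)) (fun v a => (f v.1 a, v.2)) (embed emb exit q)
  | .pop k f q => .pop (.inr (.inr k)) (fun v a => (f v.1 a, v.2)) (embed emb exit q)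
  | .load f q => .load (fun v => (f v.1, v.2)) (embed emb exit q)
  | .branch f q₁ q₂ => .branch (fun v => f v.1) (embed emb exit q₁) (embed emb exit q₂)
  | .goto f => .goto fun v => emb (f v.1)
  | .halt => .goto fun _ => exit

/-- One step of moving a stack to another one: pop a symbol, translate it, push it and repeat, or
leave if there is none. The popped symbol is kept in the second component of the machine state. -/
def transfer [Inhabited Γ] {L : Type} (k k' : Stk tm N) (f : Alph Γ tm ΓI ΓO N k → Γ)
    (g : Γ → Alph Γ tm ΓI ΓO N k') (self : L)
    (exit : TM2.Stmt (Alph Γ tm ΓI ΓO N) L (tm.σ × Option Γ)) :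
    TM2.Stmt (Alph Γ tm ΓI ΓO N) L (tm.σ × Option Γ) :=
  .pop k (fun v a => (v.1, a.map f)) <|
    .branch (fun v => v.2.isSome) (.push k' (fun v => g (v.2.getD default)) <| .goto fun _ => self)
      exit

/-- The machine code of a program; `emb` places its labels among all labels, and `exit` is the label
to go to in the end. -/
def code [Inhabited Γ] (toIn : Γ → tm.Γ tm.k₀) (ofOut : tm.Γ tm.k₁ → Γ) {L : Type} :
    (p : Prog Γ) → (emb : p.Lab tm → L) → (exit : L) → p.Lab tm →
      TM2.Stmt (Alph Γ tm ΓI ΓO N) L (tm.σ × Option Γ)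
  | .skip, _, exit, _ => .goto fun _ => exit
  | .push r a, _, exit, _ => .push (.inr (.inl (Fin.ofNat (N + 1) r))) (fun _ => a) <|
      .goto fun _ => exit
  | .pop r k, emb, _, none => .pop (.inr (.inl (Fin.ofNat (N + 1) r))) (fun v a => (v.1, a)) <|
      .goto fun v => emb (some ⟨v.2, (k v.2).entry tm⟩)
  | .pop _ k, emb, exit, some ⟨o, l⟩ =>
      code toIn ofOut (k o) (fun l => emb (some ⟨o, l⟩)) exit l
  | .seq p q, emb, _, .inl l =>
      code toIn ofOut p (fun l => emb (.inl l)) (emb (.inr (q.entry tm))) l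
  | .seq _ q, emb, exit, .inr l => code toIn ofOut q (fun l => emb (.inr l)) exit l
  | .loop r test p, emb, exit, none =>
      .peek (.inr (.inl (Fin.ofNat (N + 1) r))) (fun v a => (v.1, a)) <|
        .branch (fun v => v.2.any test) (.goto fun _ => emb (some (p.entry tm)))
          (.goto fun _ => exit)
  | .loop _ _ p, emb, _, some l => code toIn ofOut p (fun l => emb (some l)) (emb none) l
  | .call r, emb, _, .inl false =>
      transfer tm N (.inr (.inl (Fin.ofNat (N + 1) r))) (.inr (.inr tm.k₀)) id toIn
        (emb (.inl false)) (.goto fun _ => emb (.inr tm.main))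
  | .call r, emb, exit, .inl true =>
      transfer tm N (.inr (.inr tm.k₁)) (.inr (.inl (Fin.ofNat (N + 1) r))) ofOut id
        (emb (.inl true)) (.goto fun _ => exit)
  | .call _, emb, _, .inr l =>
      embed tm N (fun l => emb (.inr l)) (emb (.inl true)) (tm.m l)

/-- All stacks of the compiled machine, put together. -/
def stk (i : List ΓI) (o : List ΓO) (s : ℕ → List Γ) (u : ∀ k, List (tm.Γ k)) :
    ∀ k, List (Alph Γ tm ΓI ΓO N k)
  | .inl false => i
  | .inl true => o
  | .inr (.inl r) => s r
  | .inr (.inr k) => u k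

variable {tm N}

theorem update_stk_inp (i i' : List ΓI) (o : List ΓO) (s : ℕ → List Γ)
    (u : ∀ k, List (tm.Γ k)) :
    Function.update (stk tm N i o s u) (.inl false) i' = stk tm N i' o s u := by
  funext k
  rcases k with (_ | _) | r | k <;> simp [Function.update, stk]

theorem update_stk_out (i : List ΓI) (o o' : List ΓO) (s : ℕ → List Γ)
    (u : ∀ k, List (tm.Γ k)) :
    Function.update (stk tm N i o s u) (.inl true) o' = stk tm N i o' s u := by
  funext k
  rcases k with (_ | _) | r | k <;> simp [Function.update, stk]

theorem update_stk_reg (i : List ΓI) (o : List ΓO) (s : ℕ → List Γ)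
    (u : ∀ k, List (tm.Γ k)) {r : ℕ} (hr : r ≤ N) (l : List Γ) :
    Function.update (stk tm N i o s u) (.inr (.inl (Fin.ofNat (N + 1) r))) l =
      stk tm N i o (Function.update s r l) u := by
  have hr' : r % (N + 1) = r := Nat.mod_eq_of_lt (by omega)
  funext k
  rcases k with (_ | _) | r' | k
  · simp [Function.update, stk]
  · simp [Function.update, stk]
  · by_cases h : r' = Fin.ofNat (N + 1) r
    · subst h; simp [stk, hr']
    · rw [Function.update_of_ne (by simpa using h)]
      have h' : (r' : ℕ) ≠ r := fun e => h (Fin.ext (by simp [e, hr']))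
      simp [stk, Function.update_of_ne h']
  · simp [Function.update, stk]

theorem update_stk_sub (i : List ΓI) (o : List ΓO) (s : ℕ → List Γ)
    (u : ∀ k, List (tm.Γ k)) (k : tm.K) (l : List (tm.Γ k)) :
    Function.update (stk tm N i o s u) (.inr (.inr k)) l =
      stk tm N i o s (Function.update u k l) := by
  funext k'
  rcases k' with (_ | _) | r' | k'
  · simp [Function.update, stk]
  · simp [Function.update, stk]
  · simp [Function.update, stk]
  · by_cases h : k' = k
    · subst h; simp [stk]
    · rw [Function.update_of_ne (by simpa using h)]
      simp [stk, Function.update_of_ne h]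

theorem stk_reg (i : List ΓI) (o : List ΓO) (s : ℕ → List Γ)
    (u : ∀ k, List (tm.Γ k)) {r : ℕ} (hr : r ≤ N) :
    stk tm N i o s u (.inr (.inl (Fin.ofNat (N + 1) r))) = s r := by
  have hr' : r % (N + 1) = r := Nat.mod_eq_of_lt (by omega)
  simp [stk, hr']

/-- The machine `M` gets from `c` to `c'` in `n` steps. -/
def Runs {K L σ : Type} [DecidableEq K] {A : K → Type} (M : L → TM2.Stmt A L σ)
    (c c' : TM2.Cfg A L σ) (n : ℕ) : Prop :=
  (flip bind (TM2.step M))^[n] (some c) = some c'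

theorem Runs.refl {K L σ : Type} [DecidableEq K] {A : K → Type} {M : L → TM2.Stmt A L σ}
    (c : TM2.Cfg A L σ) : Runs M c c 0 := rfl

theorem Runs.trans {K L σ : Type} [DecidableEq K] {A : K → Type} {M : L → TM2.Stmt A L σ}
    {c₁ c₂ c₃ : TM2.Cfg A L σ} {m n : ℕ} (h₁ : Runs M c₁ c₂ m) (h₂ : Runs M c₂ c₃ n) :
    Runs M c₁ c₃ (m + n) := by
  unfold Runs at *
  rw [Nat.add_comm, Function.iterate_add_apply, h₁, h₂]

theorem Runs.single {K L σ : Type} [DecidableEq K] {A : K → Type} {M : L → TM2.Stmt A L σ}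
    {c c' : TM2.Cfg A L σ} (h : TM2.step M c = some c') : Runs M c c' 1 := h

theorem Runs.of_eq {K L σ : Type} [DecidableEq K] {A : K → Type} {M : L → TM2.Stmt A L σ}
    {l : L} {q : TM2.Stmt A L σ} (h : M l = q) {v : σ} {S : ∀ k, List (A k)} {c' : TM2.Cfg A L σ}
    (hc : TM2.stepAux q v S = c') : Runs M ⟨some l, v, S⟩ c' 1 := by
  subst h hc
  rfl

section Sub

variable {L : Type} {M : L → TM2.Stmt (Alph Γ tm ΓI ΓO N) L (tm.σ × Option Γ)}

theorem stepAux_embed (emb : tm.Λ → L) (exit : L) (q : TM2.Stmt tm.Γ tm.Λ tm.σ) (v : tm.σ)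
    (w : Option Γ) (i : List ΓI) (o : List ΓO) (s : ℕ → List Γ) (u : ∀ k, List (tm.Γ k)) :
    TM2.stepAux (embed tm N emb exit q) (v, w) (stk tm N i o s u) =
      ⟨some (((TM2.stepAux q v u).l).elim exit emb), ((TM2.stepAux q v u).var, w),
        stk tm N i o s (TM2.stepAux q v u).stk⟩ := by
  induction q generalizing v u with
  | push k f q ih =>
    simp only [embed, TM2.stepAux]
    rw [← ih, ← update_stk_sub]
    rfl
  | peek k f q ih => simp only [embed, TM2.stepAux]; rw [← ih]; rfl
  | pop k f q ih =>
    simp only [embed, TM2.stepAux]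
    rw [← ih, ← update_stk_sub]
    rfl
  | load f q ih => simp only [embed, TM2.stepAux]; rw [← ih]
  | branch f q₁ q₂ ih₁ ih₂ =>
    simp only [embed, TM2.stepAux]
    cases f v
    · exact ih₂ _ _
    · exact ih₁ _ _
  | goto f => rfl
  | halt => rfl

/-- A run of the subroutine is a run of the compiled machine; the label `none` of a halted
subroutine corresponds to `exit`. -/
theorem runs_embed (emb : tm.Λ → L) (exit : L)
    (hM : ∀ l, M (emb l) = embed tm N emb exit (tm.m l)) (w : Option Γ) (i : List ΓI) (o : List ΓO)
    (s : ℕ → List Γ) {n : ℕ} {c c' : TM2.Cfg tm.Γ tm.Λ tm.σ} (h : Runs tm.m c c' n) :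
    Runs M ⟨some (c.l.elim exit emb), (c.var, w), stk tm N i o s c.stk⟩
      ⟨some (c'.l.elim exit emb), (c'.var, w), stk tm N i o s c'.stk⟩ n := by
  induction n generalizing c with
  | zero => cases h; exact .refl _
  | succ n ih =>
    have h' : (flip bind (TM2.step tm.m))^[n] (TM2.step tm.m c) = some c' := h
    rcases c with ⟨_ | l, v, u⟩
    · have key : ∀ n, (flip bind (TM2.step tm.m))^[n] none = none := fun n =>
        Function.iterate_fixed rfl n
      rw [show TM2.step tm.m ⟨none, v, u⟩ = none from rfl, key] at h'
      cases h'
    · refine Nat.add_comm 1 n ▸ Runs.trans (Runs.single ?_) (ih (c := TM2.stepAux (tm.m l) v u) h')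
      simp [TM2.step, hM, stepAux_embed]

theorem runs_transfer_nil [Inhabited Γ] (k k' : Stk tm N) (f : Alph Γ tm ΓI ΓO N k → Γ)
    (g : Γ → Alph Γ tm ΓI ΓO N k') {self : L} {exit}
    (hM : M self = transfer tm N k k' f g self exit) (v : tm.σ) (w : Option Γ)
    (S : ∀ k, List (Alph Γ tm ΓI ΓO N k)) (hS : S k = []) :
    Runs M ⟨some self, (v, w), S⟩ (TM2.stepAux exit (v, none) S) 1 := by
  refine Runs.single ?_
  have : Function.update S k [] = S := by rw [← hS, Function.update_eq_self]
  simp [TM2.step, hM, transfer, hS, this]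

theorem runs_transfer_cons [Inhabited Γ] (k k' : Stk tm N) (f : Alph Γ tm ΓI ΓO N k → Γ)
    (g : Γ → Alph Γ tm ΓI ΓO N k') {self : L} {exit}
    (hM : M self = transfer tm N k k' f g self exit) (v : tm.σ) (w : Option Γ)
    (S : ∀ k, List (Alph Γ tm ΓI ΓO N k)) {a} {l} (hS : S k = a :: l) (hk : k' ≠ k) :
    Runs M ⟨some self, (v, w), S⟩ ⟨some self, (v, some (f a)),
      Function.update (Function.update S k l) k' (g (f a) :: S k')⟩ 1 := by
  refine Runs.single ?_
  simp [TM2.step, hM, transfer, hS, Function.update_of_ne hk]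

end Sub

/-- What the compiled machine does for a call: the register is moved to the input stack of the
subroutine, which reverses it, and the output is moved back, which reverses it again. -/
def subroutine (toIn : Γ → tm.Γ tm.k₀) (ofOut : tm.Γ tm.k₁ → Γ) (x y : List Γ) (t : ℕ) : Prop :=
  ∃ z n, Runs tm.m (initList tm (x.reverse.map toIn)) (haltList tm z) n ∧
    y = (z.map ofOut).reverse ∧ t = (x.length + 1) + n + (z.length + 1)

theorem initList_stk (x : List (tm.Γ tm.k₀)) :
    (initList tm x).stk = Function.update (fun _ => []) tm.k₀ x := by
  funext k
  by_cases h : k = tm.k₀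
  · subst h; simp [initList]
  · simp [initList, h]

theorem haltList_stk (x : List (tm.Γ tm.k₁)) :
    (haltList tm x).stk = Function.update (fun _ => []) tm.k₁ x := by
  funext k
  by_cases h : k = tm.k₁
  · subst h; simp [haltList]
  · simp [haltList, h]

section Correct

variable [Inhabited Γ] {toIn : Γ → tm.Γ tm.k₀} {ofOut : tm.Γ tm.k₁ → Γ}
  {L : Type} {M : L → TM2.Stmt (Alph Γ tm ΓI ΓO N) L (tm.σ × Option Γ)}

theorem runs_call_in {r : ℕ} (hr : r ≤ N) {self next : L}
    (hM : M self = transfer tm N (.inr (.inl (Fin.ofNat (N + 1) r))) (.inr (.inr tm.k₀)) id toIn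
      self (.goto fun _ => next)) (v : tm.σ) (w : Option Γ) (i : List ΓI) (o : List ΓO)
    (s : ℕ → List Γ) (u : ∀ k, List (tm.Γ k)) :
    Runs M ⟨some self, (v, w), stk tm N i o s u⟩
      ⟨some next, (v, none), stk tm N i o (Function.update s r [])
        (Function.update u tm.k₀ ((s r).reverse.map toIn ++ u tm.k₀))⟩ ((s r).length + 1) := by
  generalize hx : s r = x
  induction x generalizing s u w with
  | nil =>
    have := runs_transfer_nil _ _ _ _ hM v w (stk tm N i o s u) ((stk_reg i o s u hr).trans hx)
    have e : Function.update s r [] = s := by rw [← hx, Function.update_eq_self]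
    simpa [e, hx] using this
  | cons a x ih =>
    have h₁ := runs_transfer_cons _ _ _ _ hM v w (stk tm N i o s u)
      ((stk_reg i o s u hr).trans hx) (by simp)
    rw [update_stk_reg _ _ _ _ hr, update_stk_sub] at h₁
    have h₂ := ih (some a) (Function.update s r x)
      (Function.update u tm.k₀ (toIn a :: u tm.k₀)) (by simp)
    have h := Nat.add_comm 1 _ ▸ h₁.trans h₂
    simpa using h

theorem runs_call_out {r : ℕ} (hr : r ≤ N) {self next : L}
    (hM : M self = transfer tm N (.inr (.inr tm.k₁)) (.inr (.inl (Fin.ofNat (N + 1) r))) ofOut id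
      self (.goto fun _ => next)) (v : tm.σ) (w : Option Γ) (i : List ΓI) (o : List ΓO)
    (s : ℕ → List Γ) (z : List (tm.Γ tm.k₁)) :
    Runs M ⟨some self, (v, w), stk tm N i o s (Function.update (fun _ => []) tm.k₁ z)⟩
      ⟨some next, (v, none), stk tm N i o (Function.update s r ((z.map ofOut).reverse ++ s r))
        (fun _ => [])⟩ (z.length + 1) := by
  induction z generalizing s w with
  | nil =>
    have := runs_transfer_nil _ _ _ _ hM v w
      (stk tm N i o s (Function.update (fun _ => []) tm.k₁ [])) (by simp [stk])
    simpa using this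
  | cons a z ih =>
    have h₁ := runs_transfer_cons _ _ _ _ hM v w
      (stk tm N i o s (Function.update (fun _ => []) tm.k₁ (a :: z))) (a := a) (l := z)
      (by simp [stk]) (by simp)
    rw [update_stk_sub, update_stk_reg _ _ _ _ hr, stk_reg _ _ _ _ hr] at h₁
    have h₂ := ih (some (ofOut a)) (Function.update s r (ofOut a :: s r))
    have h := Nat.add_comm 1 _ ▸ h₁.trans (by simpa using h₂)
    simpa using h

/-- The compiled program makes exactly as many steps as `Exec` says. All stacks of the subroutine
are empty between calls, and its state is initial. -/
theorem runs_code {p : Prog Γ} {s s' : ℕ → List Γ} {t : ℕ}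
    (h : Exec (subroutine toIn ofOut) p s s' t) (hp : p.Below N) (emb : p.Lab tm → L) (exit : L)
    (hM : ∀ l, M (emb l) = code tm N toIn ofOut p emb exit l) (i : List ΓI) (o : List ΓO)
    (w : Option Γ) :
    ∃ w', Runs M ⟨some (emb (p.entry tm)), (tm.initialState, w), stk tm N i o s fun _ => []⟩
      ⟨some exit, (tm.initialState, w'), stk tm N i o s' fun _ => []⟩ t := by
  induction h generalizing exit w with
  | skip s => exact ⟨w, .of_eq (hM ()) rfl⟩
  | push r a s =>
    have hr : r ≤ N := hp
    refine ⟨w, .of_eq (hM ()) ?_⟩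
    simp only [code, TM2.stepAux]
    rw [update_stk_reg _ _ _ _ hr, stk_reg _ _ _ _ hr]
  | @pop r k s s' t h ih =>
    have hr : r ≤ N := hp.1
    obtain ⟨w', hw⟩ := ih (hp.2 _) (fun l => emb (some ⟨_, l⟩)) exit
      (fun l => hM (some ⟨_, l⟩)) (s r).head?
    refine ⟨w', .trans (.of_eq (hM none) ?_) hw⟩
    simp only [code, TM2.stepAux]
    rw [update_stk_reg _ _ _ _ hr, stk_reg _ _ _ _ hr]
  | @seq p q _ _ _ _ _ _ _ ih₁ ih₂ =>
    obtain ⟨w₁, h₁⟩ := ih₁ hp.1 (fun l => emb (.inl l)) (emb (.inr (q.entry tm)))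
      (fun l => hM (.inl l)) w
    obtain ⟨w₂, h₂⟩ := ih₂ hp.2 (fun l => emb (.inr l)) exit (fun l => hM (.inr l)) w₁
    exact ⟨w₂, h₁.trans h₂⟩
  | @done r test p s h =>
    have hr : r ≤ N := hp.1
    refine ⟨(s r).head?, .of_eq (hM none) ?_⟩
    simp only [code, TM2.stepAux]
    rw [stk_reg _ _ _ _ hr, h]
    rfl
  | @loop r test p s₁ s₂ s₃ t₁ t₂ h _ _ ih₁ ih₂ =>
    have hr : r ≤ N := hp.1
    obtain ⟨w₁, h₁⟩ := ih₁ hp.2 (fun l => emb (some l)) (emb none)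
      (fun l => hM (some l)) (s₁ r).head?
    obtain ⟨w₂, h₂⟩ := ih₂ hp emb exit hM w₁
    refine ⟨w₂, .trans (.trans (.of_eq (hM none) ?_) h₁) h₂⟩
    simp only [code, TM2.stepAux]
    rw [stk_reg _ _ _ _ hr, h]
    rfl
  | @call r s y t h _ =>
    have hr : r ≤ N := hp
    obtain ⟨z, n, hrun, rfl, rfl⟩ := h
    have h₁ := runs_call_in hr (hM (.inl false)) tm.initialState w i o s fun _ => []
    have h₂ := runs_embed (fun l => emb (.inr l)) (emb (.inl true)) (fun l => hM (.inr l)) none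
      i o (Function.update s r []) hrun
    have h₃ := runs_call_out hr (hM (.inl true)) tm.initialState none i o
      (Function.update s r []) z
    rw [initList_stk, haltList_stk] at h₂
    simp only [List.append_nil] at h₁
    simp only [Function.update_idem, Function.update_self, List.append_nil] at h₃
    exact ⟨none, (h₁.trans h₂).trans h₃⟩

end Correct

variable (tm N) in
/-- The machine code around a program: read the input into register `0` (reversed), run the program,
and write register `0` to the output (reversed). -/
def table [Inhabited Γ] (toIn : Γ → tm.Γ tm.k₀) (ofOut : tm.Γ tm.k₁ → Γ) (ofI : ΓI → Γ)
    (toO : Γ → ΓO) (p : Prog Γ) : Bool ⊕ p.Lab tm →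
      TM2.Stmt (Alph Γ tm ΓI ΓO N) (Bool ⊕ p.Lab tm) (tm.σ × Option Γ)
  | .inl false => transfer tm N (.inl false) (.inr (.inl (Fin.ofNat (N + 1) 0))) ofI id
      (.inl false) (.goto fun _ => .inr (p.entry tm))
  | .inl true => transfer tm N (.inr (.inl (Fin.ofNat (N + 1) 0))) (.inl true) id toO (.inl true)
      (.load (fun _ => (tm.initialState, none)) .halt)
  | .inr l => code tm N toIn ofOut p .inr (.inl true) l

variable (tm N) in
/-- The bundled machine for a program. -/
noncomputable def machine [Finite Γ] [Inhabited Γ] [Fintype ΓI] (toIn : Γ → tm.Γ tm.k₀)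
    (ofOut : tm.Γ tm.k₁ → Γ) (ofI : ΓI → Γ) (toO : Γ → ΓO) (p : Prog Γ) : FinTM2 :=
  letI := Fintype.ofFinite Γ
  letI := tm.kFin
  letI := tm.σFin
  haveI := p.finite_lab tm
  letI := Fintype.ofFinite (Bool ⊕ p.Lab tm)
  { K := Stk tm N
    k₀ := .inl false
    k₁ := .inl true
    Γ := Alph Γ tm ΓI ΓO N
    Λ := Bool ⊕ p.Lab tm
    main := .inl false
    σ := tm.σ × Option Γ
    initialState := (tm.initialState, none)
    Γk₀Fin := inferInstanceAs (Fintype ΓI)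
    m := table tm N toIn ofOut ofI toO p }

theorem machine_initList [Finite Γ] [Inhabited Γ] [Fintype ΓI] {toIn : Γ → tm.Γ tm.k₀}
    {ofOut : tm.Γ tm.k₁ → Γ} {ofI : ΓI → Γ} {toO : Γ → ΓO} {p : Prog Γ} (x : List ΓI) :
    initList (machine tm N toIn ofOut ofI toO p) x =
      ⟨some (.inl false), (tm.initialState, none), stk tm N x [] (fun _ => []) fun _ => []⟩ := by
  unfold initList
  congr 1
  funext k
  rcases k with (_ | _) | r | k
  · exact dif_pos rfl
  all_goals exact dif_neg (by rintro ⟨⟩)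

theorem machine_haltList [Finite Γ] [Inhabited Γ] [Fintype ΓI] {toIn : Γ → tm.Γ tm.k₀}
    {ofOut : tm.Γ tm.k₁ → Γ} {ofI : ΓI → Γ} {toO : Γ → ΓO} {p : Prog Γ} (y : List ΓO) :
    haltList (machine tm N toIn ofOut ofI toO p) y =
      ⟨none, (tm.initialState, none), stk tm N [] y (fun _ => []) fun _ => []⟩ := by
  unfold haltList
  congr 1
  funext k
  rcases k with (_ | _) | r | k
  · exact dif_neg (by rintro ⟨⟩)
  · exact dif_pos rfl
  all_goals exact dif_neg (by rintro ⟨⟩)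

section Table

variable [Inhabited Γ] {toIn : Γ → tm.Γ tm.k₀} {ofOut : tm.Γ tm.k₁ → Γ} {ofI : ΓI → Γ}
  {toO : Γ → ΓO} {p : Prog Γ}

theorem runs_load (x : List ΓI) (s : ℕ → List Γ) (w : Option Γ) :
    Runs (table (ΓO := ΓO) tm N toIn ofOut ofI toO p)
      ⟨some (.inl false), (tm.initialState, w), stk tm N x [] s fun _ => []⟩
      ⟨some (.inr (p.entry tm)), (tm.initialState, none), stk tm N [] []
        (Function.update s 0 ((x.map ofI).reverse ++ s 0)) fun _ => []⟩ (x.length + 1) := by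
  induction x generalizing s w with
  | nil =>
    have := runs_transfer_nil (M := table (ΓO := ΓO) tm N toIn ofOut ofI toO p) (.inl false)
      (.inr (.inl (Fin.ofNat (N + 1) 0))) ofI id (self := .inl false) rfl
      tm.initialState w (stk tm N ([] : List ΓI) ([] : List ΓO) s fun _ => []) rfl
    simpa using this
  | cons a x ih =>
    have h₁ := runs_transfer_cons (M := table (ΓO := ΓO) tm N toIn ofOut ofI toO p) (.inl false)
      (.inr (.inl (Fin.ofNat (N + 1) 0))) ofI id (self := .inl false) rfl
      tm.initialState w (stk tm N (a :: x) ([] : List ΓO) s fun _ => []) (a := a) (l := x) rfl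
      (by simp)
    rw [update_stk_inp, update_stk_reg _ _ _ _ (Nat.zero_le N),
      stk_reg _ _ _ _ (Nat.zero_le N)] at h₁
    have h := Nat.add_comm 1 _ ▸ h₁.trans (ih (Function.update s 0 (ofI a :: s 0)) (some (ofI a)))
    simpa using h

theorem runs_unload (x : List Γ) (o : List ΓO) (w : Option Γ) :
    Runs (table (ΓO := ΓO) tm N toIn ofOut ofI toO p)
      ⟨some (.inl true), (tm.initialState, w),
        stk tm N [] o (Function.update (fun _ => []) 0 x) fun _ => []⟩
      ⟨none, (tm.initialState, none), stk tm N [] ((x.map toO).reverse ++ o) (fun _ => [])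
        fun _ => []⟩ (x.length + 1) := by
  induction x generalizing o w with
  | nil =>
    have := runs_transfer_nil (M := table (ΓO := ΓO) tm N toIn ofOut ofI toO p)
      (.inr (.inl (Fin.ofNat (N + 1) 0))) (.inl true) id toO (self := .inl true) rfl
      tm.initialState w (stk tm N ([] : List ΓI) o (Function.update (fun _ => []) 0 []) fun _ => [])
      rfl
    simpa using this
  | cons a x ih =>
    have h₁ := runs_transfer_cons (M := table (ΓO := ΓO) tm N toIn ofOut ofI toO p)
      (.inr (.inl (Fin.ofNat (N + 1) 0))) (.inl true) id toO (self := .inl true) rfl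
      tm.initialState w
      (stk tm N ([] : List ΓI) o (Function.update (fun _ => []) 0 (a :: x)) fun _ => [])
      (a := a) (l := x) rfl (by simp)
    rw [update_stk_reg _ _ _ _ (Nat.zero_le N), update_stk_out] at h₁
    have h := Nat.add_comm 1 _ ▸ h₁.trans (by simpa [stk] using ih (toO a :: o) (some a))
    simpa using h

theorem runs_table {x : List ΓI} {y : List Γ} {t : ℕ} (hN : p.Below N)
    (h : Exec (subroutine toIn ofOut) p (Function.update (fun _ => []) 0 (x.map ofI).reverse)
      (Function.update (fun _ => []) 0 y) t) :
    Runs (table (ΓO := ΓO) tm N toIn ofOut ofI toO p)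
      ⟨some (.inl false), (tm.initialState, none), stk tm N x [] (fun _ => []) fun _ => []⟩
      ⟨none, (tm.initialState, none), stk tm N [] (y.map toO).reverse (fun _ => []) fun _ => []⟩
      (x.length + 1 + t + (y.length + 1)) := by
  obtain ⟨w', hmain⟩ := runs_code h hN (Sum.inr : _ → Bool ⊕ p.Lab tm) (.inl true)
    (M := table (ΓO := ΓO) tm N toIn ofOut ofI toO p) (fun _ => rfl) [] [] none
  have h₁ := runs_load (ΓO := ΓO) (toIn := toIn) (ofOut := ofOut) (ofI := ofI) (toO := toO)
    (p := p) (N := N) x (fun _ => []) none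
  have h₂ := runs_unload (toIn := toIn) (ofOut := ofOut) (ofI := ofI) (toO := toO)
    (p := p) (N := N) y [] w'
  rw [List.append_nil] at h₁ h₂
  exact (h₁.trans hmain).trans h₂

end Table

/-- A program that computes `f` in polynomial time, up to reversal of input and output, yields a
Turing machine for `f`. -/
theorem polyTime {α β : Type} [Finite Γ] [Inhabited Γ] [Fintype ΓI] {toIn : Γ → tm.Γ tm.k₀}
    {ofOut : tm.Γ tm.k₁ → Γ} (ofI : ΓI → Γ) (toO : Γ → ΓO) {ea : α → List ΓI} {eb : β → List ΓO}
    {f : α → β} (p : Prog Γ) (q : Polynomial ℕ)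
    (h : ∀ a, ∃ y t, Exec (subroutine toIn ofOut) p
      (Function.update (fun _ => []) 0 ((ea a).map ofI).reverse) (Function.update (fun _ => []) 0 y)
      t ∧ (y.map toO).reverse = eb (f a) ∧ t + y.length ≤ q.eval (ea a).length) :
    PolyTime ea eb f := by
  obtain ⟨N, hN⟩ := p.exists_below
  refine ⟨{
    tm := machine tm N toIn ofOut ofI toO p
    inputAlphabet := Equiv.refl ΓI
    outputAlphabet := Equiv.refl ΓO
    time := Polynomial.X + 2 + q
    outputsFun := fun a => Classical.choice ?_ }⟩
  obtain ⟨y, t, hexec, hy, ht⟩ := h a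
  have hrun := runs_table (ΓO := ΓO) (toO := toO) hN hexec
  rw [hy] at hrun
  refine ⟨⟨⟨(ea a).length + 1 + t + (y.length + 1), ?_⟩, ?_⟩⟩
  · have e₁ := machine_initList (tm := tm) (ΓO := ΓO) (toIn := toIn) (ofOut := ofOut) (ofI := ofI)
      (toO := toO) (p := p) (N := N) (ea a)
    have e₂ := machine_haltList (tm := tm) (ΓO := ΓO) (toIn := toIn) (ofOut := ofOut) (ofI := ofI)
      (toO := toO) (p := p) (N := N) (eb (f a))
    have h₁ : (ea a).map (Equiv.refl ΓI).invFun = ea a := List.map_id _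
    have h₂ : (eb (f a)).map (Equiv.refl ΓO).invFun = eb (f a) := List.map_id _
    rw [← h₁] at e₁
    rw [← h₂] at e₂
    exact (congrArg (fun c => (flip bind _)^[_] (some c)) e₁).trans
      (Eq.trans (by rw [h₁, h₂]; exact hrun) (congrArg some e₂.symm))
  · simp only [Polynomial.eval_add, Polynomial.eval_X, Polynomial.eval_ofNat]
    omega

end Compile

end Prog

/-! ### Polynomial-time functions on data represented by binary trees -/

theorem Polynomial.eval_mono_nat (q : Polynomial ℕ) : Monotone fun n => q.eval n := by
  intro m n h
  simp only [Polynomial.eval_eq_sum, Polynomial.sum]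
  exact Finset.sum_le_sum fun i _ => Nat.mul_le_mul_left _ (Nat.pow_le_pow_left h i)

/-- Binary trees with leaves in `Option Γ`; the leaf `none` plays the role of Lisp's `nil`. -/
inductive Dt (Γ : Type) where
  | leaf (a : Option Γ)
  | cons (x y : Dt Γ)

/-- The symbols for writing trees: `none` announces an inner node, `some` a leaf. -/
abbrev Cell (Γ : Type) : Type := Option (Option Γ)

/-- A tree in prefix notation. -/
def Dt.code {Γ : Type} : Dt Γ → List (Cell Γ)
  | leaf a => [some a]
  | cons x y => none :: (x.code ++ y.code)

/-- A representation of a type by trees. -/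
class TreeRep (Γ : Type) (α : Type) where
  /-- The tree for an element. -/
  enc : α → Dt Γ

section Frames

variable {C : Type} {O : List C → List C → ℕ → Prop}

/-- The program takes `s` to `s'` in time at most `T`. -/
def Does (O : List C → List C → ℕ → Prop) (p : Prog C) (s s' : ℕ → List C) (T : ℕ) : Prop :=
  ∃ t ≤ T, Exec O p s s' t

/-- Registers do not grow faster than time passes. -/
theorem Exec.length_le {p : Prog C} {s s' : ℕ → List C} {t : ℕ} (h : Exec O p s s' t) (r : ℕ) :
    (s' r).length ≤ (s r).length + t := by
  have upd : ∀ (s : ℕ → List C) (r' : ℕ) (l : List C) (k : ℕ), l.length ≤ (s r').length + k →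
      (Function.update s r' l r).length ≤ (s r).length + k := by
    intro s r' l k hl
    by_cases h : r = r'
    · subst h; simpa using hl
    · simp [Function.update_of_ne h]
  induction h with
  | skip s => simp
  | push r' a s => exact upd s r' _ 1 (by simp)
  | @pop r' k s s' t h ih =>
    have := upd s r' (s r').tail 0 (by simp)
    omega
  | seq _ _ ih₁ ih₂ => omega
  | done h => simp
  | loop h _ _ ih₁ ih₂ => omega
  | call h hy => exact upd _ _ _ _ (by omega)

theorem Does.mono {p : Prog C} {s s' : ℕ → List C} {T T' : ℕ} (h : Does O p s s' T)
    (hT : T ≤ T') : Does O p s s' T' :=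
  h.imp fun _ ht => ⟨ht.1.trans hT, ht.2⟩

theorem Does.of_eq {p : Prog C} {s₁ s₂ s₁' s₂' : ℕ → List C} {T T' : ℕ} (h : Does O p s₁ s₂ T)
    (h₁ : s₁ = s₁') (h₂ : s₂ = s₂') (hT : T ≤ T') : Does O p s₁' s₂' T' :=
  h₁ ▸ h₂ ▸ h.mono hT

theorem Does.seq {p q : Prog C} {s₁ s₂ s₃ : ℕ → List C} {T₁ T₂ : ℕ} (h₁ : Does O p s₁ s₂ T₁)
    (h₂ : Does O q s₂ s₃ T₂) : Does O (.seq p q) s₁ s₃ (T₁ + T₂) := by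
  obtain ⟨t₁, ht₁, h₁⟩ := h₁
  obtain ⟨t₂, ht₂, h₂⟩ := h₂
  exact ⟨t₁ + t₂, by omega, .seq h₁ h₂⟩

theorem Does.skip (s : ℕ → List C) : Does O .skip s s 1 := ⟨1, le_rfl, .skip s⟩

theorem Does.push (r : ℕ) (a : C) (s : ℕ → List C) :
    Does O (.push r a) s (Function.update s r (a :: s r)) 1 := ⟨1, le_rfl, .push r a s⟩

theorem Does.pop {r : ℕ} {k : Option C → Prog C} {s s' : ℕ → List C} {T : ℕ}
    (h : Does O (k (s r).head?) (Function.update s r (s r).tail) s' T) :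
    Does O (.pop r k) s s' (1 + T) := by
  obtain ⟨t, ht, h⟩ := h
  exact ⟨1 + t, by omega, .pop h⟩

theorem Does.done {r : ℕ} {test : C → Bool} {p : Prog C} {s : ℕ → List C}
    (h : (s r).head?.any test = false) : Does O (.loop r test p) s s 1 := ⟨1, le_rfl, .done h⟩

theorem Does.loop {r : ℕ} {test : C → Bool} {p : Prog C} {s₁ s₂ s₃ : ℕ → List C} {T₁ T₂ : ℕ}
    (h : (s₁ r).head?.any test = true) (h₁ : Does O p s₁ s₂ T₁)
    (h₂ : Does O (.loop r test p) s₂ s₃ T₂) : Does O (.loop r test p) s₁ s₃ (1 + T₁ + T₂) := by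
  obtain ⟨t₁, ht₁, h₁⟩ := h₁
  obtain ⟨t₂, ht₂, h₂⟩ := h₂
  exact ⟨1 + t₁ + t₂, by omega, .loop h h₁ h₂⟩

/-- Register contents that agree with `s` below `n`, are `a, b, c, d` in the next four registers,
and are empty from then on. -/
def fr (s : ℕ → List C) (n : ℕ) (a b c d : List C) : ℕ → List C := fun i =>
  if i < n then s i else if i = n then a else if i = n + 1 then b else
    if i = n + 2 then c else if i = n + 3 then d else []

variable (s : ℕ → List C) (n : ℕ) (a b c d x : List C)

@[simp] theorem fr_zero : fr s n a b c d n = a := by simp [fr]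
@[simp] theorem fr_one : fr s n a b c d (n + 1) = b := by simp [fr]
@[simp] theorem fr_two : fr s n a b c d (n + 2) = c := by simp [fr]
@[simp] theorem fr_three : fr s n a b c d (n + 3) = d := by simp [fr]

@[simp] theorem update_fr_zero : Function.update (fr s n a b c d) n x = fr s n x b c d := by
  funext i; simp only [Function.update_apply, fr]; split_ifs <;> first | rfl | omega

@[simp] theorem update_fr_one : Function.update (fr s n a b c d) (n + 1) x = fr s n a x c d := by
  funext i; simp only [Function.update_apply, fr]; split_ifs <;> first | rfl | omega

@[simp] theorem update_fr_two : Function.update (fr s n a b c d) (n + 2) x = fr s n a b x d := by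
  funext i; simp only [Function.update_apply, fr]; split_ifs <;> first | rfl | omega

@[simp] theorem update_fr_three : Function.update (fr s n a b c d) (n + 3) x = fr s n a b c x := by
  funext i; simp only [Function.update_apply, fr]; split_ifs <;> first | rfl | omega

/-- A program that works in the registers from `n + 1` on leaves register `n` alone. -/
theorem fr_shift : fr s n a b [] [] = fr (fr s n a [] [] []) (n + 1) b [] [] [] := by
  funext i; simp only [fr]; split_ifs <;> first | rfl | omega

end Frames

namespace Prog

variable {C : Type} {O : List C → List C → ℕ → Prop}

/-- Push the symbols of a list, one after the other. -/
def pushAll (j : ℕ) : List C → Prog C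
  | [] => .skip
  | a :: l => .seq (.push j a) (pushAll j l)

theorem does_pushAll (j : ℕ) (l : List C) (s : ℕ → List C) :
    Does O (pushAll j l) s (Function.update s j (l.reverse ++ s j)) (l.length + 1) := by
  induction l generalizing s with
  | nil => exact (Does.skip s).of_eq rfl (by simp) le_rfl
  | cons a l ih => exact ((Does.push j a s).seq (ih _)).of_eq rfl (by simp) (by simp; omega)

/-- Empty register `i`, pushing the word `g a` onto register `j` for each symbol `a`. -/
def pump (i j : ℕ) (g : C → List C) : Prog C :=
  .loop i (fun _ => true) (.pop i fun o => pushAll j (o.elim [] g))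

theorem does_pump {i j : ℕ} (hij : i ≠ j) {g : C → List C} {K : ℕ} (hg : ∀ a, (g a).length ≤ K)
    (s : ℕ → List C) : Does O (pump i j g) s
      (Function.update (Function.update s i []) j (((s i).flatMap g).reverse ++ s j))
      ((K + 3) * (s i).length + 1) := by
  generalize hx : s i = x
  induction x generalizing s with
  | nil =>
    have e : Function.update s i [] = s := by rw [← hx, Function.update_eq_self]
    exact (Does.done (by simp [hx])).of_eq rfl (by simp [e]) (by simp)
  | cons a x ih =>
    have h₁ : Does O (.pop i fun o => pushAll j (o.elim [] g)) s _ _ := Does.pop (by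
      rw [hx]; exact does_pushAll j _ _)
    refine (Does.loop (by simp [hx]) h₁
      (ih _ (by simp [Function.update_of_ne hij]))).of_eq rfl ?_ ?_
    · simp [Function.update_of_ne hij.symm, Function.update_comm hij]
    · have := hg a
      simp only [Option.elim, List.head?_cons, List.length_cons]
      nlinarith

/-- Move the contents of register `i` onto register `j`, in reverse. -/
def mv (i j : ℕ) : Prog C := pump i j fun a => [a]

theorem does_mv {i j : ℕ} (hij : i ≠ j) (s : ℕ → List C) :
    Does O (mv i j) s (Function.update (Function.update s i []) j ((s i).reverse ++ s j))
      (4 * (s i).length + 1) := by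
  exact (does_pump (K := 1) hij (fun _ => by simp) s).of_eq rfl (by simp) (by simp)

/-- Empty register `i`. -/
def clr (i : ℕ) : Prog C := pump i (i + 1) fun _ => []

theorem does_clr (i : ℕ) (s : ℕ → List C) :
    Does O (clr i) s (Function.update s i []) (3 * (s i).length + 1) := by
  refine (does_pump (K := 0) (by simp) (fun _ => by simp) s).of_eq rfl ?_ (by simp)
  rw [Function.update_eq_iff]
  simp

/-- Move the contents of register `i` onto both `j` and `k`, in reverse. -/
def copy (i j k : ℕ) : Prog C :=
  .loop i (fun _ => true) (.pop i fun o => o.elim .skip fun a => .seq (.push j a) (.push k a))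

/-- Here `b` is copied to the registers on both of its sides. -/
theorem does_copy (s : ℕ → List C) (n : ℕ) (a b c : List C) :
    Does O (copy (n + 1) n (n + 2)) (fr s n a b c [])
      (fr s n (b.reverse ++ a) [] (b.reverse ++ c) [])
      (4 * b.length + 1) := by
  induction b generalizing a c with
  | nil => exact Does.done (by simp)
  | cons x b ih =>
    have h₁ : Does O (.pop (n + 1) fun o => o.elim .skip fun a => .seq (.push n a)
        (.push (n + 2) a))
        (fr s n a (x :: b) c []) (fr s n (x :: a) b (x :: c) []) (1 + (1 + 1)) := Does.pop (by
      simpa using (Does.push n x (fr s n a b c [])).seq (Does.push (n + 2) x _))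
    exact (Does.loop (by simp) h₁ (ih _ _)).of_eq rfl (by simp) (by simp; omega)

end Prog

namespace Prog

variable {Γ : Type} {O : List (Cell Γ) → List (Cell Γ) → ℕ → Prop}

/-- The loop of `readTree`. Register `n + 2` counts, in unary, the trees yet to be read. -/
def readLoop (n : ℕ) : Prog (Cell Γ) :=
  .loop (n + 2) (fun _ => true) (.pop (n + 2) fun _ => .pop n fun o =>
    o.elim .skip fun a => .seq (.push (n + 3) a)
      (a.elim (.seq (.push (n + 2) none) (.push (n + 2) none)) fun _ => .skip))

/-- Move the first tree of register `n` to register `n + 3`, in reverse. -/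
def readTree (n : ℕ) : Prog (Cell Γ) := .seq (.push (n + 2) none) (readLoop n)

/-- To read `x` takes one unit off the counter; `h` describes what the loop does afterwards. -/
theorem does_readLoop (x : Dt Γ) {s : ℕ → List (Cell Γ)} {n : ℕ} {r b d : List (Cell Γ)}
    {u : Cell Γ}
    {c : List (Cell Γ)} {s' : ℕ → List (Cell Γ)} {T : ℕ}
    (h : Does O (readLoop n) (fr s n r b c (x.code.reverse ++ d)) s' T) :
    Does O (readLoop n) (fr s n (x.code ++ r) b (u :: c) d) s' (T + 7 * x.code.length) := by
  induction x generalizing r d u c T with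
  | leaf a =>
    have h₁ : Does O (.pop (n + 2) fun _ => .pop n fun o => o.elim .skip fun a =>
        .seq (.push (n + 3) a)
          (a.elim (.seq (.push (n + 2) none) (.push (n + 2) none)) fun _ => .skip))
        (fr s n ((Dt.leaf a).code ++ r) b (u :: c) d) (fr s n r b c (some a :: d)) 4 :=
      Does.pop (T := 3) (.pop (T := 2) (by
        simpa [Dt.code] using (Does.push (n + 3) (some a) (fr s n r b c d)).seq (.skip _)))
    exact (Does.loop (by simp) h₁ h).mono (by simp [Dt.code]; omega)
  | cons x y ihx ihy =>
    have h₁ : Does O (.pop (n + 2) fun _ => .pop n fun o => o.elim .skip fun a =>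
        .seq (.push (n + 3) a)
          (a.elim (.seq (.push (n + 2) none) (.push (n + 2) none)) fun _ => .skip))
        (fr s n ((Dt.cons x y).code ++ r) b (u :: c) d)
        (fr s n (x.code ++ (y.code ++ r)) b (none :: none :: c) (none :: d)) 5 :=
      Does.pop (T := 4) (.pop (T := 3) (by
        simpa [Dt.code] using (Does.push (n + 3) none (fr s n (x.code ++ (y.code ++ r)) b c d)).seq
          ((Does.push (n + 2) none _).seq (Does.push (n + 2) none _))))
    have h₂ := ihx (u := none) (d := none :: d) (r := y.code ++ r) (c := none :: c)
      (ihy (u := none) (c := c) (by simpa [Dt.code] using h))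
    exact (Does.loop (by simp) h₁ h₂).mono (by simp [Dt.code]; omega)

theorem does_readTree (x : Dt Γ) (s : ℕ → List (Cell Γ)) (n : ℕ) (r b d : List (Cell Γ)) :
    Does O (readTree n) (fr s n (x.code ++ r) b [] d) (fr s n r b [] (x.code.reverse ++ d))
      (7 * x.code.length + 2) := by
  have h : Does O (readLoop n) (fr s n r b [] (x.code.reverse ++ d)) _ _ := Does.done (by simp)
  exact ((Does.push (n + 2) none _).seq ((does_readLoop (u := none) x h).of_eq (by simp) rfl
    le_rfl)).mono (by omega)

end Prog

section PTime

/-- The behaviour of a subroutine: `rel x y t` holds when it turns the word `x` into `y` in time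
`t`. -/
structure Oracle (Γ : Type) where
  /-- The relation between argument, result and running time. -/
  rel : List (Cell Γ) → List (Cell Γ) → ℕ → Prop

variable {Γ : Type} {O : Oracle Γ}

/-- The word that represents an element. -/
def cd (Γ : Type) {α : Type} [TreeRep Γ α] (a : α) : List (Cell Γ) := (TreeRep.enc a : Dt Γ).code

/-- The size of an element: the number of nodes of the tree that represents it. -/
def sz (Γ : Type) {α : Type} [TreeRep Γ α] (a : α) : ℕ := (cd Γ a).length

variable {α β γ δ : Type} [TreeRep Γ α] [TreeRep Γ β] [TreeRep Γ γ] [TreeRep Γ δ]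

variable (O) in
/-- `f` is computed in polynomial time by a program that may call `O`. There is a version of the
program for every `n`: it works in the registers from `n` on, so that it can be used while smaller
registers hold other data. -/
@[fun_prop]
def PTime (f : α → β) : Prop :=
  ∃ (p : ℕ → Prog (Cell Γ)) (q : Polynomial ℕ), ∀ n s a,
    Does O.rel (p n) (fr s n (cd Γ a) [] [] []) (fr s n (cd Γ (f a)) [] [] []) (q.eval (sz Γ a))

instance : TreeRep Γ Unit := ⟨fun _ => .leaf none⟩

instance : TreeRep Γ (α × β) := ⟨fun x => .cons (TreeRep.enc x.1) (TreeRep.enc x.2)⟩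

/-- Lists as in Lisp. -/
def encList : List α → Dt Γ
  | [] => .leaf none
  | a :: l => .cons (TreeRep.enc a) (encList l)

instance : TreeRep Γ (List α) := ⟨encList⟩

instance : TreeRep Γ (Option α) := ⟨fun o => TreeRep.enc o.toList⟩

instance {p : α → Prop} : TreeRep Γ {a // p a} := ⟨fun a => TreeRep.enc a.1⟩

instance : TreeRep Γ Bool := ⟨fun b => TreeRep.enc (bif b then [()] else [])⟩

@[simp] theorem cd_prod (a : α) (b : β) : cd Γ (a, b) = none :: (cd Γ a ++ cd Γ b) := rfl
@[simp] theorem cd_nil : cd Γ ([] : List α) = [some none] := rfl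
@[simp] theorem cd_cons (a : α) (l : List α) : cd Γ (a :: l) = none :: (cd Γ a ++ cd Γ l) := rfl
@[simp] theorem cd_unit (u : Unit) : cd Γ u = [some none] := rfl

theorem length_cd (a : α) : (cd Γ a).length = sz Γ a := rfl

@[simp] theorem sz_prod (a : α) (b : β) : sz Γ (a, b) = sz Γ a + sz Γ b + 1 := by simp [sz]
@[simp] theorem sz_nil : sz Γ ([] : List α) = 1 := rfl
@[simp] theorem sz_cons (a : α) (l : List α) : sz Γ (a :: l) = sz Γ a + sz Γ l + 1 := by simp [sz]
@[simp] theorem sz_unit (u : Unit) : sz Γ u = 1 := rfl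
@[simp] theorem sz_none : sz Γ (none : Option α) = 1 := rfl
@[simp] theorem sz_some (a : α) : sz Γ (some a) = sz Γ a + 2 := sz_cons a []

theorem sz_pos (a : α) : 0 < sz Γ a := by
  unfold sz cd
  cases (TreeRep.enc a : Dt Γ) <;> simp [Dt.code]

theorem sz_bool_le (b : Bool) : sz Γ b ≤ 3 := by
  cases b <;> simp [sz, cd, TreeRep.enc, encList, Dt.code]

theorem length_lt_sz (l : List α) : l.length < sz Γ l := by
  induction l with
  | nil => simp
  | cons a l ih => simp; omega

theorem does_readTree_cd (a : α) (s : ℕ → List (Cell Γ)) (n : ℕ) (r b d : List (Cell Γ)) :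
    Does O.rel (.readTree n) (fr s n (cd Γ a ++ r) b [] d) (fr s n r b [] ((cd Γ a).reverse ++ d))
      (7 * sz Γ a + 2) :=
  Prog.does_readTree _ s n r b d

theorem PTime.sz_le {f : α → β} (hf : PTime O f) :
    ∃ q : Polynomial ℕ, ∀ a, sz Γ (f a) ≤ q.eval (sz Γ a) := by
  obtain ⟨p, q, h⟩ := hf
  refine ⟨.X + q, fun a => ?_⟩
  obtain ⟨t, ht, h⟩ := h 0 (fun _ => []) a
  have := h.length_le 0
  simp only [fr, lt_self_iff_false, if_false, if_true] at this
  simp only [Polynomial.eval_add, Polynomial.eval_X]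
  exact this.trans (Nat.add_le_add_left ht _)

/-- Functions that agree on the level of representations are of the same complexity. -/
theorem PTime.congr_enc {f : α → β} {g : γ → δ} (hg : PTime O g) (i : α → γ)
    (hi : ∀ a, (TreeRep.enc (i a) : Dt Γ) = TreeRep.enc a)
    (ho : ∀ a, (TreeRep.enc (f a) : Dt Γ) = TreeRep.enc (g (i a))) : PTime O f := by
  obtain ⟨p, q, h⟩ := hg
  refine ⟨p, q, fun n s a => ?_⟩
  have h₁ : cd Γ (i a) = cd Γ a := congrArg Dt.code (hi a)
  have h₂ : cd Γ (f a) = cd Γ (g (i a)) := congrArg Dt.code (ho a)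
  simpa only [sz, h₁, h₂] using h n s (i a)

@[fun_prop]
theorem PTime.id : PTime O (fun a : α => a) :=
  ⟨fun _ => .skip, 1, fun n s a => by exact (Does.skip _).mono (by simp)⟩

/-- A function that does not change the representation. -/
theorem PTime.cast {f : α → β} (h : ∀ a, (TreeRep.enc (f a) : Dt Γ) = TreeRep.enc a) : PTime O f :=
  PTime.id.congr_enc (fun a => a) (fun _ => rfl) h

@[fun_prop]
theorem PTime.comp {g : β → γ} {f : α → β} (hg : PTime O g) (hf : PTime O f) :
    PTime O (fun a => g (f a)) := by
  obtain ⟨r, hr⟩ := hf.sz_le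
  obtain ⟨p₁, q₁, h₁⟩ := hf
  obtain ⟨p₂, q₂, h₂⟩ := hg
  refine ⟨fun n => .seq (p₁ n) (p₂ n), q₁ + q₂.comp r, fun n s a => ?_⟩
  refine ((h₁ n s a).seq (h₂ n s (f a))).mono ?_
  simp only [Polynomial.eval_add, Polynomial.eval_comp]
  exact Nat.add_le_add_left (q₂.eval_mono_nat (hr a)) _

section Moves

variable {C : Type} {O : List C → List C → ℕ → Prop} (s : ℕ → List C) (n : ℕ) (a b c d : List C)
  (x : C)

theorem does_push0 : Does O (.push n x) (fr s n a b c d) (fr s n (x :: a) b c d) 1 :=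
  (Does.push n x _).of_eq rfl (by simp) le_rfl

theorem does_push1 : Does O (.push (n + 1) x) (fr s n a b c d) (fr s n a (x :: b) c d) 1 :=
  (Does.push (n + 1) x _).of_eq rfl (by simp) le_rfl

theorem does_pop0 : Does O (.pop n fun _ => .skip) (fr s n (x :: a) b c d) (fr s n a b c d) 2 :=
  (Does.pop (.skip _)).of_eq rfl (by simp) le_rfl

theorem does_mv01 : Does O (.mv n (n + 1)) (fr s n a b c d) (fr s n [] (a.reverse ++ b) c d)
    (4 * a.length + 1) := (Prog.does_mv (by simp) _).of_eq rfl (by simp) (by simp)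

theorem does_mv10 : Does O (.mv (n + 1) n) (fr s n a b c d) (fr s n (b.reverse ++ a) [] c d)
    (4 * b.length + 1) := (Prog.does_mv (by simp) _).of_eq rfl (by simp) (by simp)

theorem does_mv12 : Does O (.mv (n + 1) (n + 2)) (fr s n a b c d)
    (fr s n a [] (b.reverse ++ c) d) (4 * b.length + 1) :=
  (Prog.does_mv (by simp) _).of_eq rfl (by simp) (by simp)

theorem does_mv20 : Does O (.mv (n + 2) n) (fr s n a b c d) (fr s n (c.reverse ++ a) b [] d)
    (4 * c.length + 1) := (Prog.does_mv (by simp) _).of_eq rfl (by simp) (by simp)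

theorem does_mv21 : Does O (.mv (n + 2) (n + 1)) (fr s n a b c d)
    (fr s n a (c.reverse ++ b) [] d) (4 * c.length + 1) :=
  (Prog.does_mv (by simp) _).of_eq rfl (by simp) (by simp)

theorem does_mv30 : Does O (.mv (n + 3) n) (fr s n a b c d) (fr s n (d.reverse ++ a) b c [])
    (4 * d.length + 1) := (Prog.does_mv (by simp) _).of_eq rfl (by simp) (by simp)

theorem does_mv31 : Does O (.mv (n + 3) (n + 1)) (fr s n a b c d)
    (fr s n a (d.reverse ++ b) c []) (4 * d.length + 1) :=
  (Prog.does_mv (by simp) _).of_eq rfl (by simp) (by simp)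

theorem does_clr0 : Does O (.clr n) (fr s n a b c d) (fr s n [] b c d) (3 * a.length + 1) :=
  (Prog.does_clr _ _).of_eq rfl (by simp) (by simp)

theorem does_clr3 : Does O (.clr (n + 3)) (fr s n a b c d) (fr s n a b c []) (3 * d.length + 1) :=
  (Prog.does_clr _ _).of_eq rfl (by simp) (by simp)

end Moves

/-- Take a pair apart: the second component stays, the first one goes, reversed, to register
`n + 3`. -/
theorem does_split (a : α) (b : β) (s : ℕ → List (Cell Γ)) (n : ℕ) (m : List (Cell Γ) := []) :
    Does O.rel (.seq (.pop n fun _ => .skip) (.readTree n)) (fr s n (cd Γ (a, b)) m [] [])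
      (fr s n (cd Γ b) m [] (cd Γ a).reverse) (7 * sz Γ a + 4) :=
  ((does_pop0 s n _ _ _ _ none).seq (does_readTree_cd a s n (cd Γ b) _ _)).of_eq rfl (by simp)
    (by omega)

/-- The first component is computed one register further up, over the second one. -/
theorem PTime.first {f : α → β} (hf : PTime O f) : PTime O (fun x : α × γ => (f x.1, x.2)) := by
  obtain ⟨r, hr⟩ := hf.sz_le
  obtain ⟨p, q, h⟩ := hf
  refine ⟨fun n => .seq (.seq (.pop n fun _ => .skip) (.readTree n)) (.seq (.mv (n + 3) (n + 1))
    (.seq (p (n + 1)) (.seq (.mv (n + 1) (n + 2)) (.seq (.mv (n + 2) n) (.push n none))))),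
    q + 8 * r + 11 * .X + 8, fun n s ⟨a, c⟩ => ?_⟩
  have h₁ := h (n + 1) (fr s n (cd Γ c) [] [] []) a
  rw [← fr_shift, ← fr_shift] at h₁
  refine ((does_split a c s n).seq (((does_mv31 _ _ _ _ _ _).of_eq rfl (by simp) le_rfl).seq
    (h₁.seq ((does_mv12 _ _ _ _ _ _).seq ((does_mv20 _ _ _ _ _ _).seq
    (does_push0 _ _ _ _ _ _ _)))))).of_eq rfl (by simp) ?_
  have h₂ := hr a
  have h₃ := q.eval_mono_nat (show sz Γ a ≤ sz Γ (a, c) by simp; omega)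
  have h₄ := r.eval_mono_nat (show sz Γ a ≤ sz Γ (a, c) by simp; omega)
  simp only [sz_prod, List.length_reverse, List.length_append, List.length_nil, length_cd,
    Polynomial.eval_add, Polynomial.eval_mul, Polynomial.eval_X, Polynomial.eval_ofNat] at *
  omega

theorem PTime.dup : PTime O (fun a : α => (a, a)) := by
  refine ⟨fun n => .seq (.mv n (n + 1)) (.seq (.copy (n + 1) n (n + 2)) (.seq (.mv (n + 2) (n + 1))
    (.seq (.mv (n + 1) n) (.push n none)))), 16 * .X + 5, fun n s a => ?_⟩
  refine ((does_mv01 _ _ _ _ _ _).seq ((Prog.does_copy _ _ _ _ _).seq ((does_mv21 _ _ _ _ _ _).seq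
    ((does_mv10 _ _ _ _ _ _).seq (does_push0 _ _ _ _ _ _ _))))).of_eq rfl (by simp) ?_
  simp [length_cd]
  omega

theorem PTime.swap : PTime O (fun x : α × β => (x.2, x.1)) := by
  refine ⟨fun n => .seq (.seq (.pop n fun _ => .skip) (.readTree n)) (.seq (.mv n (n + 1))
    (.seq (.mv (n + 3) n) (.seq (.mv (n + 1) n) (.push n none)))), 15 * .X + 8,
    fun n s ⟨a, b⟩ => ?_⟩
  refine ((does_split a b s n).seq ((does_mv01 _ _ _ _ _ _).seq ((does_mv30 _ _ _ _ _ _).seq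
    ((does_mv10 _ _ _ _ _ _).seq (does_push0 _ _ _ _ _ _ _))))).of_eq rfl (by simp) ?_
  simp [length_cd]
  omega

theorem PTime.fst : PTime O (fun x : α × β => x.1) := by
  refine ⟨fun n => .seq (.seq (.pop n fun _ => .skip) (.readTree n)) (.seq (.clr n)
    (.mv (n + 3) n)), 14 * .X + 6, fun n s ⟨a, b⟩ => ?_⟩
  refine ((does_split a b s n).seq ((does_clr0 _ _ _ _ _ _).seq
    (does_mv30 _ _ _ _ _ _))).of_eq rfl (by simp) ?_
  simp [length_cd]
  omega

theorem PTime.snd : PTime O (fun x : α × β => x.2) := by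
  refine ⟨fun n => .seq (.seq (.pop n fun _ => .skip) (.readTree n)) (.clr (n + 3)),
    10 * .X + 5, fun n s ⟨a, b⟩ => ?_⟩
  refine ((does_split a b s n).seq (does_clr3 _ _ _ _ _ _)).of_eq rfl (by simp) ?_
  simp [length_cd]
  omega

@[fun_prop]
theorem PTime.const (b : β) : PTime O (fun _ : α => b) := by
  refine ⟨fun n => .seq (.clr n) (.pushAll n (cd Γ b).reverse), 3 * .X + (2 + .C (sz Γ b)),
    fun n s a => ?_⟩
  refine ((does_clr0 _ _ _ _ _ _).seq (Prog.does_pushAll _ _ _)).of_eq rfl (by simp) ?_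
  simp [length_cd]
  omega

@[fun_prop]
theorem PTime.prodMk {f : α → β} {g : α → γ} (hf : PTime O f) (hg : PTime O g) :
    PTime O (fun a => (f a, g a)) :=
  PTime.swap.comp (hg.first.comp (PTime.swap.comp (hf.first.comp PTime.dup)))

/-- Case distinction on a list. -/
theorem PTime.listCase {f : α → β} {g : (δ × List δ) × α → β} (hf : PTime O f) (hg : PTime O g) :
    PTime O (fun x : List δ × α => match x.1 with
      | [] => f x.2
      | d :: l => g ((d, l), x.2)) := by
  obtain ⟨p₁, q₁, h₁⟩ := hf
  obtain ⟨p₂, q₂, h₂⟩ := hg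
  refine ⟨fun n => .pop n fun _ => .pop n fun o => match o with
    | some none => .seq (.push n none) (.seq (.push n none) (p₂ n))
    | _ => p₁ n, q₁ + q₂ + 4, fun n s ⟨l, a⟩ => ?_⟩
  have e₁ := q₁.eval_mono_nat (show sz Γ a ≤ sz Γ (l, a) by simp; omega)
  cases l with
  | nil =>
    refine (Does.pop (T := 1 + q₁.eval (sz Γ a)) (.pop ?_)).mono ?_
    · simpa using h₁ n s a
    · simp at *; omega
  | cons d l =>
    have e₂ := q₂.eval_mono_nat (show sz Γ ((d, l), a) ≤ sz Γ (d :: l, a) by simp)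
    refine (Does.pop (T := 1 + (1 + (1 + q₂.eval (sz Γ ((d, l), a))))) (.pop ?_)).mono ?_
    · have h := (does_push0 s n (cd Γ d ++ (cd Γ l ++ cd Γ a)) [] [] [] none).seq
        ((does_push0 s n _ [] [] [] none).seq ((h₂ n s ((d, l), a)).of_eq (by simp) rfl le_rfl))
      simpa using h
    · simp at *; omega

instance {F : Type} {α : F → Type} [TreeRep Γ F] [∀ c, TreeRep Γ (α c)] : TreeRep Γ (Σ c, α c) :=
  ⟨fun x => .cons (TreeRep.enc x.1) (TreeRep.enc x.2)⟩

/-- Case distinction on an element of a finite type that is represented by leaves. -/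
theorem PTime.finCase {F : Type} [TreeRep Γ F] [Finite F] (ι : F → Γ) (hι : ι.Injective)
    (he : ∀ c, TreeRep.enc c = Dt.leaf (some (ι c))) {α : F → Type} [∀ c, TreeRep Γ (α c)]
    {f : ∀ c, α c → β} (hf : ∀ c, PTime O (f c)) :
    PTime O (fun x : Σ c, α c => f x.1 x.2) := by
  classical
  choose p q h using hf
  cases nonempty_fintype F
  refine ⟨fun n => .pop n fun _ => .pop n fun o => if hc : ∃ c, o = some (some (some (ι c)))
    then p hc.choose n else .skip, ∑ c, q c + 2, fun n s ⟨c, a⟩ => ?_⟩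
  have hcd : cd Γ c = [some (some (ι c))] := by rw [cd, he]; rfl
  have hcd' : cd Γ (⟨c, a⟩ : Σ c, α c) = none :: (cd Γ c ++ cd Γ a) := rfl
  have hsz : sz Γ (⟨c, a⟩ : Σ c, α c) = sz Γ a + 2 := by simp [sz, hcd', hcd]
  refine (Does.pop (T := 1 + (q c).eval (sz Γ a)) (.pop ?_)).mono ?_
  · have hc : ∃ c', some (some (some (ι c))) = some (some (some (ι c'))) := ⟨c, rfl⟩
    have hcc : hc.choose = c := hι (by simpa using hc.choose_spec.symm)
    simp only [hcd', hcd, fr_zero, List.tail_cons, update_fr_zero, List.singleton_append,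
      List.head?_cons]
    rw [dif_pos hc, hcc]
    exact h c n s a
  · have e₁ := (q c).eval_mono_nat (show sz Γ a ≤ sz Γ (⟨c, a⟩ : Σ c, α c) by omega)
    have e₂ : (q c).eval (sz Γ (⟨c, a⟩ : Σ c, α c)) ≤
        ∑ c', (q c').eval (sz Γ (⟨c, a⟩ : Σ c, α c)) :=
      Finset.single_le_sum (f := fun c' => (q c').eval (sz Γ (⟨c, a⟩ : Σ c, α c)))
        (fun _ _ => Nat.zero_le _) (Finset.mem_univ c)
    simp only [Polynomial.eval_add, Polynomial.eval_finsetSum, Polynomial.eval_ofNat] at *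
    omega

/-- Iteration over a list is polynomial if all intermediate results are of polynomial size. The
domain is a subtype because this bound is available only for the arguments that occur. -/
theorem PTime.foldl_subtype {f : α × β → β} (hf : PTime O f) (P : β × List α → Prop)
    (r : Polynomial ℕ) (hr : ∀ x, P x → ∀ l', l' <+: x.2 →
      sz Γ (l'.foldl (fun b a => f (a, b)) x.1) ≤ r.eval (sz Γ x)) :
    PTime O (fun x : {x // P x} => x.1.2.foldl (fun b a => f (a, b)) x.1.1) := by
  obtain ⟨p, q, h⟩ := hf
  set body : ℕ → Prog (Cell Γ) := fun n => .seq (.seq (.pop n fun _ => .skip) (.readTree n))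
    (.seq (.mv (n + 3) (n + 1)) (.seq (.push (n + 1) none) (p (n + 1)))) with hbody
  have hloop : ∀ n s (l : List α) (b : β) (M R : ℕ), sz Γ l ≤ M →
      (∀ l', l' <+: l → sz Γ (l'.foldl (fun b a => f (a, b)) b) ≤ R) →
      Does O.rel (.loop n (fun c => c.isNone) (body n)) (fr s n (cd Γ l) (cd Γ b) [] [])
        (fr s n [some none] (cd Γ (l.foldl (fun b a => f (a, b)) b)) [] [])
        (sz Γ l * (11 * M + 8 + q.eval (M + R + 1))) := by
    intro n s l
    induction l with
    | nil => exact fun b M R _ _ => (Does.done (by simp)).mono (by simp; omega)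
    | cons a l ih =>
      intro b M R hM hR
      have h₁ := h (n + 1) (fr s n (cd Γ l) [] [] []) (a, b)
      rw [← fr_shift, ← fr_shift] at h₁
      have h₂ : Does O.rel (body n) (fr s n (cd Γ (a :: l)) (cd Γ b) [] [])
          (fr s n (cd Γ l) (cd Γ (f (a, b))) [] []) _ :=
        (does_split a l s n (cd Γ b)).seq
          (((does_mv31 s n (cd Γ l) (cd Γ b) [] (cd Γ a).reverse).of_eq rfl (by simp) le_rfl).seq
          ((does_push1 s n (cd Γ l) (cd Γ a ++ cd Γ b) [] [] none).seq h₁))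
      refine (Does.loop (by simp) h₂ (ih (f (a, b)) M R (by simp at hM; omega)
        fun l' hl' => hR (a :: l') (by simpa using hl'))).mono ?_
      have e₁ := hR [] (by simp)
      simp only [List.foldl_nil] at e₁
      have e₂ := q.eval_mono_nat (show sz Γ (a, b) ≤ M + R + 1 by simp at hM ⊢; omega)
      simp only [sz_cons, List.length_reverse, length_cd] at hM e₂ ⊢
      have e₃ : (11 * M + 8 + q.eval (M + R + 1)) ≤
        (sz Γ a + 1) * (11 * M + 8 + q.eval (M + R + 1)) := Nat.le_mul_of_pos_left _ (by omega)
      rw [show sz Γ a + sz Γ l + 1 = (sz Γ a + 1) + sz Γ l by omega, Nat.add_mul]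
      omega
  refine ⟨fun n => .seq (.seq (.pop n fun _ => .skip) (.readTree n)) (.seq (.mv (n + 3) (n + 1))
    (.seq (.loop n (fun c => c.isNone) (body n)) (.seq (.pop n fun _ => .skip)
    (.seq (.mv (n + 1) (n + 2)) (.mv (n + 2) n))))),
    11 * .X + 9 + 8 * r + .X * (11 * .X + 8 + q.comp (.X + r + 1)), fun n s ⟨⟨b, l⟩, hx⟩ => ?_⟩
  have e : sz Γ l ≤ sz Γ (b, l) := by simp; omega
  have h₁ := hloop n s l b (sz Γ (b, l)) (r.eval (sz Γ (b, l))) e (hr _ hx)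
  refine ((does_split b l s n).seq (((does_mv31 _ _ _ _ _ _).of_eq rfl (by simp) le_rfl).seq
    (h₁.seq ((does_pop0 _ _ _ _ _ _ _).seq ((does_mv12 _ _ _ _ _ _).seq
    (does_mv20 _ _ _ _ _ _)))))).of_eq rfl (by simp) ?_
  have e₁ := hr _ hx l (List.prefix_refl _)
  change _ ≤ Polynomial.eval (sz Γ (b, l)) _
  have e₂ := Nat.mul_le_mul_right (11 * sz Γ (b, l) + 8 +
    q.eval (sz Γ (b, l) + r.eval (sz Γ (b, l)) + 1)) e
  have e₃ : sz Γ b ≤ sz Γ (b, l) := by simp; omega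
  simp only [List.length_reverse, List.length_append, List.length_nil, length_cd,
    Polynomial.eval_add, Polynomial.eval_mul, Polynomial.eval_X, Polynomial.eval_ofNat,
    Polynomial.eval_comp, Polynomial.eval_one] at *
  omega

/-- The size of an input, in unary. -/
theorem PTime.replicate_sz : PTime O (fun a : α => List.replicate (sz Γ a) ()) := by
  refine ⟨fun n => .seq (.push (n + 1) (some none)) (.seq
      (.pump n (n + 1) fun _ => [some none, none])
    (.seq (.mv (n + 1) (n + 2)) (.mv (n + 2) n))), 21 * .X + 12, fun n s a => ?_⟩
  have key : ∀ (x : List (Cell Γ)) (l : List Unit),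
      (x.flatMap fun _ => [some none, none]).reverse ++ cd Γ l =
        cd Γ (List.replicate x.length () ++ l) := by
    intro x
    induction x with
    | nil => exact fun l => rfl
    | cons c x ih =>
      intro l
      rw [List.length_cons, List.replicate_succ', List.append_assoc, ← ih]
      simp
  have key' := key (cd Γ a) []
  rw [List.append_nil, length_cd] at key'
  have hlen : (cd Γ (List.replicate (sz Γ a) ())).length = 2 * sz Γ a + 1 := by
    rw [← key', ← length_cd]
    simp [List.length_flatMap]
    omega
  refine ((does_push1 _ _ _ _ _ _ _).seq ((Prog.does_pump (K := 2) (by simp) (by simp) _).seq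
    (((does_mv12 s n [] (cd Γ (List.replicate (sz Γ a) ())) [] []).of_eq ?_ rfl le_rfl).seq
    (does_mv20 _ _ _ _ _ _)))).of_eq rfl (by simp) ?_
  · rw [← key']
    simp
  · simp [hlen, length_cd]
    omega

end PTime

/-! ### Closure properties of the polynomial-time functions -/

/-- Case distinction on a list. -/
def List.elim {δ β : Type} (f : β) (g : δ → List δ → β) : List δ → β
  | [] => f
  | d :: t => g d t

@[simp]
theorem List.elim_nil {δ β : Type} (f : β) (g : δ → List δ → β) : ([] : List δ).elim f g = f := rfl

@[simp]
theorem List.elim_cons {δ β : Type} (f : β) (g : δ → List δ → β) (d : δ) (t : List δ) :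
    (d :: t).elim f g = g d t := rfl

section Closure

variable {Γ : Type} {O : Oracle Γ}
variable {α β γ δ ρ : Type} [TreeRep Γ α] [TreeRep Γ β] [TreeRep Γ γ] [TreeRep Γ δ] [TreeRep Γ ρ]

namespace PTime

@[fun_prop]
theorem fst_comp {f : α → β × γ} (hf : PTime O f) : PTime O (fun a => (f a).1) := fst.comp hf

@[fun_prop]
theorem snd_comp {f : α → β × γ} (hf : PTime O f) : PTime O (fun a => (f a).2) := snd.comp hf

theorem of_eq {f g : α → β} (hf : PTime O f) (h : ∀ a, f a = g a) : PTime O g :=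
  (funext h : f = g) ▸ hf

@[fun_prop]
theorem cons {f : α → β} {g : α → List β} (hf : PTime O f) (hg : PTime O g) :
    PTime O (fun a => f a :: g a) :=
  (cast (f := fun x : β × List β => x.1 :: x.2) fun _ => rfl).comp (hf.prodMk hg)

@[fun_prop]
theorem some {f : α → β} (hf : PTime O f) : PTime O (fun a => some (f a)) :=
  (hf.cons (const [])).congr_enc (fun a => a) (fun _ => rfl) fun _ => rfl

@[fun_prop]
theorem listElim {l : α → List δ} {f : α → β} {g : α → δ → List δ → β} (hl : PTime O l)
    (hf : PTime O f) (hg : PTime O fun x : (δ × List δ) × α => g x.2 x.1.1 x.1.2) :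
    PTime O (fun a => (l a).elim (f a) (g a)) :=
  ((listCase hf hg).comp (hl.prodMk id)).of_eq fun a => by dsimp only; cases l a <;> rfl

@[fun_prop]
theorem optElim {o : α → Option δ} {f : α → β} {g : α → δ → β} (ho : PTime O o)
    (hf : PTime O f) (hg : PTime O fun x : δ × α => g x.2 x.1) :
    PTime O (fun a => (o a).elim (f a) (g a)) := by
  have h : PTime O fun a => (o a).toList :=
    (cast (f := fun o : Option δ => o.toList) fun _ => rfl).comp ho
  refine (h.listElim hf (g := fun a d _ => g a d) (hg.comp
      (f := fun x : (δ × List δ) × α => (x.1.1, x.2))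
    (by fun_prop))).of_eq fun a => ?_
  cases o a <;> rfl

@[fun_prop]
theorem cond {b : α → Bool} {f g : α → β} (hb : PTime O b) (hf : PTime O f) (hg : PTime O g) :
    PTime O (fun a => bif b a then f a else g a) := by
  have h : PTime O fun a => bif b a then [()] else [] :=
    (cast (f := fun b : Bool => bif b then [()] else []) fun _ => rfl).comp hb
  refine (h.listElim hg (g := fun a _ _ => f a) (hf.comp
      (f := fun x : (Unit × List Unit) × α => x.2)
    (by fun_prop))).of_eq fun a => ?_
  cases b a <;> rfl

@[fun_prop]
theorem and {b c : α → Bool} (hb : PTime O b) (hc : PTime O c) : PTime O (fun a => b a && c a) :=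
  (hb.cond hc (const false)).of_eq fun a => by cases b a <;> rfl

@[fun_prop]
theorem or {b c : α → Bool} (hb : PTime O b) (hc : PTime O c) : PTime O (fun a => b a || c a) :=
  (hb.cond (const true) hc).of_eq fun a => by cases b a <;> rfl

@[fun_prop]
theorem not {b : α → Bool} (hb : PTime O b) : PTime O (fun a => !b a) :=
  (hb.cond (const false) (const true)).of_eq fun a => by cases b a <;> rfl

@[fun_prop]
theorem optMap {o : α → Option δ} {g : α → δ → β} (ho : PTime O o)
    (hg : PTime O fun x : δ × α => g x.2 x.1) : PTime O (fun a => (o a).map (g a)) :=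
  (ho.optElim (const none) (g := fun a d => Option.some (g a d)) hg.some).of_eq fun a => by
    cases o a <;> rfl

@[fun_prop]
theorem orElse {o p : α → Option δ} (ho : PTime O o) (hp : PTime O p) :
    PTime O (fun a => (o a).or (p a)) :=
  (ho.optElim hp (g := fun _ d => Option.some d) (by fun_prop)).of_eq fun a => by
    cases o a <;> rfl

@[fun_prop]
theorem getD {o : α → Option δ} {d : α → δ} (ho : PTime O o) (hd : PTime O d) :
    PTime O (fun a => (o a).getD (d a)) :=
  (ho.optElim hd (g := fun _ d => d) (by fun_prop)).of_eq fun a => by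
    cases o a <;> rfl

theorem foldl {f : α → β → δ → β} {b : α → β} {l : α → List δ} (hb : PTime O b) (hl : PTime O l)
    (hf : PTime O fun x : α × β × δ => f x.1 x.2.1 x.2.2)
    (hr : ∃ r : Polynomial ℕ, ∀ a l', l' <+: l a → sz Γ (l'.foldl (f a) (b a)) ≤ r.eval (sz Γ a)) :
    PTime O (fun a => (l a).foldl (f a) (b a)) := by
  obtain ⟨r, hr⟩ := hr
  have key : ∀ (a : α) (b : β) (l : List δ),
      l.foldl (fun (y : α × β) d => (y.1, f y.1 y.2 d)) (a, b) = (a, l.foldl (f a) b) := by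
    intro a b l
    induction l generalizing b with
    | nil => rfl
    | cons d l ih => exact ih _
  have h := foldl_subtype (O := O) (f := fun y : δ × (α × β) => (y.2.1, f y.2.1 y.2.2 y.1))
    ((by fun_prop : PTime O fun y : δ × (α × β) => y.2.1).prodMk
      (hf.comp (f := fun y : δ × (α × β) => (y.2.1, y.2.2, y.1)) (by fun_prop)))
    (fun x => ∃ a, x = ((a, b a), l a)) (.X + r + 1) (by
      rintro _ ⟨a, rfl⟩ l' hl'
      dsimp only at hl' ⊢
      rw [key]
      have h₁ := hr a l' hl'
      have h₂ := r.eval_mono_nat (show sz Γ a ≤ sz Γ ((a, b a), l a) by simp; omega)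
      simp only [sz_prod, Polynomial.eval_add, Polynomial.eval_X, Polynomial.eval_one] at *
      omega)
  have h' : PTime O fun a => (⟨((a, b a), l a), a, rfl⟩ : {x // ∃ a, x = ((a, b a), l a)}) :=
    ((id.prodMk hb).prodMk hl).congr_enc (fun a => a) (fun _ => rfl) fun _ => rfl
  refine (snd_comp (h.comp h')).of_eq fun a => ?_
  dsimp only
  rw [key]

theorem sz_append (l l' : List α) : sz Γ (l ++ l') + 1 = sz Γ l + sz Γ l' := by
  induction l with
  | nil => simp; omega
  | cons a l ih => simp; omega

theorem sz_reverse (l : List α) : sz Γ l.reverse = sz Γ l := by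
  induction l with
  | nil => rfl
  | cons a l ih =>
    have := sz_append (Γ := Γ) l.reverse [a]
    simp at *
    omega

theorem sz_le_of_prefix {l l' : List α} (h : l' <+: l) : sz Γ l' ≤ sz Γ l := by
  obtain ⟨t, rfl⟩ := h
  have := sz_append (Γ := Γ) l' t
  have := sz_pos (Γ := Γ) t
  omega

theorem sz_le_of_suffix {l l' : List α} (h : l' <:+ l) : sz Γ l' ≤ sz Γ l := by
  obtain ⟨t, rfl⟩ := h
  have := sz_append (Γ := Γ) t l'
  have := sz_pos (Γ := Γ) t
  omega

theorem sz_le_of_mem {l : List α} {a : α} (h : a ∈ l) : sz Γ a < sz Γ l := by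
  induction l with
  | nil => simp at h
  | cons b l ih =>
    rw [sz_cons]
    rcases List.mem_cons.1 h with rfl | h
    · omega
    · have := ih h
      omega

@[fun_prop]
theorem reverse {l : α → List β} (hl : PTime O l) : PTime O (fun a => (l a).reverse) := by
  obtain ⟨q, hq⟩ := hl.sz_le
  refine (foldl (const []) hl (f := fun _ t d => d :: t) (by fun_prop) ⟨q, fun a l' h => ?_⟩).of_eq
    fun a => by simp
  rw [List.foldl_flip_cons_eq_append']
  have := sz_le_of_prefix (Γ := Γ) h
  have := hq a
  simp only [List.append_nil, sz_reverse]
  omega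

theorem foldr {f : α → δ → β → β} {b : α → β} {l : α → List δ} (hb : PTime O b) (hl : PTime O l)
    (hf : PTime O fun x : α × β × δ => f x.1 x.2.2 x.2.1)
    (hr : ∃ r : Polynomial ℕ, ∀ a l', l' <:+ l a → sz Γ (l'.foldr (f a) (b a)) ≤ r.eval (sz Γ a)) :
    PTime O (fun a => (l a).foldr (f a) (b a)) := by
  obtain ⟨r, hr⟩ := hr
  refine (foldl hb hl.reverse (f := fun a t d => f a d t) hf ⟨r, fun a l' h => ?_⟩).of_eq
    fun a => by simp
  have := hr a l'.reverse (by simpa using List.reverse_suffix.2 h)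
  simpa using this

@[fun_prop]
theorem append {l l' : α → List β} (hl : PTime O l) (hl' : PTime O l') :
    PTime O (fun a => l a ++ l' a) := by
  obtain ⟨q, hq⟩ := hl.sz_le
  obtain ⟨q', hq'⟩ := hl'.sz_le
  refine (foldr hl' hl (f := fun _ d t => d :: t) (by fun_prop) ⟨q + q', fun a t h => ?_⟩).of_eq
    fun a => by simp
  have := sz_le_of_suffix (Γ := Γ) h
  have := hq a
  have := hq' a
  have := sz_append (Γ := Γ) t (l' a)
  simp only [List.foldr_cons_eq_append', Polynomial.eval_add] at *
  omega

theorem sz_map_le {α : Type} (f : α → β) (l : List α) (R : ℕ) (h : ∀ a ∈ l, sz Γ (f a) ≤ R) :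
    sz Γ (l.map f) ≤ l.length * (R + 1) + 1 := by
  induction l with
  | nil => simp
  | cons a l ih =>
    have := ih fun a ha => h a (by simp [ha])
    have := h a (by simp)
    simp
    grind

@[fun_prop]
theorem map {l : α → List β} {f : α → β → γ} (hl : PTime O l)
    (hf : PTime O fun x : α × β => f x.1 x.2) : PTime O (fun a => (l a).map (f a)) := by
  obtain ⟨q, hq⟩ := hl.sz_le
  obtain ⟨r, hr⟩ := hf.sz_le
  refine (foldr (const []) hl (f := fun a d t => f a d :: t) (by fun_prop)
    ⟨q * (r.comp (.X + q + 1) + 1) + 1, fun a t h => ?_⟩).of_eq fun a => by simp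
  have e := sz_map_le (Γ := Γ) (f a) t (r.eval (sz Γ a + q.eval (sz Γ a) + 1)) fun b hb =>
    (hr (a, b)).trans (r.eval_mono_nat (by
      have := sz_le_of_mem (Γ := Γ) (h.subset hb)
      have := hq a
      simp; omega))
  have h₁ := sz_le_of_suffix (Γ := Γ) h
  have h₂ := length_lt_sz (Γ := Γ) t
  have h₃ := Nat.mul_le_mul_right (r.eval (sz Γ a + q.eval (sz Γ a) + 1) + 1)
    (show t.length ≤ q.eval (sz Γ a) by have := hq a; omega)
  simp only [← List.map_eq_foldr, Polynomial.eval_add, Polynomial.eval_mul, Polynomial.eval_X,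
    Polynomial.eval_comp, Polynomial.eval_one]
  omega

@[fun_prop]
theorem any {l : α → List β} {f : α → β → Bool} (hl : PTime O l)
    (hf : PTime O fun x : α × β => f x.1 x.2) : PTime O (fun a => (l a).any (f a)) :=
  (foldr (const false) hl (f := fun a d b => f a d || b)
    ((hf.comp (f := fun x : α × Bool × β => (x.1, x.2.2)) (by fun_prop)).or (by fun_prop))
    ⟨3, fun a t _ => by simpa using sz_bool_le _⟩).of_eq fun a => by
      induction l a with
      | nil => rfl
      | cons d l ih => rw [List.foldr_cons, ih, List.any_cons]

@[fun_prop]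
theorem flatten {l : α → List (List β)} (hl : PTime O l) : PTime O (fun a => (l a).flatten) := by
  have key : ∀ t : List (List β), sz Γ t.flatten ≤ sz Γ t := by
    intro t
    induction t with
    | nil => simp
    | cons d t ih =>
      have := sz_append (Γ := Γ) d t.flatten
      simp only [List.flatten_cons, sz_cons]
      omega
  have key' : ∀ t : List (List β), t.foldr (fun d t => d ++ t) [] = t.flatten := fun t => by
    induction t with
    | nil => rfl
    | cons d t ih => rw [List.foldr_cons, ih, List.flatten_cons]
  obtain ⟨q, hq⟩ := hl.sz_le
  refine (foldr (const []) hl (f := fun _ d t => d ++ t) (by fun_prop) ⟨q, fun a t h => ?_⟩).of_eq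
    fun a => key' _
  rw [key']
  exact (key t).trans ((sz_le_of_suffix h).trans (hq a))

/-- Iteration as often as the size of the input says. -/
theorem iterate {f : α → β → β} {b : α → β} (hb : PTime O b)
    (hf : PTime O fun x : α × β => f x.1 x.2)
    (hr : ∃ r : Polynomial ℕ, ∀ a, ∀ k ≤ sz Γ a, sz Γ ((f a)^[k] (b a)) ≤ r.eval (sz Γ a)) :
    PTime O (fun a => (f a)^[sz Γ a] (b a)) := by
  have key : ∀ (a : α) (b : β) (l : List Unit),
      l.foldl (fun y _ => f a y) b = (f a)^[l.length] b := by
    intro a b l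
    induction l generalizing b with
    | nil => rfl
    | cons d l ih => exact ih _
  obtain ⟨r, hr⟩ := hr
  refine (foldl hb replicate_sz (f := fun a y _ => f a y)
    (hf.comp (f := fun x : α × β × Unit => (x.1, x.2.1)) (by fun_prop))
    ⟨r, fun a l' h => ?_⟩).of_eq fun a => ?_
  · rw [key]
    exact hr a _ (by simpa using h.length_le)
  · rw [key, List.length_replicate]

end PTime

/-- Look for the first position in a list where `g` gives a result, `k` telling how to prepend an
element of the list to a result. -/
def List.search {δ ρ : Type} (g : δ → List δ → Option ρ) (k : δ → ρ → ρ) : List δ → Option ρ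
  | [] => none
  | a :: l => (g a l).or ((search g k l).map (k a))

theorem List.search_eq_some {δ ρ : Type} {g : δ → List δ → Option ρ} {k : δ → ρ → ρ} {l : List δ}
    {x : ρ}
    (h : l.search g k = Option.some x) :
    ∃ l₁ a l₂ y, l = l₁ ++ a :: l₂ ∧ g a l₂ = Option.some y ∧ x = l₁.foldr k y := by
  induction l generalizing x with
  | nil => simp [search] at h
  | cons a l ih =>
    simp only [search, Option.or_eq_some_iff, Option.map_eq_some_iff] at h
    rcases h with h | ⟨-, y, hy, rfl⟩
    · exact ⟨[], a, l, x, rfl, h, rfl⟩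
    · obtain ⟨l₁, b, l₂, z, rfl, hz, rfl⟩ := ih hy
      exact ⟨a :: l₁, b, l₂, z, rfl, hz, rfl⟩

theorem List.search_eq_none {δ ρ : Type} {g : δ → List δ → Option ρ} {k : δ → ρ → ρ} {l : List δ}
    (h : l.search g k = none) (l₁ : List δ) (a : δ) (l₂ : List δ) (e : l = l₁ ++ a :: l₂) :
    g a l₂ = none := by
  induction l generalizing l₁ with
  | nil => simp at e
  | cons b l ih =>
    simp only [search, Option.or_eq_none_iff, Option.map_eq_none_iff] at h
    cases l₁ with
    | nil => cases e; exact h.1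
    | cons c l₁ => cases e; exact ih h.2 l₁ rfl

theorem PTime.search {l : α → List δ} {g : α → δ → List δ → Option ρ} {k : α → δ → ρ → ρ}
    (hl : PTime O l) (hg : PTime O fun x : α × δ × List δ => g x.1 x.2.1 x.2.2)
    (hk : PTime O fun x : α × δ × ρ => k x.1 x.2.1 x.2.2)
    (hs : ∀ a d x, sz Γ (k a d x) ≤ sz Γ x + sz Γ d + 1) :
    PTime O (fun a => (l a).search (g a) (k a)) := by
  obtain ⟨q, hq⟩ := hl.sz_le
  obtain ⟨r, hr⟩ := hg.sz_le
  have key : ∀ a (l : List δ), l.foldr (fun d t => (d :: t.1, (g a d t.1).or (t.2.map (k a d))))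
      ([], Option.none) = (l, l.search (g a) (k a)) := by
    intro a l
    induction l with
    | nil => rfl
    | cons d l ih => rw [List.foldr_cons, ih]; rfl
  have bound : ∀ a (l : List δ), sz Γ (l.search (g a) (k a)) ≤
      r.eval (sz Γ a + sz Γ l + 1) + sz Γ l + 1 := by
    intro a l
    induction l with
    | nil => simp [List.search]
    | cons d l ih =>
      have h₁ := hr (a, d, l)
      have h₂ := r.eval_mono_nat
        (show sz Γ a + sz Γ l + 1 ≤ sz Γ a + sz Γ (d :: l) + 1 by simp; omega)
      have h₃ : ∀ o : Option ρ, sz Γ (o.map (k a d)) ≤ sz Γ o + sz Γ d + 1 := by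
        intro o
        cases o with
        | none => simp
        | some x => have := hs a d x; simp; omega
      have h₄ := h₃ (l.search (g a) (k a))
      simp only [List.search]
      simp only [sz_prod, sz_cons] at *
      cases h : g a d l with
      | none => simp only [Option.none_or]; omega
      | some x =>
        simp only [Option.some_or, h] at *
        rw [← add_assoc] at h₁
        simp only [add_assoc] at *
        omega
  refine ((foldr (const ([], Option.none)) hl
    (f := fun a d t => (d :: t.1, (g a d t.1).or (t.2.map (k a d)))) ?_
    ⟨r.comp (.X + q + 1) + 2 * q + 2, fun a t h => ?_⟩).snd_comp).of_eq fun a => by rw [key]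
  · refine .prodMk (by fun_prop) (.orElse ?_ (.optMap (by fun_prop) ?_))
    · exact hg.comp (f := fun x : α × (List δ × Option ρ) × δ => (x.1, x.2.2, x.2.1.1))
        (by fun_prop)
    · exact hk.comp (f := fun x : ρ × α × (List δ × Option ρ) × δ => (x.2.1, x.2.2.2, x.1))
        (by fun_prop)
  · rw [key]
    have h₁ := bound a t
    have h₂ := sz_le_of_suffix (Γ := Γ) h
    have h₃ := hq a
    have h₄ := r.eval_mono_nat (show sz Γ a + sz Γ t + 1 ≤ sz Γ a + q.eval (sz Γ a) + 1 by omega)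
    dsimp only at h₄
    simp only [sz_prod, Polynomial.eval_add, Polynomial.eval_mul, Polynomial.eval_X,
      Polynomial.eval_comp, Polynomial.eval_one, Polynomial.eval_ofNat]
    omega

end Closure

/-! ### Formulas as data, and recursion on formulas -/

section Formulas

open NC (Tok)

variable {A B : Type} {O : Oracle (Tok A B)} {P V R : Type}
variable [TreeRep (Tok A B) P] [TreeRep (Tok A B) V] [TreeRep (Tok A B) R]
variable {α β : Type} [TreeRep (Tok A B) α] [TreeRep (Tok A B) β]

/-- Case distinction on a connective. -/
def Conn.elim {β : Type} (a b : β) : Conn → β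
  | .and => a
  | .or => b

instance : TreeRep (Tok A B) Conn := ⟨fun o => .leaf (some (.opn o))⟩

instance {Γ : Type} : TreeRep Γ (Dt Γ) := ⟨id⟩

namespace NC

/-- The tree for a formula: a pair of a tag and the components. -/
def tree : NC P V → Dt (Tok A B)
  | const α β => .cons (.leaf (some .const)) (TreeRep.enc (α, β))
  | pos X α => .cons (.leaf (some .pos)) (TreeRep.enc (X, α))
  | neg X α => .cons (.leaf (some .neg)) (TreeRep.enc (X, α))
  | node o φs => .cons (.leaf (some (.opn o))) (encList (φs.map tree))

instance : TreeRep (Tok A B) (NC P V) := ⟨tree⟩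

theorem enc_const (α β : V) : (TreeRep.enc (const α β : NC P V) : Dt (Tok A B)) =
    .cons (.leaf (some .const)) (TreeRep.enc (α, β)) := by simp only [TreeRep.enc, tree]

theorem enc_pos (X : P) (α : V) : (TreeRep.enc (pos X α) : Dt (Tok A B)) =
    .cons (.leaf (some .pos)) (TreeRep.enc (X, α)) := by simp only [TreeRep.enc, tree]

theorem enc_neg (X : P) (α : V) : (TreeRep.enc (neg X α) : Dt (Tok A B)) =
    .cons (.leaf (some .neg)) (TreeRep.enc (X, α)) := by simp only [TreeRep.enc, tree]

theorem enc_node (o : Conn) (φs : List (NC P V)) :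
    (TreeRep.enc (node o φs) : Dt (Tok A B)) = TreeRep.enc (o, φs) := by
  have h : encList (φs.map (tree (A := A) (B := B))) = (encList φs : Dt (Tok A B)) := by
    induction φs with
    | nil => rfl
    | cons φ l ih => exact congrArg (Dt.cons _) ih
  have h' : (TreeRep.enc (node o φs) : Dt (Tok A B)) =
      .cons (.leaf (some (.opn o))) (encList (φs.map (tree (A := A) (B := B)))) := by
    simp only [TreeRep.enc, tree]
  rw [h', h]
  rfl

/-- The shape of a formula. -/
inductive Kind
  | const
  | pos
  | neg
  | node (o : Conn)

/-- The tag for a shape. -/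
def Kind.tok : Kind → Tok A B
  | const => .const
  | pos => .pos
  | neg => .neg
  | node o => .opn o

instance : TreeRep (Tok A B) Kind := ⟨fun k => .leaf (some k.tok)⟩

instance : Finite Conn :=
  .of_injective (fun o => (match o with | .and => true | .or => false : Bool)) fun a b => by
    cases a <;> cases b <;> simp

instance : Finite Kind :=
  .of_injective (fun k => (match k with
    | .const => .inl 0 | .pos => .inl 1 | .neg => .inl 2 | .node o => .inr o : Fin 3 ⊕ Conn))
    fun a b => by cases a <;> cases b <;> simp

theorem Kind.tok_injective : Function.Injective (Kind.tok : Kind → Tok A B) := fun a b => by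
  cases a <;> cases b <;> simp [tok]

variable (P V) in
/-- The components of a formula of a given shape. -/
def Comps : Kind → Type
  | .const => V × V
  | .pos => P × V
  | .neg => P × V
  | .node _ => List (NC P V)

instance : ∀ k, TreeRep (Tok A B) (Comps P V k)
  | .const => inferInstanceAs (TreeRep _ (V × V))
  | .pos => inferInstanceAs (TreeRep _ (P × V))
  | .neg => inferInstanceAs (TreeRep _ (P × V))
  | .node _ => inferInstanceAs (TreeRep _ (List (NC P V)))

/-- Case distinction on a formula. -/
def elim {β : Type} (fc : V → V → β) (fp fn : P → V → β) (fo : Conn → List (NC P V) → β) :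
    NC P V → β
  | const α β => fc α β
  | pos X α => fp X α
  | neg X α => fn X α
  | node o φs => fo o φs

/-- Shape and components. -/
def split : NC P V → Σ k, Comps P V k
  | const α β => ⟨.const, (α, β)⟩
  | pos X α => ⟨.pos, (X, α)⟩
  | neg X α => ⟨.neg, (X, α)⟩
  | node o φs => ⟨.node o, φs⟩

end NC

namespace PTime

@[fun_prop]
theorem ncElim {φ : α → NC P V} {fc : α → V → V → β} {fp fn : α → P → V → β}
    {fo : α → Conn → List (NC P V) → β} (hφ : PTime O φ)
    (hc : PTime O fun x : (V × V) × α => fc x.2 x.1.1 x.1.2)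
    (hp : PTime O fun x : (P × V) × α => fp x.2 x.1.1 x.1.2)
    (hn : PTime O fun x : (P × V) × α => fn x.2 x.1.1 x.1.2)
    (ho : PTime O fun x : (Conn × List (NC P V)) × α => fo x.2 x.1.1 x.1.2) :
    PTime O (fun a => (φ a).elim (fc a) (fp a) (fn a) (fo a)) := by
  -- the tree of a formula is that of the pair of its shape and its components
  have h₁ : PTime O fun x : NC P V × α =>
      (⟨x.1.split.1, x.1.split.2, x.2⟩ : Σ k, NC.Comps P V k × α) := by
    have h : PTime O fun x : (Dt (Tok A B) × Dt (Tok A B)) × Dt (Tok A B) =>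
        (x.1.1, x.1.2, x.2) := by fun_prop
    refine h.congr_enc (fun x => ((TreeRep.enc x.1.split.1, TreeRep.enc x.1.split.2),
      TreeRep.enc x.2)) ?_ fun _ => rfl
    rintro ⟨_ | _ | _ | ⟨o, φs⟩, a⟩
    · exact congrArg (Dt.cons · _) (NC.enc_const _ _).symm
    · exact congrArg (Dt.cons · _) (NC.enc_pos _ _).symm
    · exact congrArg (Dt.cons · _) (NC.enc_neg _ _).symm
    · exact congrArg (Dt.cons · _) (NC.enc_node o φs).symm
  have h₂ := finCase (O := O) NC.Kind.tok NC.Kind.tok_injective (fun _ => rfl)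
    (α := fun k => NC.Comps P V k × α) (f := fun k => match k with
      | .const => fun x : (V × V) × α => fc x.2 x.1.1 x.1.2
      | .pos => fun x : (P × V) × α => fp x.2 x.1.1 x.1.2
      | .neg => fun x : (P × V) × α => fn x.2 x.1.1 x.1.2
      | .node o => fun x : List (NC P V) × α => fo x.2 o x.1) (by
        rintro (_ | _ | _ | o)
        · exact hc
        · exact hp
        · exact hn
        · exact ho.comp (f := fun x : List (NC P V) × α => ((o, x.1), x.2)) (by fun_prop))
  refine ((h₂.comp h₁).comp (hφ.prodMk id)).of_eq fun a => ?_
  dsimp only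
  cases φ a <;> rfl

@[fun_prop]
theorem ncConst {v w : α → V} (hv : PTime O v) (hw : PTime O w) :
    PTime O (fun a => NC.const (P := P) (v a) (w a)) :=
  ((const NC.Kind.const).prodMk (hv.prodMk hw)).congr_enc (fun a => a) (fun _ => rfl)
    fun _ => NC.enc_const _ _

@[fun_prop]
theorem ncPos {X : α → P} {v : α → V} (hX : PTime O X) (hv : PTime O v) :
    PTime O (fun a => NC.pos (X a) (v a)) :=
  ((const NC.Kind.pos).prodMk (hX.prodMk hv)).congr_enc (fun a => a) (fun _ => rfl)
    fun _ => NC.enc_pos _ _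

@[fun_prop]
theorem ncNeg {X : α → P} {v : α → V} (hX : PTime O X) (hv : PTime O v) :
    PTime O (fun a => NC.neg (X a) (v a)) :=
  ((const NC.Kind.neg).prodMk (hX.prodMk hv)).congr_enc (fun a => a) (fun _ => rfl)
    fun _ => NC.enc_neg _ _

@[fun_prop]
theorem ncNode {o : α → Conn} {l : α → List (NC P V)} (ho : PTime O o) (hl : PTime O l) :
    PTime O (fun a => NC.node (o a) (l a)) :=
  (ho.prodMk hl).congr_enc (fun a => a) (fun _ => rfl) fun _ => NC.enc_node _ _

@[fun_prop]
theorem connElim {o : α → Conn} {f g : α → β} (ho : PTime O o) (hf : PTime O f) (hg : PTime O g) :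
    PTime O (fun a => (o a).elim (f a) (g a)) := by
  have h : PTime O fun a => (⟨o a, a⟩ : Σ _ : Conn, α) :=
    (ho.prodMk id).congr_enc (fun a => a) (fun _ => rfl) fun _ => rfl
  exact (finCase (O := O) Tok.opn (fun _ _ h => by simpa using h) (fun _ => rfl)
    (f := fun o a => o.elim (f a) (g a)) (Conn.rec hf hg)).comp h

end PTime

namespace NC

theorem sz_const (α β : V) : sz (Tok A B) (const α β : NC P V) =
    sz (Tok A B) α + sz (Tok A B) β + 3 := by
  simp only [sz, cd, enc_const]
  simp [Dt.code, TreeRep.enc]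

theorem sz_lit (X : P) (α : V) : sz (Tok A B) (pos X α) = sz (Tok A B) X + sz (Tok A B) α + 3 ∧
    sz (Tok A B) (neg X α) = sz (Tok A B) X + sz (Tok A B) α + 3 := by
  simp only [sz, cd, enc_pos, enc_neg]
  simp [Dt.code, TreeRep.enc]

theorem sz_node (o : Conn) (φs : List (NC P V)) :
    sz (Tok A B) (node o φs) = sz (Tok A B) φs + 2 := by
  have : sz (Tok A B) (node o φs) = sz (Tok A B) (o, φs) := by simp only [sz, cd, enc_node]
  rw [this, sz_prod, show sz (Tok A B) o = 1 from rfl]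
  omega

/-- Recursion on formulas: the value of `leaf` at the literals and constants, and of `node` at a
connective and the list of its arguments with their values. -/
def para {R : Type} (leaf : NC P V → R) (nd : Conn → List (NC P V × R) → R) : NC P V → R
  | node o φs => nd o (φs.map fun φ => (φ, para leaf nd φ))
  | const α β => leaf (const α β)
  | pos X α => leaf (pos X α)
  | neg X α => leaf (neg X α)

/-- The state of the evaluation of `para` with an explicit stack: each entry is a connective, the
arguments that have been evaluated, the last one first, and the arguments still to be evaluated. -/
abbrev Stack (P V R : Type) := List (Conn × List R × List (NC P V))

/-- One step of the evaluation of `para` with an explicit stack. -/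
def paraStep {R : Type} (leaf : NC P V → R) (nd : Conn → List (NC P V × R) → R)
    (S : Stack P V (NC P V × R)) : Stack P V (NC P V × R) :=
  S.elim [] fun x st => x.2.2.elim
    (st.elim [x] fun y st =>
      (y.1, (node x.1 (x.2.1.reverse.map fun z => z.1), nd x.1 x.2.1.reverse) :: y.2.1,
        y.2.2) :: st)
    fun φ t => φ.elim
      (fun v w => (x.1, (const v w, leaf (const v w)) :: x.2.1, t) :: st)
      (fun v w => (x.1, (pos v w, leaf (pos v w)) :: x.2.1, t) :: st)
      (fun v w => (x.1, (neg v w, leaf (neg v w)) :: x.2.1, t) :: st)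
      fun o φs => (o, [], φs) :: (x.1, x.2.1, t) :: st

/-- The number of steps for evaluating a formula. -/
def steps : NC P V → ℕ
  | const _ _ => 1
  | pos _ _ => 1
  | neg _ _ => 1
  | node _ φs => 2 + (φs.map steps).sum

theorem steps_le (φ : NC P V) : steps φ ≤ sz (Tok A B) φ := by
  induction φ using NC.induct with
  | const _ _ => rw [sz_const, steps]; omega
  | pos _ _ => rw [(sz_lit _ _).1, steps]; omega
  | neg _ _ => rw [(sz_lit _ _).2, steps]; omega
  | node o φs ih =>
    rw [sz_node, steps]
    induction φs with
    | nil => simp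
    | cons φ l ihl =>
      have := ihl fun φ h => ih φ (by simp [h])
      have := ih φ (by simp)
      simp at *
      omega

section Para

variable {R : Type} (leaf : NC P V → R) (nd : Conn → List (NC P V × R) → R)

/-- The next argument is evaluated in as many steps as `steps` says. -/
theorem paraStep_iterate (φ : NC P V) (o : Conn) (d : List (NC P V × R)) (t : List (NC P V))
    (st : Stack P V (NC P V × R)) : (paraStep leaf nd)^[steps φ] ((o, d, φ :: t) :: st) =
      (o, (φ, para leaf nd φ) :: d, t) :: st := by
  induction φ using NC.induct generalizing o d t st with
  | const _ _ => simp [steps, paraStep, para, elim]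
  | pos _ _ => simp [steps, paraStep, para, elim]
  | neg _ _ => simp [steps, paraStep, para, elim]
  | node o₁ φs ih =>
    have key : ∀ (l : List (NC P V)) (d' : List (NC P V × R)), (∀ φ ∈ l, φ ∈ φs) →
        (paraStep leaf nd)^[(l.map steps).sum] ((o₁, d', l) :: (o, d, t) :: st) =
          (o₁, (l.map fun φ => (φ, para leaf nd φ)).reverse ++ d', []) :: (o, d, t) :: st := by
      intro l
      induction l with
      | nil => intros; rfl
      | cons φ l ihl =>
        intro d' hl
        rw [List.map_cons, List.sum_cons, Nat.add_comm, Function.iterate_add_apply,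
          ih φ (hl _ (by simp)), ihl _ fun φ h => hl φ (by simp [h])]
        simp
    rw [steps, show 2 + (φs.map steps).sum = 1 + (φs.map steps).sum + 1 by omega,
      Function.iterate_add_apply, Function.iterate_add_apply]
    simp only [Function.iterate_one, paraStep, List.elim_cons, elim]
    rw [key _ _ fun _ h => h]
    simp [para, Function.comp_def]

/-- Each state of the evaluation comes from a stack of formulas by adding their values. -/
theorem paraStep_invariant (S : Stack P V (NC P V)) : ∃ S' : Stack P V (NC P V),
    sz (Tok A B) S' ≤ sz (Tok A B) S + 6 ∧
    paraStep leaf nd (S.map fun x => (x.1, x.2.1.map fun φ => (φ, para leaf nd φ), x.2.2)) =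
      S'.map fun x => (x.1, x.2.1.map fun φ => (φ, para leaf nd φ), x.2.2) := by
  have hc : ∀ o : Conn, sz (Tok A B) o = 1 := fun o => rfl
  match S with
  | [] => exact ⟨[], by simp, rfl⟩
  | [(o, d, [])] => exact ⟨[(o, d, [])], by simp, rfl⟩
  | (o, d, []) :: (o', d', t') :: st =>
    refine ⟨(o', node o d.reverse :: d', t') :: st, ?_, ?_⟩
    · simp [sz_node, PTime.sz_reverse, hc]; omega
    · simp [paraStep, para, Function.comp_def, List.map_reverse]
  | (o, d, const α β :: t) :: st =>
    exact ⟨(o, const α β :: d, t) :: st, by simp; omega, by simp [paraStep, para, elim]⟩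
  | (o, d, pos α β :: t) :: st =>
    exact ⟨(o, pos α β :: d, t) :: st, by simp; omega, by simp [paraStep, para, elim]⟩
  | (o, d, neg α β :: t) :: st =>
    exact ⟨(o, neg α β :: d, t) :: st, by simp; omega, by simp [paraStep, para, elim]⟩
  | (o, d, node o₁ φs :: t) :: st =>
    exact ⟨(o₁, [], φs) :: (o, d, t) :: st, by simp [sz_node, hc]; omega, by simp [paraStep, elim]⟩

end Para

end NC

theorem sz_map_le_mul {Γ : Type} {α β : Type} [TreeRep Γ α] [TreeRep Γ β] {f : α → β} {K : ℕ}
    (hK : 1 ≤ K) {l : List α} (h : ∀ a ∈ l, sz Γ (f a) ≤ K * sz Γ a) :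
    sz Γ (l.map f) ≤ K * sz Γ l := by
  induction l with
  | nil => simpa
  | cons a l ih =>
    have := ih fun a ha => h a (by simp [ha])
    have := h a (by simp)
    simp only [List.map_cons, sz_cons, Nat.mul_add]
    omega

/-- Recursion on formulas is polynomial if the values of all formulas are of polynomial size: the
recursion runs on an explicit stack, and each step adds a constant to the size of the stack without
the values. -/
theorem PTime.para {leaf : α → NC P V → R} {nd : α → Conn → List (NC P V × R) → R} {φ : α → NC P V}
    (hφ : PTime O φ) (hl : PTime O fun x : α × NC P V => leaf x.1 x.2)
    (hn : PTime O fun x : α × Conn × List (NC P V × R) => nd x.1 x.2.1 x.2.2)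
    (hr : ∃ r : Polynomial ℕ, ∀ a φ, sz (Tok A B) (NC.para (leaf a) (nd a) φ) ≤
      r.eval (sz (Tok A B) a + sz (Tok A B) φ)) :
    PTime O (fun a => NC.para (leaf a) (nd a) (φ a)) := by
  have hstep : PTime O fun x : (α × NC P V) × NC.Stack P V (NC P V × R) =>
      NC.paraStep (leaf x.1.1) (nd x.1.1) x.2 := by
    have hleaf : ∀ {β : Type} [TreeRep (Tok A B) β] {f : β → α} {χ : β → NC P V}, PTime O f →
        PTime O χ → PTime O fun b => leaf (f b) (χ b) := fun hf hχ => hl.comp (hf.prodMk hχ)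
    have hnode : ∀ {β : Type} [TreeRep (Tok A B) β] {f : β → α} {o : β → Conn}
        {l : β → List (NC P V × R)}, PTime O f → PTime O o → PTime O l →
        PTime O fun b => nd (f b) (o b) (l b) := fun hf ho hl => hn.comp (hf.prodMk (ho.prodMk hl))
    unfold NC.paraStep
    fun_prop
  have hiter : PTime O fun x : α × NC P V => (NC.paraStep (leaf x.1) (nd x.1))^[sz (Tok A B) x]
      [(.and, [], [x.2])] := by
    obtain ⟨r, hr⟩ := hr
    refine iterate (by fun_prop) hstep ⟨(r.comp (7 * .X + 8) + 2) * (7 * .X + 8), fun a k hk => ?_⟩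
    have inv : ∀ k : ℕ, ∃ S' : NC.Stack P V (NC P V),
        sz (Tok A B) S' ≤ sz (Tok A B) a.2 + 8 + 6 * k ∧
        (NC.paraStep (leaf a.1) (nd a.1))^[k] [(.and, [], [a.2])] =
        S'.map fun x => (x.1, x.2.1.map fun φ => (φ, NC.para (leaf a.1) (nd a.1) φ), x.2.2) := by
      intro k
      induction k with
      | zero =>
        exact ⟨[(.and, [], [a.2])],
          by simp [show sz (Tok A B) Conn.and = 1 from rfl]; omega, rfl⟩
      | succ k ih =>
        obtain ⟨S, h₁, h₂⟩ := ih
        obtain ⟨S', h₃, h₄⟩ := NC.paraStep_invariant (A := A) (B := B) (leaf a.1) (nd a.1) S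
        exact ⟨S', by omega, by rw [Function.iterate_succ_apply', h₂, h₄]⟩
    obtain ⟨S, h₁, h₂⟩ := inv k
    obtain ⟨a, φ⟩ := a
    rw [sz_prod] at *
    set N := sz (Tok A B) a + sz (Tok A B) φ + 1 with hN
    have h₃ : sz (Tok A B) S ≤ 7 * N + 7 := by dsimp only at h₁; omega
    set K := r.eval (7 * N + 8) with hK
    rw [h₂]
    have h₄ : ∀ x ∈ S,
        sz (Tok A B) ((x.1, x.2.1.map fun φ => (φ, NC.para (leaf a) (nd a) φ), x.2.2) :
          Conn × List (NC P V × R) × List (NC P V)) ≤ (K + 2) * sz (Tok A B) x := by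
      rintro ⟨o, d, t⟩ hx
      have e₁ := sz_le_of_mem (Γ := Tok A B) hx
      have e₂ : ∀ ψ ∈ d,
          sz (Tok A B) (ψ, NC.para (leaf a) (nd a) ψ) ≤ (K + 2) * sz (Tok A B) ψ := by
        intro ψ hψ
        have e₃ := sz_le_of_mem (Γ := Tok A B) hψ
        simp only [sz_prod] at *
        have e₄ := (hr a ψ).trans (r.eval_mono_nat (show _ ≤ 7 * N + 8 by omega))
        have e₅ := sz_pos (Γ := Tok A B) ψ
        change _ ≤ K at e₄
        nlinarith
      have e₃ := sz_map_le_mul (by omega) e₂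
      simp only [sz_prod]
      nlinarith
    refine (sz_map_le_mul (by omega) h₄).trans ?_
    simp only [Polynomial.eval_mul, Polynomial.eval_add, Polynomial.eval_comp, Polynomial.eval_X,
      Polynomial.eval_ofNat]
    exact Nat.mul_le_mul_left _ (by omega)
  have hout : PTime O fun x : (α × NC P V) × NC.Stack P V (NC P V × R) =>
      x.2.elim (leaf x.1.1 x.1.2) fun y _ => y.2.1.elim (leaf x.1.1 x.1.2) fun z _ => z.2 := by
    fun_prop
  refine (hout.comp ((PTime.id.prodMk hiter).comp (PTime.id.prodMk hφ))).of_eq fun a => ?_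
  obtain ⟨k, hk⟩ := Nat.exists_eq_add_of_le ((NC.steps_le (A := A) (B := B) (φ a)).trans
    (show _ ≤ sz (Tok A B) (a, φ a) by simp; omega))
  -- the iteration makes more steps than needed, and the rest of them change nothing
  have fix : ∀ (k : ℕ) (x : NC P V × R), (NC.paraStep (leaf a) (nd a))^[k] [(.and, [x], [])] =
      [(.and, [x], [])] := fun k x => Function.iterate_fixed rfl k
  dsimp only
  rw [hk, Nat.add_comm, Function.iterate_add_apply, NC.paraStep_iterate, fix]
  rfl

end Formulas

/-! ### Finding an inference -/

section Search

open NC (Tok)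

/-- Equality of connectives, as a Boolean. -/
def Conn.same (o o' : Conn) : Bool := o.elim (o'.elim true false) (o'.elim false true)

theorem Conn.same_iff {o o' : Conn} : o.same o' = true ↔ o = o' := by
  cases o <;> cases o' <;> simp [same, elim]

theorem List.search_map {δ ε ρ : Type} (f : ε → δ) (g : δ → List δ → Option ρ) (k : δ → ρ → ρ)
    (l : List ε) : (l.map f).search g k =
      l.search (fun a t => g (f a) (t.map f)) fun a x => k (f a) x := by
  induction l with
  | nil => rfl
  | cons a l ih => simp [search, ih]

namespace NC

section Algorithms

variable {P D : Type} (eq : P → P → Bool) (le : D → D → Bool)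

/-- Whether a formula is `(∨)`. -/
def isBot : NC P D → Bool :=
  elim (fun _ _ => false) (fun _ _ => false) (fun _ _ => false)
    fun o φs => o.elim false (φs.elim true fun _ _ => false)

/-- Whether a formula is a literal `X ≤ β` with `β < α`. -/
def negBelow (X : P) (α : D) : NC P D → Bool :=
  elim (fun _ _ => false) (fun _ _ => false) (fun Y β => eq X Y && !le α β) fun _ _ => false

/-- Whether a formula has a literal `X ≤ β` with `β < α` under conjunctions only, and the result of
removing a disjunct that has, if there is one. -/
def cutStep (X : P) (α : D) : NC P D → Bool × Option (NC P D) :=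
  para (fun φ => (negBelow eq le X α φ, none)) fun o l =>
    (o.elim (l.any fun x => x.2.1) false,
      (l.search (fun x rest => (x.2.2.map fun ψ => ψ :: rest.map fun y => y.1).or
        (o.elim none (bif x.2.1 then some (rest.map fun y => y.1) else none)))
        fun x y => x.1 :: y).map fun φs => node o φs)

/-- What becomes of the arguments of `o` from `φ` on, `rest` being those after `φ`, when `φ` is
merged with `o` or its connective is removed. -/
def mergeStep (o : Conn) (φ : NC P D) (rest : List (NC P D)) : Option (List (NC P D)) :=
  φ.elim (fun _ _ => none) (fun _ _ => none) (fun _ _ => none) fun o' ψs =>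
    (bif o.same o' then some (ψs ++ rest) else none).or
      (ψs.elim none fun ψ t => t.elim (some (ψ :: rest)) fun _ _ => none)

/-- Whether there are conjuncts `X ≥ α` and `X ≤ β` with `β < α`. -/
def clash (φs : List (NC P D)) : Bool :=
  φs.any fun φ => φ.elim (fun _ _ => false) (fun X α => φs.any fun ψ => negBelow eq le X α ψ)
    (fun _ _ => false) fun _ _ => false

/-- Join two conjuncts `X ≥ α` and `X ≥ β`. -/
def maxStep (φs : List (NC P D)) : Option (List (NC P D)) :=
  φs.search (fun φ rest => φ.elim (fun _ _ => none) (fun X α =>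
    (rest.search (fun ψ r => ψ.elim (fun _ _ => none)
        (fun Y β => bif eq X Y then some (bif le α β then β else α, r) else none)
        (fun _ _ => none) fun _ _ => none)
      fun ψ x => (x.1, ψ :: x.2)).map fun x => pos X x.1 :: x.2)
    (fun _ _ => none) fun _ _ => none) fun φ x => φ :: x

/-- Apply a simplification rule, if possible. Rule `∨⊥` needs no case of its own: to remove a
disjunct `(∨)` is to merge it with the disjunction. -/
def simpStep : NC P D → Option (NC P D) :=
  para (fun _ => none) fun o l =>
    ((l.search (fun x rest => (x.2.map fun ψ => ψ :: rest.map fun y => y.1).or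
      (mergeStep o x.1 (rest.map fun y => y.1))) fun x y => x.1 :: y).map fun φs => node o φs).or
    (o.elim (bif (l.any fun x => isBot x.1) || clash eq le (l.map fun x => x.1)
      then some (node .or [])
      else (maxStep eq le (l.map fun x => x.1)).map fun φs => node .and φs) none)

/-- Apply rule `RUR`, if possible. -/
def rurStep (φ : NC P D) : Option (NC P D) :=
  φ.elim (fun _ _ => none) (fun _ _ => none) (fun _ _ => none) fun o φs =>
    o.elim ((φs.search (fun ψ rest =>
      (φs.search (fun u _ => u.elim (fun _ _ => none) (fun X α => (cutStep eq le X α ψ).2)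
        (fun _ _ => none) fun _ _ => none) fun _ x => x).map fun χ => χ :: rest)
      fun φ x => φ :: x).map fun φs => node .and φs) none

/-- Make one inference, if possible. -/
def next (φ : NC P D) : Option (NC P D) := (simpStep eq le φ).or (rurStep eq le φ)

theorem cutStep_node (X : P) (α : D) (o : Conn) (φs : List (NC P D)) :
    cutStep eq le X α (node o φs) = (o.elim (φs.any fun φ => (cutStep eq le X α φ).1) false,
      (φs.search (fun φ rest => ((cutStep eq le X α φ).2.map fun ψ => ψ :: rest).or
        (o.elim none (bif (cutStep eq le X α φ).1 then some rest else none)))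
        fun φ x => φ :: x).map fun φs => node o φs) := by
  simp [cutStep, para, List.search_map, Function.comp_def]

theorem simpStep_node (o : Conn) (φs : List (NC P D)) :
    simpStep eq le (node o φs) =
      ((φs.search (fun φ rest => ((simpStep eq le φ).map fun ψ => ψ :: rest).or
        (mergeStep o φ rest)) fun φ x => φ :: x).map fun φs => node o φs).or
      (o.elim (bif φs.any isBot || clash eq le φs then some (node .or [])
        else (maxStep eq le φs).map fun φs => node .and φs) none) := by
  simp [simpStep, para, List.search_map, Function.comp_def]

end Algorithms

section Correctness

variable {P D T : Type*} {val : D → T}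

theorem map_node (o : Conn) (φs : List (NC P D)) :
    map val (node o φs) = node o (φs.map (map val)) := by simp [map]

theorem map_eq_pos {φ : NC P D} {X : P} {a : T} :
    map val φ = pos X a ↔ ∃ α, φ = pos X α ∧ val α = a := by
  cases φ <;> simp [map]

theorem map_eq_node {φ : NC P D} {o : Conn} {ψs : List (NC P T)} :
    map val φ = node o ψs ↔ ∃ φs, φ = node o φs ∧ φs.map (map val) = ψs := by
  cases φ <;> simp [map]

theorem foldr_snd_cons {δ ε : Type*} (l : List δ) (y : ε × List δ) :
    l.foldr (fun a x => (x.1, a :: x.2)) y = (y.1, l ++ y.2) := by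
  induction l <;> simp_all

theorem foldr_const {δ ε : Type*} (l : List δ) (y : ε) : l.foldr (fun _ x => x) y = y := by
  induction l <;> simp_all

end Correctness

section Correctness

variable {P D : Type} {T : Type*} [LinearOrder T] {eq : P → P → Bool} {le : D → D → Bool}
  {val : D → T}

theorem isBot_iff {φ : NC P D} : isBot φ = true ↔ φ = node .or [] := by
  rcases φ with _ | _ | _ | ⟨_ | _, _ | _⟩ <;> simp [isBot, elim, Conn.elim]

variable (heq : ∀ X Y, eq X Y = true ↔ X = Y) (hle : ∀ α β, le α β = true ↔ val α ≤ val β)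

include heq hle

theorem negBelow_iff {X : P} {α : D} {φ : NC P D} :
    negBelow eq le X α φ = true ↔ ∃ β, β < val α ∧ map val φ = neg X β := by
  cases φ with
  | neg Y β =>
    have : le α β = false ↔ val β < val α := by rw [← not_le, ← hle]; simp
    simp only [negBelow, elim, Bool.and_eq_true, heq, Bool.not_eq_true', this, map, neg.injEq]
    grind
  | _ => simp [negBelow, elim, map]

theorem clash_iff {φs : List (NC P D)} : clash eq le φs = true ↔ ∃ X α β,
    pos X α ∈ φs.map (map val) ∧ neg X β ∈ φs.map (map val) ∧ β < α := by
  simp only [clash, List.any_eq_true, List.mem_map]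
  constructor
  · rintro ⟨φ, hφ, h⟩
    cases φ with
    | pos X α =>
      simp only [elim, List.any_eq_true, negBelow_iff heq hle] at h
      obtain ⟨ψ, hψ, β, hβ, e⟩ := h
      exact ⟨X, val α, β, ⟨_, hφ, by simp [map]⟩, ⟨ψ, hψ, e⟩, hβ⟩
    | _ => simp [elim] at h
  · rintro ⟨X, α, β, ⟨φ, hφ, e⟩, ⟨ψ, hψ, e'⟩, h⟩
    obtain ⟨α, rfl, rfl⟩ := map_eq_pos.1 e
    refine ⟨_, hφ, ?_⟩
    simp only [elim, List.any_eq_true, negBelow_iff heq hle]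
    exact ⟨ψ, hψ, β, h, e'⟩

variable {μ : NC P D → ℕ} {w e : ℕ}
  (hμ : ∀ o φs, μ (node o φs) = w + (φs.map fun φ => e + μ φ).sum)

include hμ

/-- The results are correct, and not larger than `φ` in any additive measure of size, such as the
number of occurrences (`w = 1`, `e = 0`), the length of the string (`w = 2`, `e = 0`) or the number
of nodes of the tree (`w = 3`, `e = 1`). -/
theorem cutStep_spec (X : P) (α : D) (φ : NC P D) :
    ((cutStep eq le X α φ).1 = true ↔ ∃ β, β < val α ∧ ConjWith (neg X β) (map val φ)) ∧
    (∀ ψ, (cutStep eq le X α φ).2 = some ψ →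
      Cut X (val α) (map val φ) (map val ψ) ∧ μ ψ ≤ μ φ) ∧
    ((cutStep eq le X α φ).2 = none → ∀ ψ, ¬ Cut X (val α) (map val φ) ψ) := by
  have lit : ∀ φ : NC P D, (∀ o φs, φ ≠ node o φs) → ((negBelow eq le X α φ = true ↔
      ∃ β, β < val α ∧ ConjWith (neg X β) (map val φ)) ∧ ∀ ψ, ¬ Cut X (val α) (map val φ) ψ) := by
    intro φ hφ
    constructor
    · rw [negBelow_iff heq hle]
      refine exists_congr fun β => and_congr_right fun _ => ⟨fun h => h ▸ .lit, fun h => ?_⟩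
      generalize hψ : map val φ = ψ at h
      cases h with
      | lit => rfl
      | conj => obtain ⟨φs, rfl, -⟩ := map_eq_node.1 hψ; exact absurd rfl (hφ _ _)
    · intro ψ h
      generalize hψ : map val φ = χ at h
      cases h <;> (obtain ⟨φs, rfl, -⟩ := map_eq_node.1 hψ; exact absurd rfl (hφ _ _))
  induction φ using NC.induct with
  | const a b => simpa [cutStep, para] using lit (const a b) (by simp)
  | pos a b => simpa [cutStep, para] using lit (pos a b) (by simp)
  | neg a b => simpa [cutStep, para] using lit (neg a b) (by simp)
  | node o φs ih =>
    rw [cutStep_node, map_node]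
    refine ⟨?_, fun ψ h => ?_, fun h ψ hc => ?_⟩
    · cases o with
      | and =>
        simp only [Conn.elim, List.any_eq_true]
        constructor
        · rintro ⟨φ, hφ, h⟩
          obtain ⟨β, hβ, hc⟩ := (ih φ hφ).1.1 h
          exact ⟨β, hβ, .conj (List.mem_map_of_mem hφ) hc⟩
        · rintro ⟨β, hβ, _ | ⟨h, hc⟩⟩
          obtain ⟨φ, hφ, rfl⟩ := List.mem_map.1 h
          exact ⟨φ, hφ, (ih φ hφ).1.2 ⟨β, hβ, hc⟩⟩
      | or =>
        simp only [Conn.elim, Bool.false_eq_true, false_iff]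
        rintro ⟨β, hβ, hc⟩
        cases hc
    · simp only [Option.map_eq_some_iff] at h
      obtain ⟨χs, hs, rfl⟩ := h
      obtain ⟨l, φ, r, y, rfl, h, rfl⟩ := List.search_eq_some hs
      rw [List.foldr_cons_eq_append', map_node]
      simp only [Option.or_eq_some_iff, Option.map_eq_some_iff] at h
      rcases h with ⟨χ, h, rfl⟩ | ⟨-, h⟩
      · obtain ⟨h₁, h₂⟩ := (ih φ (by simp)).2.1 χ h
        refine ⟨?_, ?_⟩
        · simpa using Cut.deep o (l.map (map val)) (r.map (map val)) h₁
        · simp [hμ]; omega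
      · cases o with
        | and => simp [Conn.elim] at h
        | or =>
          simp only [Conn.elim] at h
          cases hb : (cutStep eq le X α φ).1 with
          | false => simp [hb] at h
          | true =>
            obtain ⟨β, hβ, hc⟩ := (ih φ (by simp)).1.1 hb
            simp only [hb, cond_true, Option.some.injEq] at h
            subst h
            refine ⟨?_, ?_⟩
            · simpa using Cut.here (l.map (map val)) (r.map (map val)) hβ hc
            · simp [hμ]
    · simp only [Option.map_eq_none_iff] at h
      have key := fun l φ r e => List.search_eq_none h l φ r e
      simp only [Option.or_eq_none_iff, Option.map_eq_none_iff] at key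
      generalize hψ : node o (φs.map (map val)) = χ at hc
      cases hc with
      | @here β C l r hβ hC =>
        simp only [node.injEq] at hψ
        obtain ⟨rfl, hψ⟩ := hψ
        obtain ⟨l, s, rfl, rfl, e₂⟩ := List.map_eq_append_iff.1 hψ
        obtain ⟨φ, r, rfl, rfl, rfl⟩ := List.map_eq_cons_iff.1 e₂
        have := (key l φ r rfl).2
        simp [Conn.elim, (ih φ (by simp)).1.2 ⟨β, hβ, hC⟩] at this
      | @deep χ χ' _ l r hc =>
        simp only [node.injEq] at hψ
        obtain ⟨rfl, hψ⟩ := hψ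
        obtain ⟨l, s, rfl, rfl, e₂⟩ := List.map_eq_append_iff.1 hψ
        obtain ⟨φ, r, rfl, rfl, rfl⟩ := List.map_eq_cons_iff.1 e₂
        exact (ih φ (by simp)).2.2 (key l φ r rfl).1 _ hc

omit heq hle in
theorem mergeStep_some {o : Conn} {φ : NC P D} {l r φs : List (NC P D)}
    (h : mergeStep o φ r = some φs) :
    SimpRule (map val (node o (l ++ φ :: r))) (map val (node o (l ++ φs))) ∧
      μ (node o (l ++ φs)) ≤ μ (node o (l ++ φ :: r)) := by
  cases φ with
  | node o' ψs =>
    simp only [mergeStep, elim, Option.or_eq_some_iff] at h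
    rcases h with h | ⟨-, h⟩
    · cases hs : o.same o' with
      | false => simp [hs] at h
      | true =>
        simp only [hs, cond_true, Option.some.injEq] at h
        obtain rfl := Conn.same_iff.1 hs
        subst h
        refine ⟨?_, ?_⟩
        · simpa [map_node] using SimpRule.merge o (ψs.map (map val)) (l.map (map val))
            (r.map (map val))
        · simp [hμ]; omega
    · match ψs, h with
      | [ψ], h =>
        simp only [List.elim_cons, List.elim_nil, Option.some.injEq] at h
        subst h
        refine ⟨?_, ?_⟩
        · simpa [map_node] using
            SimpRule.single o o' (map val ψ) (l.map (map val)) (r.map (map val))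
        · simp [hμ]; omega
      | [], h => simp at h
      | _ :: _ :: _, h => simp at h
  | _ => simp [mergeStep, elim] at h

omit hμ in
theorem maxStep_some {φs ψs : List (NC P D)} (h : maxStep eq le φs = some ψs) :
    ∃ X α β γ l m r, φs = l ++ pos X α :: m ++ pos X β :: r ∧ ψs = l ++ pos X γ :: m ++ r ∧
      val γ = max (val α) (val β) ∧ (γ = α ∨ γ = β) := by
  obtain ⟨l, φ, r, y, rfl, h', rfl⟩ := List.search_eq_some h
  cases φ with
  | pos X α =>
    simp only [elim, Option.map_eq_some_iff] at h'
    obtain ⟨x, hs, rfl⟩ := h'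
    obtain ⟨m, ψ, r, y, rfl, h', rfl⟩ := List.search_eq_some hs
    cases ψ with
    | pos Y β =>
      cases hXY : eq X Y with
      | false => simp [hXY] at h'
      | true =>
        simp only [hXY, cond_true, Option.some.injEq] at h'
        obtain rfl := (heq _ _).1 hXY
        subst h'
        refine ⟨X, α, β, bif le α β then β else α, l, m, r, by simp, ?_, ?_, ?_⟩
        · rw [List.foldr_cons_eq_append', foldr_snd_cons]
          simp
        · cases hc : le α β with
          | true => simpa using (hle _ _).1 hc
          | false => simpa using le_of_not_ge fun h => by simp [(hle _ _).2 h] at hc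
        · cases le α β <;> simp
    | _ => simp at h'
  | _ => simp [elim] at h'

omit hle hμ in
theorem maxStep_ne_none {X : P} {α β : D} {l m r : List (NC P D)} :
    maxStep eq le (l ++ pos X α :: m ++ pos X β :: r) ≠ none := by
  intro h
  have h₁ := List.search_eq_none h l (pos X α) (m ++ pos X β :: r) (by simp)
  simp only [elim, Option.map_eq_none_iff] at h₁
  have h₂ := List.search_eq_none h₁ m (pos X β) r rfl
  simp [(heq X X).2 rfl] at h₂

theorem simpStep_spec (φ : NC P D) :
    (∀ ψ, simpStep eq le φ = some ψ → Simplify (map val φ) (map val ψ) ∧ μ ψ ≤ μ φ) ∧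
    (simpStep eq le φ = none → ∀ ψ, ¬ Simplify (map val φ) ψ) := by
  have lit : ∀ φ : NC P D, (∀ o φs, φ ≠ node o φs) → ∀ ψ, ¬ Simplify (map val φ) ψ := by
    intro φ hφ ψ h
    generalize hψ : map val φ = χ at h
    rcases h with ⟨⟨⟩⟩ | _ <;> (obtain ⟨φs, rfl, -⟩ := map_eq_node.1 hψ; exact absurd rfl (hφ _ _))
  induction φ using NC.induct with
  | const a b => exact ⟨by simp [simpStep, para], fun _ => lit _ (by simp)⟩
  | pos a b => exact ⟨by simp [simpStep, para], fun _ => lit _ (by simp)⟩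
  | neg a b => exact ⟨by simp [simpStep, para], fun _ => lit _ (by simp)⟩
  | node o φs ih =>
    rw [simpStep_node]
    refine ⟨fun ψ h => ?_, fun h ψ hs => ?_⟩
    · simp only [Option.or_eq_some_iff, Option.map_eq_some_iff] at h
      rcases h with ⟨χs, hs, rfl⟩ | ⟨-, h⟩
      · obtain ⟨l, φ, r, y, rfl, h, rfl⟩ := List.search_eq_some hs
        rw [List.foldr_cons_eq_append']
        simp only [Option.or_eq_some_iff, Option.map_eq_some_iff] at h
        rcases h with ⟨χ, h, rfl⟩ | ⟨-, h⟩
        · obtain ⟨h₁, h₂⟩ := (ih φ (by simp)).1 χ h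
          refine ⟨?_, ?_⟩
          · simpa [map_node] using Simplify.deep o (l.map (map val)) (r.map (map val)) h₁
          · simp [hμ]; omega
        · obtain ⟨h₁, h₂⟩ := mergeStep_some (val := val) hμ h
          exact ⟨.here h₁, h₂⟩
      · cases o with
        | or => simp [Conn.elim] at h
        | and =>
          simp only [Conn.elim] at h
          cases hb : φs.any isBot || clash eq le φs with
          | true =>
            simp only [hb, cond_true, Option.some.injEq] at h
            subst h
            refine ⟨?_, by simp [hμ]⟩
            rcases Bool.or_eq_true_iff.1 hb with hb | hb
            · obtain ⟨φ, hφ, hb⟩ := List.any_eq_true.1 hb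
              obtain rfl := isBot_iff.1 hb
              obtain ⟨l, r, rfl⟩ := List.append_of_mem hφ
              simpa [map_node] using
                Simplify.here (SimpRule.andBot (l.map (map val)) (r.map (map val)))
            · obtain ⟨X, α, β, h₁, h₂, h₃⟩ := (clash_iff heq hle).1 hb
              simpa [map_node] using Simplify.here (SimpRule.clash h₁ h₂ h₃)
          | false =>
            simp only [hb, cond_false, Option.map_eq_some_iff] at h
            obtain ⟨ψs, h, rfl⟩ := h
            obtain ⟨X, α, β, γ, l, m, r, rfl, rfl, hγ, hγ'⟩ := maxStep_some heq hle h
            refine ⟨?_, ?_⟩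
            · have := SimpRule.max X (val α) (val β) (l.map (map val)) (m.map (map val))
                (r.map (map val))
              rw [← hγ] at this
              simpa [map_node, map] using Simplify.here this
            · rcases hγ' with rfl | rfl
              · simp [hμ]
              · simp [hμ]
                omega
    · simp only [Option.or_eq_none_iff, Option.map_eq_none_iff] at h
      obtain ⟨h, h'⟩ := h
      have key := fun l φ r e => List.search_eq_none h l φ r e
      simp only [Option.or_eq_none_iff, Option.map_eq_none_iff] at key
      rw [map_node] at hs
      generalize hχ : node o (φs.map (map val)) = χ at hs
      cases hs with
      | @deep χ χ' _ l r hs =>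
        simp only [node.injEq] at hχ
        obtain ⟨rfl, hχ⟩ := hχ
        obtain ⟨l, s, rfl, rfl, e₂⟩ := List.map_eq_append_iff.1 hχ
        obtain ⟨φ, r, rfl, rfl, rfl⟩ := List.map_eq_cons_iff.1 e₂
        exact (ih φ (by simp)).2 (key l φ r rfl).1 _ hs
      | here hs =>
        have hor : ∀ o' ψs, node o' ψs ∈ φs.map (map val) → o ≠ o' ∧ ψs.length ≠ 1 := by
          intro o' ψs hm
          obtain ⟨φ, hφ, e⟩ := List.mem_map.1 hm
          obtain ⟨ψs, rfl, rfl⟩ := map_eq_node.1 e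
          obtain ⟨l, r, rfl⟩ := List.append_of_mem hφ
          have := (key l _ r rfl).2
          simp only [mergeStep, elim, Option.or_eq_none_iff] at this
          refine ⟨fun e => ?_, fun e => ?_⟩
          · simp [Conn.same_iff.2 e] at this
          · obtain ⟨ψ, rfl⟩ := List.length_eq_one_iff.1 (by simpa using e)
            simp at this
        have hand : o = .and → φs.any isBot = false ∧ clash eq le φs = false ∧
            maxStep eq le φs = none := by
          rintro rfl
          simp only [Conn.elim] at h'
          cases h₁ : φs.any isBot <;> cases h₂ : clash eq le φs <;> simp_all
        cases hs with
        | orBot l r =>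
          simp only [node.injEq] at hχ
          obtain ⟨rfl, hχ⟩ := hχ
          exact (hor .or [] (by simp [hχ])).1 rfl
        | andBot l r =>
          simp only [node.injEq] at hχ
          obtain ⟨rfl, hχ⟩ := hχ
          obtain ⟨φ, hφ, e⟩ := List.mem_map.1 (show node Conn.or [] ∈ φs.map (map val) by simp [hχ])
          obtain ⟨ψs, rfl, e⟩ := map_eq_node.1 e
          have := List.any_eq_false.1 (hand rfl).1 _ hφ
          simp_all [isBot_iff]
        | single o₂ o₁ φ l r =>
          simp only [node.injEq] at hχ
          obtain ⟨rfl, hχ⟩ := hχ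
          exact (hor o₁ [φ] (by simp [hχ])).2 rfl
        | merge o' ψs l r =>
          simp only [node.injEq] at hχ
          obtain ⟨rfl, hχ⟩ := hχ
          exact (hor o ψs (by simp [hχ])).1 rfl
        | clash h₁ h₂ h₃ =>
          simp only [node.injEq] at hχ
          obtain ⟨rfl, rfl⟩ := hχ
          have := (clash_iff heq hle).2 ⟨_, _, _, h₁, h₂, h₃⟩
          simp [(hand rfl).2.1] at this
        | max X α β l m r =>
          simp only [node.injEq] at hχ
          obtain ⟨rfl, hχ⟩ := hχ
          obtain ⟨s, t, rfl, e₁, e₂⟩ := List.map_eq_append_iff.1 hχ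
          obtain ⟨φ, r, rfl, e₃, rfl⟩ := List.map_eq_cons_iff.1 e₂
          obtain ⟨l, t, rfl, rfl, e₄⟩ := List.map_eq_append_iff.1 e₁
          obtain ⟨ψ, m, rfl, e₅, rfl⟩ := List.map_eq_cons_iff.1 e₄
          obtain ⟨α, rfl, rfl⟩ := map_eq_pos.1 e₅
          obtain ⟨β, rfl, rfl⟩ := map_eq_pos.1 e₃
          exact maxStep_ne_none heq (hand rfl).2.2

theorem rurStep_spec (φ : NC P D) :
    (∀ ψ, rurStep eq le φ = some ψ → RUR (map val φ) (map val ψ) ∧ μ ψ ≤ μ φ) ∧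
    (rurStep eq le φ = none → ∀ ψ, ¬ RUR (map val φ) ψ) := by
  match φ with
  | const _ _ => exact ⟨by simp [rurStep, elim], fun _ ψ h => by simp only [map] at h; cases h⟩
  | pos _ _ => exact ⟨by simp [rurStep, elim], fun _ ψ h => by simp only [map] at h; cases h⟩
  | neg _ _ => exact ⟨by simp [rurStep, elim], fun _ ψ h => by simp only [map] at h; cases h⟩
  | node .or φs =>
    exact ⟨by simp [rurStep, elim, Conn.elim], fun _ ψ h => by simp only [map] at h; cases h⟩
  | node .and φs =>
    simp only [rurStep, elim, Conn.elim]
    refine ⟨fun ψ h₀ => ?_, fun h ψ hr => ?_⟩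
    · obtain ⟨χs, hs, rfl⟩ := Option.map_eq_some_iff.1 h₀
      obtain ⟨l, φ, r, y, rfl, h, rfl⟩ := List.search_eq_some hs
      obtain ⟨χ, hs', rfl⟩ := Option.map_eq_some_iff.1 h
      obtain ⟨l', u, r', y, e, h', rfl⟩ := List.search_eq_some hs'
      rw [foldr_const, List.foldr_cons_eq_append']
      cases u with
      | pos X α =>
        obtain ⟨h₁, h₂⟩ := (cutStep_spec heq hle hμ X α φ).2.1 y h'
        have hm : pos X α ∈ l ++ φ :: r := by simp [e]
        refine ⟨?_, by simp [hμ]; omega⟩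
        have hm' : pos X (val α) ∈ l.map (map val) ++ r.map (map val) := by
          rw [← List.map_append]
          refine List.mem_map.2 ⟨pos X α, ?_, by simp [map]⟩
          rcases List.mem_append.1 hm with h | h
          · simp [h]
          · rcases List.mem_cons.1 h with rfl | h
            · simp only [map] at h₁
              cases h₁
            · simp [h]
        simpa [map_node] using RUR.mk _ _ hm' h₁
      | _ => simp at h'
    · rw [Option.map_eq_none_iff] at h
      rw [map_node] at hr
      generalize hχ : node Conn.and (φs.map (map val)) = χ at hr
      obtain @⟨X, α, φ, φ', l, r, hu, hcut⟩ := hr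
      simp only [node.injEq, true_and] at hχ
      obtain ⟨l, s, rfl, rfl, e₂⟩ := List.map_eq_append_iff.1 hχ
      obtain ⟨φ, r, rfl, rfl, rfl⟩ := List.map_eq_cons_iff.1 e₂
      have h₁ := List.search_eq_none h l φ r rfl
      rw [Option.map_eq_none_iff] at h₁
      rw [← List.map_append] at hu
      obtain ⟨u, hm, e⟩ := List.mem_map.1 hu
      obtain ⟨α, rfl, rfl⟩ := map_eq_pos.1 e
      obtain ⟨l', r', e'⟩ := List.append_of_mem (show pos X α ∈ l ++ φ :: r by
        rcases List.mem_append.1 hm with h | h <;> simp [h])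
      exact (cutStep_spec heq hle hμ X α φ).2.2 (List.search_eq_none h₁ l' _ r' e') _ hcut

theorem next_spec (φ : NC P D) :
    (∀ ψ, next eq le φ = some ψ → Infer (map val φ) (map val ψ) ∧ μ ψ ≤ μ φ) ∧
    (next eq le φ = none → Irreducible (map val φ)) := by
  have h₁ := simpStep_spec heq hle hμ φ
  have h₂ := rurStep_spec heq hle hμ φ
  simp only [next, Option.or_eq_some_iff, Option.or_eq_none_iff]
  refine ⟨?_, fun h ψ => not_or.2 ⟨h₂.2 h.2 ψ, h₁.2 h.1 ψ⟩⟩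
  rintro ψ (h | ⟨-, h⟩)
  · exact (h₁.1 ψ h).imp_left .inr
  · exact (h₂.1 ψ h).imp_left .inl

end Correctness

end NC

end Search

/-! ### Deciding satisfiability in polynomial time -/

section Decision

open NC (Tok)

namespace NC

section Definitions

variable {P D : Type} (eq : P → P → Bool) (le : D → D → Bool)

/-- Replace the regular constants by `{∧}` and `(∨)`. -/
def rmConst : NC P D → NC P D :=
  para (fun φ => φ.elim (fun α β => bif le β α then node .and [] else node .or []) pos neg node)
    fun o l => node o (l.map fun x => x.2)

/-- Make an inference if possible. -/
def step (φ : NC P D) : NC P D := (next eq le φ).getD φ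

end Definitions

section Correctness

variable {P D : Type} {T : Type*} {eq : P → P → Bool} {le : D → D → Bool}
  {val : D → T}

theorem rmConst_node (o : Conn) (φs : List (NC P D)) :
    rmConst le (node o φs) = node o (φs.map (rmConst le)) := by
  simp [rmConst, para, Function.comp_def]

theorem hasPos_map {φ : NC P D} : HasPos (map val φ) ↔ HasPos φ := by
  induction φ using NC.induct with
  | node o φs ih => simp only [map_node, hasPos_node, List.mem_map]; grind
  | _ => simp [map]

theorem isHNC_map {φ : NC P D} (h : IsHNC φ) : IsHNC (map val φ) := by
  induction φ using NC.induct with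
  | node o φs ih =>
    cases o
    · simp only [map_node, isHNC_and, List.mem_map] at *; grind
    · simp only [map_node, isHNC_or, List.mem_map, List.pairwise_map, hasPos_map] at *; grind
  | _ => simp [map]

theorem rmConst_hasPos {φ : NC P D} (h : HasPos (rmConst le φ)) : HasPos φ := by
  induction φ using NC.induct with
  | const α β => cases hc : le β α <;> simp [rmConst, para, elim, hc] at h
  | pos X α => simp
  | neg X α => simp [rmConst, para, elim] at h
  | node o φs ih => simp only [rmConst_node, hasPos_node, List.mem_map] at *; grind

theorem rmConst_isHNC {φ : NC P D} (h : IsHNC φ) : IsHNC (rmConst le φ) := by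
  induction φ using NC.induct with
  | const α β => cases hc : le β α <;> simp [rmConst, para, elim, hc]
  | pos X α => simp [rmConst, para, elim]
  | neg X α => simp [rmConst, para, elim]
  | node o φs ih =>
    cases o
    · simp only [rmConst_node, isHNC_and, List.mem_map] at *; grind
    · simp only [rmConst_node, isHNC_or, List.mem_map, List.pairwise_map] at *
      exact ⟨h.1.imp fun h hc => h ⟨rmConst_hasPos hc.1, rmConst_hasPos hc.2⟩, by grind⟩

theorem rmConst_constFree (φ : NC P D) : ConstFree (map val (rmConst le φ)) := by
  induction φ using NC.induct with
  | const α β => cases hc : le β α <;> simp [rmConst, para, elim, hc, map]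
  | pos X α => simp [rmConst, para, elim, map]
  | neg X α => simp [rmConst, para, elim, map]
  | node o φs ih => simp only [rmConst_node, map_node, constFree_node, List.mem_map] at *; grind

theorem size_map (φ : NC P D) : size (map val φ) = size φ := by
  induction φ using NC.induct with
  | node o φs ih =>
    simp only [map_node, size, List.map_map]
    rw [List.map_congr_left fun φ h => by exact ih φ h]
  | _ => simp [map, size]

variable [LinearOrder T] (hle : ∀ α β, le α β = true ↔ val α ≤ val β)

include hle

theorem rmConst_holds (I : P → T) (φ : NC P D) :
    Holds I (map val (rmConst le φ)) ↔ Holds I (map val φ) := by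
  induction φ using NC.induct with
  | const α β =>
    have := hle β α
    simp only [rmConst, para, elim, map, Holds, ← this]
    cases le β α <;> simp [map]
  | pos X α => simp [rmConst, para, elim, map]
  | neg X α => simp [rmConst, para, elim, map]
  | node o φs ih =>
    cases o
    · simp only [rmConst_node, map_node, holds_and, List.mem_map] at *; grind
    · simp only [rmConst_node, map_node, holds_or, List.mem_map] at *; grind

variable (heq : ∀ X Y, eq X Y = true ↔ X = Y)

include heq

theorem derives_step (φ : NC P D) (k : ℕ) :
    Derives (map val φ) (map val ((step eq le)^[k] φ)) := by
  induction k with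
  | zero => exact .refl
  | succ k ih =>
    rw [Function.iterate_succ_apply', step]
    cases h : next eq le ((step eq le)^[k] φ) with
    | none => exact ih
    | some ψ => exact ih.tail ((next_spec heq hle (μ := size) (w := 1) (e := 0) (by simp [size])
        _).1 ψ h).1

/-- As long as inferences are possible, each one makes the formula smaller. -/
theorem next_iterate_step (φ : NC P D) (k : ℕ) :
    k + size ((step eq le)^[k] φ) ≤ size φ ∨ next eq le ((step eq le)^[k] φ) = none := by
  induction k with
  | zero => simp
  | succ k ih =>
    rw [Function.iterate_succ_apply', step]
    cases h : next eq le ((step eq le)^[k] φ) with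
    | none => exact .inr h
    | some ψ =>
      left
      have h₁ :=
        ((next_spec heq hle (μ := size) (w := 1) (e := 0) (by simp [size]) _).1 ψ h).1.size_lt
      rw [size_map, size_map] at h₁
      simp only [h, reduceCtorEq, or_false, Option.getD_some] at *
      omega

theorem irreducible_iterate_step (φ : NC P D) {k : ℕ} (hk : size φ ≤ k) :
    Irreducible (map val ((step eq le)^[k] φ)) := by
  refine (next_spec heq hle (μ := size) (w := 1) (e := 0) (by simp [size]) _).2
    ((next_iterate_step hle heq φ k).resolve_left ?_)
  have := size_pos ((step eq le)^[k] φ)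
  omega

/-- After the removal of constants, all possible inferences tell whether a formula is satisfiable.
The calculus is complete for conjunctions, so the formula is made a conjunction first. -/
theorem sat_iff_iterate_step [Nonempty T] {φ : NC P D} (hφ : IsHNC φ) {k : ℕ}
    (hk : size (node .and [rmConst le φ]) ≤ k) :
    (!isBot ((step eq le)^[k] (node .and [rmConst le φ]))) = true ↔ Sat (map val φ) := by
  have h := (derives_step hle heq (node .and [rmConst le φ]) k)
  have h' := irreducible_iterate_step hle heq (node .and [rmConst le φ]) hk
  have h₁ : Sat (map val φ) ↔ Sat (map val (node .and [rmConst le φ])) :=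
    exists_congr fun I => by simp [map_node, rmConst_holds hle]
  rw [map_node] at h h₁
  have h₂ := h.not_sat_iff (by simpa using isHNC_map (rmConst_isHNC hφ))
    (by simpa using rmConst_constFree φ) h'
  rw [h₁, ← not_iff_not, h₂, Bool.not_eq_true, Bool.not_eq_false', isBot_iff, map_eq_node]
  simp

end Correctness

end NC

section

variable {A B : Type} {O : Oracle (Tok A B)} {P D : Type}
variable [TreeRep (Tok A B) P] [TreeRep (Tok A B) D]
variable {α : Type} [TreeRep (Tok A B) α]

open NC

/-- A polynomial-time function of two arguments, in a form for proofs by composition. -/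
theorem PTime.uncurry {β γ δ : Type} [TreeRep (Tok A B) β] [TreeRep (Tok A B) γ]
    [TreeRep (Tok A B) δ] {f : β → γ → δ} (hf : PTime O fun x : β × γ => f x.1 x.2) {g : α → β}
    {h : α → γ} (hg : PTime O g) (hh : PTime O h) : PTime O fun a => f (g a) (h a) :=
  hf.comp (hg.prodMk hh)

@[fun_prop]
theorem PTime.same {o o' : α → Conn} (ho : PTime O o) (ho' : PTime O o') :
    PTime O fun a => (o a).same (o' a) := by
  unfold Conn.same
  fun_prop

@[fun_prop]
theorem PTime.isBot {φ : α → NC P D} (hφ : PTime O φ) : PTime O fun a => isBot (φ a) := by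
  unfold NC.isBot
  fun_prop

@[fun_prop]
theorem PTime.mergeStep {o : α → Conn} {φ : α → NC P D} {l : α → List (NC P D)} (ho : PTime O o)
    (hφ : PTime O φ) (hl : PTime O l) : PTime O fun a => mergeStep (o a) (φ a) (l a) := by
  unfold NC.mergeStep
  fun_prop

theorem sz_option_le {Γ β : Type} [TreeRep Γ β] {o : Option β} {N : ℕ}
    (h : ∀ b, o = some b → sz Γ b ≤ N) : sz Γ o ≤ N + 2 := by
  cases o with
  | none => simp
  | some b => have := h b rfl; simp; omega

theorem sz_list {Γ β : Type} [TreeRep Γ β] (l : List β) :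
    sz Γ l = 1 + (l.map fun b => 1 + sz Γ b).sum := by
  induction l with
  | nil => rfl
  | cons b l ih => rw [sz_cons, ih, List.map_cons, List.sum_cons]; omega

theorem NC.sz_node_sum (o : Conn) (φs : List (NC P D)) :
    sz (Tok A B) (node o φs) = 3 + (φs.map fun φ => 1 + sz (Tok A B) φ).sum := by
  rw [sz_node, sz_list]
  omega

theorem NC.size_le_sz (φ : NC P D) : size φ ≤ sz (Tok A B) φ := by
  induction φ using NC.induct with
  | node o φs ih =>
    rw [sz_node_sum, size]
    have := List.sum_le_sum fun φ h => (ih φ h).trans (Nat.le_add_left _ 1)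
    omega
  | _ => rw [size]; exact sz_pos _

variable {T : Type*} [LinearOrder T] {eq : P → P → Bool} {le : D → D → Bool} {val : D → T}
  (heq : ∀ X Y, eq X Y = true ↔ X = Y) (hle : ∀ α β, le α β = true ↔ val α ≤ val β)
  (he : PTime O fun x : P × P => eq x.1 x.2) (hl : PTime O fun x : D × D => le x.1 x.2)

include he hl

theorem PTime.negBelow {X : α → P} {v : α → D} {φ : α → NC P D} (hX : PTime O X) (hv : PTime O v)
    (hφ : PTime O φ) : PTime O fun a => negBelow eq le (X a) (v a) (φ a) := by
  have h₁ := fun {α : Type} [TreeRep (Tok A B) α] {f g : α → P} => he.uncurry (g := f) (h := g)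
  have h₂ := fun {α : Type} [TreeRep (Tok A B) α] {f g : α → D} => hl.uncurry (g := f) (h := g)
  unfold NC.negBelow
  fun_prop

theorem PTime.clash {φs : α → List (NC P D)} (hφ : PTime O φs) :
    PTime O fun a => clash eq le (φs a) := by
  have h₁ := fun {α : Type} [TreeRep (Tok A B) α] {X : α → P} {v φ} =>
    PTime.negBelow he hl (X := X) (v := v) (φ := φ)
  unfold NC.clash
  fun_prop

theorem PTime.maxStep {φs : α → List (NC P D)} (hφ : PTime O φs) :
    PTime O fun a => maxStep eq le (φs a) := by
  have h₁ := fun {α : Type} [TreeRep (Tok A B) α] {f g : α → P} => he.uncurry (g := f) (h := g)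
  have h₂ := fun {α : Type} [TreeRep (Tok A B) α] {f g : α → D} => hl.uncurry (g := f) (h := g)
  unfold NC.maxStep
  refine .search hφ (.ncElim (by fun_prop) (by fun_prop) (.optMap (.search (by fun_prop)
    (by fun_prop) (by fun_prop) ?_) (by fun_prop)) (by fun_prop) (by fun_prop)) (by fun_prop) ?_
  · rintro a d ⟨x, y⟩
    simp
    omega
  · intro a d x
    simp
    omega

include heq hle

theorem PTime.cutStep {X : α → P} {v : α → D} {φ : α → NC P D} (hX : PTime O X) (hv : PTime O v)
    (hφ : PTime O φ) : PTime O fun a => cutStep eq le (X a) (v a) (φ a) := by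
  have h₁ := fun {α : Type} [TreeRep (Tok A B) α] {X : α → P} {v φ} =>
    PTime.negBelow he hl (X := X) (v := v) (φ := φ)
  unfold NC.cutStep
  refine .para hφ (by fun_prop) (.prodMk (by fun_prop) (.optMap (.search (by fun_prop)
    (by fun_prop) (by fun_prop) ?_) (by fun_prop))) ⟨.X + 6, fun a φ => ?_⟩
  · rintro a ⟨d, y⟩ x
    simp
    omega
  · have h₂ := sz_bool_le (Γ := Tok A B) (NC.cutStep eq le (X a) (v a) φ).1
    have h₃ := sz_option_le fun ψ h =>
      ((cutStep_spec heq hle (sz_node_sum (A := A) (B := B)) (X a) (v a) φ).2.1 ψ h).2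
    have h₄ : sz (Tok A B) (NC.cutStep eq le (X a) (v a) φ) =
        sz (Tok A B) (NC.cutStep eq le (X a) (v a) φ).1 +
          sz (Tok A B) (NC.cutStep eq le (X a) (v a) φ).2 + 1 := sz_prod _ _
    simp only [NC.cutStep, Polynomial.eval_add, Polynomial.eval_X, Polynomial.eval_ofNat] at *
    omega

theorem PTime.simpStep {φ : α → NC P D} (hφ : PTime O φ) :
    PTime O fun a => simpStep eq le (φ a) := by
  have h₁ := fun {α : Type} [TreeRep (Tok A B) α] {l : α → List (NC P D)} =>
    PTime.clash he hl (φs := l)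
  have h₂ := fun {α : Type} [TreeRep (Tok A B) α] {l : α → List (NC P D)} =>
    PTime.maxStep he hl (φs := l)
  unfold NC.simpStep
  refine .para hφ (by fun_prop) (.orElse (.optMap (.search (by fun_prop)
    (by fun_prop) (by fun_prop) ?_) (by fun_prop)) (by fun_prop)) ⟨.X + 2, fun a φ => ?_⟩
  · rintro a ⟨d, y⟩ x
    simp
    omega
  · have h₃ := sz_option_le fun ψ h =>
      ((simpStep_spec heq hle (sz_node_sum (A := A) (B := B)) φ).1 ψ h).2
    simp only [NC.simpStep, Polynomial.eval_add, Polynomial.eval_X, Polynomial.eval_ofNat] at *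
    omega

theorem PTime.next {φ : α → NC P D} (hφ : PTime O φ) : PTime O fun a => next eq le (φ a) := by
  have h₁ := fun {α : Type} [TreeRep (Tok A B) α] {X : α → P} {v φ} =>
    PTime.cutStep heq hle he hl (X := X) (v := v) (φ := φ)
  refine (PTime.simpStep heq hle he hl hφ).orElse ?_
  unfold NC.rurStep
  refine .ncElim hφ (by fun_prop) (by fun_prop) (by fun_prop) (.connElim (by fun_prop)
    (.optMap (.search (by fun_prop) (.optMap (.search (by fun_prop) (by fun_prop) (by fun_prop) ?_)
    (by fun_prop)) (by fun_prop) ?_) (by fun_prop)) (by fun_prop))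
  · intro a d x
    omega
  · intro a d x
    simp
    omega

omit heq hle he in
theorem PTime.rmConst {φ : α → NC P D} (hφ : PTime O φ) : PTime O fun a => rmConst le (φ a) := by
  have h₁ := fun {α : Type} [TreeRep (Tok A B) α] {f g : α → D} => hl.uncurry (g := f) (h := g)
  unfold NC.rmConst
  refine .para hφ (by fun_prop) (by fun_prop) ⟨.X, fun a φ => ?_⟩
  change sz _ (NC.rmConst le φ) ≤ _
  rw [Polynomial.eval_X]
  have : sz (Tok A B) (NC.rmConst le φ) ≤ sz (Tok A B) φ := by
    induction φ using NC.induct with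
    | const α β =>
      have h₁ := sz_pos (Γ := Tok A B) α
      have h₂ := sz_pos (Γ := Tok A B) β
      cases h : le β α <;> simp [NC.rmConst, NC.para, NC.elim, h, sz_const, sz_node]
    | pos X α => simp [NC.rmConst, NC.para, NC.elim]
    | neg X α => simp [NC.rmConst, NC.para, NC.elim]
    | node o φs ih =>
      rw [rmConst_node, sz_node_sum, sz_node_sum, List.map_map]
      exact Nat.add_le_add_left (List.sum_le_sum fun φ h => Nat.add_le_add_left (ih φ h) 1) 3
  omega

/-- The decision procedure takes polynomial time. -/
theorem PTime.decideSat {φ : α → NC P D} (hφ : PTime O φ) : PTime O fun a =>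
    !NC.isBot ((NC.step eq le)^[sz (Tok A B) (node .and [NC.rmConst le (φ a)])]
      (node .and [NC.rmConst le (φ a)])) := by
  have h₁ : PTime O fun φ : NC P D => (NC.step eq le)^[sz (Tok A B) φ] φ := by
    have h := fun {α : Type} [TreeRep (Tok A B) α] {φ : α → NC P D} =>
      PTime.next heq hle he hl (φ := φ)
    refine .iterate (by fun_prop) (by unfold NC.step; fun_prop) ⟨.X, fun φ k _ => ?_⟩
    rw [Polynomial.eval_X]
    clear * - heq hle
    induction k with
    | zero => rfl
    | succ k ih =>
      rw [Function.iterate_succ_apply']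
      refine le_trans ?_ ih
      generalize (NC.step eq le)^[k] φ = ψ
      rw [NC.step]
      cases h : NC.next eq le ψ with
      | none => rfl
      | some χ => exact ((next_spec heq hle (sz_node_sum (A := A) (B := B)) ψ).1 χ h).2
  have h₂ := PTime.rmConst hl hφ
  exact (h₁.comp (g := fun φ : NC P D => _) (f := fun a => node .and [NC.rmConst le (φ a)])
    (by fun_prop)).isBot.not

end

end Decision

/-! ### Reading and writing formulas -/

section Strings

open NC (Tok)

variable {A B : Type} {O : Oracle (Tok A B)} {α β : Type} [TreeRep (Tok A B) α]
  [TreeRep (Tok A B) β]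

instance : TreeRep (Tok A B) (Tok A B) := ⟨fun c => .leaf (some c)⟩

instance [Finite A] [Finite B] : Finite (Tok A B) :=
  .of_injective (fun c => (match c with
    | .const => .inl 0 | .pos => .inl 1 | .neg => .inl 2 | .sep => .inl 3 | .fin => .inl 4
    | .opn o => .inr (.inl o) | .cls o => .inr (.inr (.inl o)) | .prop a => .inr
        (.inr (.inr (.inl a)))
    | .val b => .inr (.inr (.inr (.inr b))) : Fin 5 ⊕ Conn ⊕ Conn ⊕ A ⊕ B)) fun a b => by
    cases a <;> cases b <;> simp

theorem sz_word (l : List (Tok A B)) : sz (Tok A B) l = 2 * l.length + 1 := by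
  induction l with
  | nil => rfl
  | cons c l ih => rw [sz_cons, ih, show sz (Tok A B) c = 1 from rfl, List.length_cons]; omega

namespace PTime

theorem tokElim [Finite A] [Finite B] {t : α → Tok A B} {f : Tok A B → α → β} (ht : PTime O t)
    (hf : ∀ c, PTime O (f c)) : PTime O fun a => f (t a) a := by
  have h : PTime O fun a => (⟨t a, a⟩ : Σ _ : Tok A B, α) :=
    (ht.prodMk id).congr_enc (fun a => a) (fun _ => rfl) fun _ => rfl
  exact (finCase (O := O) (fun c : Tok A B => c) (fun _ _ h => h) (fun _ => rfl) hf).comp h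

@[fun_prop]
theorem opn {o : α → Conn} (ho : PTime O o) : PTime O fun a => (Tok.opn (o a) : Tok A B) :=
  (cast (f := fun o : Conn => (Tok.opn o : Tok A B)) fun _ => rfl).comp ho

@[fun_prop]
theorem cls {o : α → Conn} (ho : PTime O o) : PTime O fun a => (Tok.cls (o a) : Tok A B) :=
  (ho.connElim (const (Tok.cls .and)) (const (Tok.cls .or))).of_eq fun a => by cases o a <;> rfl

open Classical in
theorem tokEq [Finite A] [Finite B] {s t : α → Tok A B} (hs : PTime O s) (ht : PTime O t) :
    PTime O fun a => decide (s a = t a) :=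
  hs.tokElim (f := fun c a => decide (c = t a)) fun c =>
    ht.tokElim (f := fun d _ => decide (c = d)) fun _ => const _

end PTime

open Classical in
/-- Equality of words, by a comparison letter by letter. The accumulator is the part of `l'` that is
yet to be compared, or `none` after a difference. -/
noncomputable def eqWord (l l' : List (Tok A B)) : Bool :=
  (l.foldl (fun o c => o.elim none fun r => r.elim none fun d t =>
    bif decide (c = d) then some t else none) (some l')).elim false
    fun r => r.elim true fun _ _ => false

open Classical in
theorem eqWord_iff {l l' : List (Tok A B)} : eqWord l l' = true ↔ l = l' := by
  induction l generalizing l' with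
  | nil => cases l' <;> simp [eqWord]
  | cons c l ih =>
    have hnone : ∀ l : List (Tok A B), l.foldl (fun o c => o.elim none fun r =>
        r.elim none fun d t => bif decide (c = d) then some t else none)
        (none : Option (List (Tok A B))) = none := by
      intro l
      induction l with
      | nil => rfl
      | cons c l ih => exact ih
    cases l' with
    | nil => simp [eqWord, hnone]
    | cons d t =>
      by_cases h : c = d
      · subst h
        simpa [eqWord] using ih (l' := t)
      · simp [eqWord, h, hnone]

open Classical in
@[fun_prop]
theorem PTime.eqWord [Finite A] [Finite B] {l l' : α → List (Tok A B)} (hl : PTime O l)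
    (hl' : PTime O l') : PTime O fun a => eqWord (l a) (l' a) := by
  have h := fun {α : Type} [TreeRep (Tok A B) α] {s t : α → Tok A B} => PTime.tokEq (O := O)
      (s := s) (t := t)
  obtain ⟨q, hq⟩ := hl'.sz_le
  unfold _root_.eqWord
  refine (PTime.foldl (by fun_prop) hl (by fun_prop) ⟨q + 2, fun a t _ => ?_⟩).optElim
    (by fun_prop) (by fun_prop)
  have key : ∀ (t : List (Tok A B)) (o : Option (List (Tok A B))),
      sz (Tok A B) (t.foldl (fun o c => o.elim none fun r => r.elim none fun d t =>
        bif decide (c = d) then Option.some t else none) o) ≤ sz (Tok A B) o := by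
    intro t
    induction t with
    | nil => exact fun o => le_rfl
    | cons c t ih =>
      intro o
      refine (ih _).trans ?_
      match o with
      | none => exact le_rfl
      | .some [] => simp
      | .some (d :: r) => by_cases h : c = d <;> simp [h]; omega
  have := key t (.some (l' a))
  have := hq a
  simp at *
  omega

namespace NC

variable {P D : Type} {eP : P → List A} {eD : D → List B}

/-- Add an element to the list on the top of a stack. -/
def pushTop {δ : Type} (d : δ) (st : List (List δ)) : List (List δ) :=
  st.elim [] fun l st => (d :: l) :: st

/-- The state of the parser, which reads a string from right to left, so that words and lists of
arguments are built up from their ends: the names that have been read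
since the last symbol `fin`, and for each open connective the arguments that have been read. In
parsed formulas the names are words. -/
abbrev Parser (A B : Type) : Type := List (Tok A B) × List (Tok A B) ×
  List (List (NC (List (Tok A B)) (List (Tok A B))))

/-- One step of the parser. -/
def parseStep (c : Tok A B) (s : Parser A B) : Parser A B :=
  match c with
  | .const => ([], [], pushTop (const s.1 s.2.1) s.2.2)
  | .pos => ([], [], pushTop (pos s.1 s.2.1) s.2.2)
  | .neg => ([], [], pushTop (neg s.1 s.2.1) s.2.2)
  | .sep => ([], s.1, s.2.2)
  | .fin => ([], [], s.2.2)
  | .opn o => (s.1, s.2.1, s.2.2.elim [] fun l st => pushTop (node o l) st)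
  | .cls _ => (s.1, s.2.1, [] :: s.2.2)
  | .prop a => (.prop a :: s.1, s.2)
  | .val b => (.val b :: s.1, s.2)

/-- The formula represented by a string. -/
def parse (l : List (Tok A B)) : NC (List (Tok A B)) (List (Tok A B)) :=
  (l.foldr parseStep ([], [], [[]])).2.2.elim (node .and []) fun l _ =>
    l.elim (node .and []) fun φ _ => φ

/-- Replace propositions and truth-values by the words that name them. -/
def raw (eP : P → List A) (eD : D → List B) : NC P D → NC (List (Tok A B)) (List (Tok A B))
  | const α β => const ((eD α).map .val) ((eD β).map .val)
  | pos X α => pos ((eP X).map .prop) ((eD α).map .val)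
  | neg X α => neg ((eP X).map .prop) ((eD α).map .val)
  | node o φs => node o (φs.map (raw eP eD))

theorem foldr_parseStep_prop (l : List A) (s : Parser A B) :
    (l.map Tok.prop).foldr parseStep s = (l.map Tok.prop ++ s.1, s.2) := by
  induction l with
  | nil => rfl
  | cons a l ih => rw [List.map_cons, List.foldr_cons, ih]; rfl

theorem foldr_parseStep_val (l : List B) (s : Parser A B) :
    (l.map Tok.val).foldr parseStep s = (l.map Tok.val ++ s.1, s.2) := by
  induction l with
  | nil => rfl
  | cons a l ih => rw [List.map_cons, List.foldr_cons, ih]; rfl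

/-- To read the string for a formula adds the formula to the arguments of the connective around it.
-/
theorem foldr_parseStep (φ : NC P D) (s : Parser A B) :
    ((encodeWith eP eD φ).foldr parseStep s).2.2 = pushTop (raw eP eD φ) s.2.2 := by
  induction φ using NC.induct generalizing s with
  | const α β => simp [encodeWith, foldr_parseStep_val, parseStep, raw]
  | pos X α => simp [encodeWith, foldr_parseStep_val, foldr_parseStep_prop, parseStep, raw]
  | neg X α => simp [encodeWith, foldr_parseStep_val, foldr_parseStep_prop, parseStep, raw]
  | node o φs ih =>
    have key : ∀ (l : List (NC P D)) (s : Parser A B) (st : _),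
        (∀ φ ∈ l, φ ∈ φs) → s.2.2 = [] :: st →
        ((l.map (encodeWith eP eD)).flatten.foldr parseStep s).2.2 = l.map (raw eP eD) :: st := by
      intro l
      induction l with
      | nil => exact fun s st _ h => h
      | cons φ l ihl =>
        intro s st hl h
        rw [List.map_cons, List.flatten_cons, List.foldr_append, ih φ (hl φ (by simp)),
          ihl s st (fun φ h => hl φ (by simp [h])) h]
        rfl
    have h := key φs (s.1, s.2.1, [] :: s.2.2) s.2.2 (fun _ h => h) rfl
    simp only [encodeWith, List.foldr_append, List.cons_append, List.foldr_cons, List.foldr_nil,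
      parseStep, raw]
    rw [h]
    rfl

theorem parse_encodeWith (φ : NC P D) : parse (encodeWith eP eD φ) = raw eP eD φ := by
  simp [parse, foldr_parseStep, pushTop]

theorem sz_parseStep (c : Tok A B) (s : Parser A B) :
    sz (Tok A B) (parseStep c s) ≤ sz (Tok A B) s + 10 := by
  have h₁ : ∀ (φ : NC (List (Tok A B)) (List (Tok A B))) st,
      sz (Tok A B) (pushTop φ st) ≤ sz (Tok A B) st + sz (Tok A B) φ + 1 := by
    rintro φ (_ | ⟨l, st⟩) <;> simp [pushTop]; omega
  have h₂ : ∀ c : Tok A B, sz (Tok A B) c = 1 := fun c => rfl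
  obtain ⟨w₁, w₂, st⟩ := s
  cases c with
  | const => have := h₁ (const w₁ w₂) st; rw [sz_const] at this; simp [parseStep]; omega
  | pos => have := h₁ (pos w₁ w₂) st; rw [(sz_lit _ _).1] at this; simp [parseStep]; omega
  | neg => have := h₁ (neg w₁ w₂) st; rw [(sz_lit _ _).2] at this; simp [parseStep]; omega
  | sep => simp [parseStep]; omega
  | fin => simp [parseStep]; omega
  | opn o =>
    cases st with
    | nil => simp [parseStep]
    | cons l st => have := h₁ (node o l) st; rw [sz_node] at this; simp [parseStep]; omega
  | cls o => simp [parseStep]; omega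
  | prop a => simp [parseStep, h₂]; omega
  | val b => simp [parseStep, h₂]; omega

end NC

open NC

@[fun_prop]
theorem PTime.pushTop {d : α → β} {l : α → List (List β)} (hd : PTime O d) (hl : PTime O l) :
    PTime O fun a => pushTop (d a) (l a) := by
  unfold NC.pushTop
  fun_prop

theorem PTime.parse [Finite A] [Finite B] {l : α → List (Tok A B)} (hl : PTime O l) :
    PTime O fun a => parse (l a) := by
  have hstep : ∀ c : Tok A B, PTime O (parseStep c) := by
    intro c
    change PTime O fun s => NC.parseStep c s
    cases c <;> simp only [NC.parseStep] <;> fun_prop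
  have h := fun {α : Type} [TreeRep (Tok A B) α] {c : α → Tok A B} {s : α → Parser A B}
    (hc : PTime O c) (hs : PTime O s) =>
    hc.tokElim (f := fun c a => parseStep c (s a)) fun c => (hstep c).comp hs
  obtain ⟨q, hq⟩ := hl.sz_le
  unfold NC.parse
  refine .listElim (.snd_comp (.snd_comp (.foldr (by fun_prop) hl (by fun_prop)
    ⟨10 * q + 10, fun a t ht => ?_⟩))) (by fun_prop) (by fun_prop)
  have key : ∀ t : List (Tok A B),
      sz (Tok A B) (t.foldr parseStep ([], [], [[]])) ≤ 10 * t.length + 10 := by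
    intro t
    induction t with
    | nil => simp
    | cons c t ih =>
      have := sz_parseStep c (t.foldr parseStep ([], [], [[]]))
      simp only [List.foldr_cons, List.length_cons]
      omega
  have h₁ := key t
  have h₂ := ht.length_le
  have h₃ := length_lt_sz (Γ := Tok A B) (l a)
  have h₄ := hq a
  simp only [Polynomial.eval_add, Polynomial.eval_mul, Polynomial.eval_ofNat]
  omega

section Names

variable {P D : Type} [TreeRep (Tok A B) P] [TreeRep (Tok A B) D] {eP : P → List A}
    {eD : D → List B}

section

variable (hP : ∀ X, (TreeRep.enc X : Dt (Tok A B)) = TreeRep.enc ((eP X).map (Tok.prop (B := B))))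
  (hD : ∀ v, (TreeRep.enc v : Dt (Tok A B)) = TreeRep.enc ((eD v).map (Tok.val (A := A))))

include hP hD

/-- When names are represented by their words, a formula and its version with words in place of
names are the same tree. -/
theorem NC.enc_raw (φ : NC P D) :
    (TreeRep.enc (raw eP eD φ) : Dt (Tok A B)) = TreeRep.enc φ := by
  have pair : ∀ {γ δ γ' δ' : Type} [TreeRep (Tok A B) γ] [TreeRep (Tok A B) δ]
      [TreeRep (Tok A B) γ']
      [TreeRep (Tok A B) δ'] {c : γ} {d : δ} {c' : γ'} {d' : δ'},
      (TreeRep.enc c : Dt (Tok A B)) = TreeRep.enc c' →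
      (TreeRep.enc d : Dt (Tok A B)) = TreeRep.enc d' →
      (TreeRep.enc (c, d) : Dt (Tok A B)) = TreeRep.enc (c', d') := by
    intro _ _ _ _ _ _ _ _ _ _ _ _ h₁ h₂
    exact congrArg₂ Dt.cons h₁ h₂
  induction φ using NC.induct with
  | const v w => rw [raw, enc_const, enc_const, pair (hD v) (hD w)]
  | pos X v => rw [raw, enc_pos, enc_pos, pair (hP X) (hD v)]
  | neg X v => rw [raw, enc_neg, enc_neg, pair (hP X) (hD v)]
  | node o φs ih =>
    rw [raw, enc_node, enc_node]
    refine pair rfl ?_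
    induction φs with
    | nil => rfl
    | cons φ l ihl => exact congrArg₂ Dt.cons (ih φ (by simp)) (ihl fun φ h => ih φ (by simp [h]))

omit hD in
theorem sz_prop (X : P) : sz (Tok A B) X = 2 * (eP X).length + 1 := by
  have : sz (Tok A B) X = sz (Tok A B) ((eP X).map (Tok.prop (B := B))) := by
    simp only [sz, cd, hP]
  rw [this, sz_word, List.length_map]

omit hP in
theorem sz_val (v : D) : sz (Tok A B) v = 2 * (eD v).length + 1 := by
  have : sz (Tok A B) v = sz (Tok A B) ((eD v).map (Tok.val (A := A))) := by
    simp only [sz, cd, hD]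
  rw [this, sz_word, List.length_map]

theorem NC.length_encodeWith_le (φ : NC P D) :
    (encodeWith eP eD φ).length ≤ sz (Tok A B) φ := by
  induction φ using NC.induct with
  | const v w => rw [sz_const, sz_val hD, sz_val hD]; simp [encodeWith]; omega
  | pos X v => rw [(sz_lit _ _).1, sz_prop hP, sz_val hD]; simp [encodeWith]; omega
  | neg X v => rw [(sz_lit _ _).2, sz_prop hP, sz_val hD]; simp [encodeWith]; omega
  | node o φs ih =>
    rw [sz_node_sum]
    have := List.sum_le_sum fun φ h => (ih φ h).trans (Nat.le_add_left _ 1)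
    simp only [encodeWith, List.length_append, List.length_cons, List.length_flatten, List.map_map,
      Function.comp_def, List.length_nil]
    omega

theorem PTime.encodeWith {φ : α → NC P D} (hφ : PTime O φ) :
    PTime O fun a => encodeWith eP eD (φ a) := by
  have h₁ := fun {α : Type} [TreeRep (Tok A B) α] {X : α → P} (hX : PTime O X) =>
    (cast (O := O) (f := fun X : P => (eP X).map (Tok.prop (B := B))) fun X => (hP X).symm).comp hX
  have h₂ := fun {α : Type} [TreeRep (Tok A B) α] {v : α → D} (hv : PTime O v) =>
    (cast (O := O) (f := fun v : D => (eD v).map (Tok.val (A := A))) fun v => (hD v).symm).comp hv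
  have key : ∀ φ : NC P D, NC.para (fun φ => φ.elim
      (fun v w => Tok.const :: (eD v).map Tok.val ++ Tok.sep :: (eD w).map Tok.val ++ [Tok.fin])
      (fun X v => Tok.pos :: (eP X).map Tok.prop ++ Tok.sep :: (eD v).map Tok.val ++ [Tok.fin])
      (fun X v => Tok.neg :: (eP X).map Tok.prop ++ Tok.sep :: (eD v).map Tok.val ++ [Tok.fin])
      fun _ _ => [])
      (fun o l => Tok.opn o :: (l.map fun x => x.2).flatten ++ [Tok.cls o]) φ =
        NC.encodeWith eP eD φ := by
    intro φ
    induction φ using NC.induct with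
    | node o φs ih =>
      simp only [NC.para, NC.encodeWith, List.map_map, Function.comp_def]
      rw [List.map_congr_left ih]
    | _ => simp [NC.para, NC.encodeWith, NC.elim]
  refine (PTime.para (O := O) hφ ?_ (by fun_prop) ⟨2 * .X + 1, fun a φ => ?_⟩).of_eq
    fun a => key (φ a)
  · fun_prop
  · rw [key, sz_word]
    have := length_encodeWith_le hP hD φ
    simp only [Polynomial.eval_add, Polynomial.eval_mul, Polynomial.eval_X, Polynomial.eval_ofNat,
      Polynomial.eval_one]
    omega

end

end Names

end Strings

/-! ### Comparison of truth-values as a subroutine, and Turing machines -/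

section Machines

open NC (Tok)
open Turing

variable {A B : Type}

instance : Inhabited (Cell (Tok A B)) := ⟨none⟩

/-- The symbol of a machine for comparison that corresponds to a symbol in the code of a pair: the
nil at the end of the first name becomes the separator. -/
def cmpIn {Δ : Type} (e : Δ ≃ Option B) : Cell (Tok A B) → Δ
  | some (some (.val b)) => e.symm (some b)
  | _ => e.symm none

/-- The symbol for an answer; any two different symbols would do. -/
def cmpOut {Δ : Type} (e : Δ ≃ Bool) (z : Δ) : Cell (Tok A B) := bif e z then none else some none

/-- A machine for comparison as an oracle. -/
def cmpOracle {D : Type} {eD : D → List B} {f : D × D → Bool}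
    (M : TM2ComputableInPolyTime (encodePair eD) Computability.encodeBool f) : Oracle (Tok A B) :=
  ⟨Prog.subroutine (cmpIn M.inputAlphabet) (cmpOut M.outputAlphabet)⟩

/-- Delete the symbols for inner nodes. -/
def leaves : Cell (Tok A B) → List (Cell (Tok A B))
  | none => []
  | some a => [some a]

theorem flatMap_leaves (l : List (Tok A B)) :
    (cd (Tok A B) l).flatMap leaves = l.map (fun c => some (some c)) ++ [some none] := by
  induction l with
  | nil => rfl
  | cons c l ih =>
    rw [cd_cons, List.flatMap_cons, List.flatMap_append, ih]
    rfl

theorem does_pump01 {C : Type} {O : List C → List C → ℕ → Prop} {g : C → List C} {K : ℕ}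
    (hg : ∀ a, (g a).length ≤ K) (s : ℕ → List C) (n : ℕ) (a b c d : List C) :
    Does O (.pump n (n + 1) g) (fr s n a b c d) (fr s n [] ((a.flatMap g).reverse ++ b) c d)
      ((K + 3) * a.length + 1) :=
  (Prog.does_pump (by simp) hg _).of_eq rfl (by simp) (by simp)

theorem length_leaves_le (c : Cell (Tok A B)) : (leaves c).length ≤ 1 := by
  rcases c with _ | _ <;> simp [leaves]

/-- A comparison is one call of the oracle, on both names separated by a leaf `nil`. -/
theorem ptime_cmp {D : Type} [TreeRep (Tok A B) D] {eD : D → List B} {f : D × D → Bool}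
    (hD : ∀ v, (TreeRep.enc v : Dt (Tok A B)) = TreeRep.enc ((eD v).map (Tok.val (A := A))))
    (M : TM2ComputableInPolyTime (encodePair eD) Computability.encodeBool f) :
    PTime (cmpOracle (A := A) M) f := by
  refine ⟨fun n => .seq (.pump n (n + 1) leaves) (.seq (.pop (n + 1) fun _ => .skip)
    (.seq (.call (n + 1)) (.pop (n + 1) fun o =>
      o.elim .skip fun c => .pushAll n (cd (Tok A B) c.isNone).reverse))),
    5 * .X + M.time.comp .X + 12, fun n s ⟨v, w⟩ => ?_⟩
  have hcd : ∀ v : D, cd (Tok A B) v = cd (Tok A B) ((eD v).map (Tok.val (A := A))) := fun v =>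
    congrArg Dt.code (hD v)
  set x : List (Cell (Tok A B)) := ((eD w).map fun b => some (some (Tok.val b))).reverse ++
    some none :: ((eD v).map fun b => some (some (Tok.val b))).reverse with hx
  have h₁ := does_pump01 (O := (cmpOracle (A := A) M).rel) length_leaves_le s n
    (cd (Tok A B) (v, w)) [] [] []
  have e₁ : ((cd (Tok A B) (v, w)).flatMap leaves).reverse ++ [] = some none :: x := by
    rw [cd_prod, List.flatMap_cons, List.flatMap_append, hcd, hcd, flatMap_leaves, flatMap_leaves]
    simp [hx, leaves, Function.comp_def]
  rw [e₁] at h₁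
  have h₂ : Does (cmpOracle (A := A) M).rel (.pop (n + 1) fun _ => .skip)
      (fr s n [] (some none :: x) [] []) (fr s n [] x [] []) 2 :=
    (Does.pop (.skip _)).of_eq rfl (by simp) le_rfl
  obtain ⟨⟨k, hk⟩, hk'⟩ := M.outputsFun (v, w)
  have hin : x.reverse.map (cmpIn M.inputAlphabet) =
      (encodePair eD (v, w)).map M.inputAlphabet.invFun := by
    simp [hx, encodePair, cmpIn, Function.comp_def]
  set z := (Computability.encodeBool (f (v, w))).map M.outputAlphabet.invFun with hz
  have hz' : z = [M.outputAlphabet.symm (f (v, w))] := rfl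
  have hlen : x.length = (encodePair eD (v, w)).length := by simp [hx, encodePair]; omega
  have h₃ : Does (cmpOracle (A := A) M).rel (.call (n + 1)) (fr s n [] x [] [])
      (fr s n [] [bif f (v, w) then none else some none] [] [])
      ((x.length + 1) + k + 2) := by
    refine ⟨_, le_rfl, ?_⟩
    have := Exec.call (O := (cmpOracle (A := A) M).rel) (r := n + 1) (s := fr s n [] x [] [])
      (y := [bif f (v, w) then none else some none]) (t := (x.length + 1) + k + 2)
      ⟨z, k, ?_, by simp [hz', cmpOut], by simp [hz']⟩ (by simp)
    · rwa [update_fr_one] at this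
    · rw [fr_one, hin]
      exact hk
  have h₄ : Does (cmpOracle (A := A) M).rel (.pop (n + 1) fun o =>
      o.elim .skip fun c => .pushAll n (cd (Tok A B) c.isNone).reverse)
      (fr s n [] [bif f (v, w) then none else some none] [] [])
      (fr s n (cd (Tok A B) (f (v, w))) [] [] []) 5 := by
    refine (Does.pop (T := 4) ?_).of_eq rfl rfl le_rfl
    rw [fr_one, update_fr_one]
    have e : (bif f (v, w) then none else some none : Cell (Tok A B)).isNone = f (v, w) := by
      cases f (v, w) <;> rfl
    have := sz_bool_le (Γ := Tok A B) (f (v, w))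
    exact (Prog.does_pushAll _ _ _).of_eq rfl (by simp [e])
      (by rw [e, List.length_reverse, length_cd]; omega)
  refine (h₁.seq (h₂.seq (h₃.seq h₄))).mono ?_
  have e₂ : x.length ≤ sz (Tok A B) (v, w) := by
    rw [sz_prod, sz_val hD, sz_val hD]
    simp [hx]
    omega
  have e₃ : k ≤ _ := hk'.trans (M.time.eval_mono_nat (hlen ▸ e₂))
  simp only [length_cd, Polynomial.eval_add, Polynomial.eval_mul, Polynomial.eval_X,
    Polynomial.eval_ofNat, Polynomial.eval_comp] at e₃ ⊢
  omega

/-- A value given by a string. -/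
structure Written {α Γ : Type} (e : α → List Γ) where
  /-- The value. -/
  val : α

instance {α Γ : Type} [TreeRep Γ Γ] (e : α → List Γ) : TreeRep Γ (Written e) :=
  ⟨fun x => TreeRep.enc (e x.val)⟩

/-- The symbol for a token, if the symbol stands for one. -/
def tokens : Cell (Tok A B) → List (Cell (Tok A B))
  | some (some c) => [some (some c)]
  | _ => []

theorem flatMap_tokens (l : List (Tok A B)) :
    (cd (Tok A B) l).flatMap tokens = l.map fun c => some (some c) := by
  induction l with
  | nil => rfl
  | cons c l ih =>
    rw [cd_cons, List.flatMap_cons, List.flatMap_append, ih]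
    rfl

theorem length_tokens_le (c : Cell (Tok A B)) : (tokens c).length ≤ 1 := by
  rcases c with _ | _ | _ <;> simp [tokens]

/-- Turn a word, in reverse, into the code of a list. -/
def load (n : ℕ) : Prog (Cell (Tok A B)) :=
  .seq (.push (n + 1) (some none)) (.seq (.pump n (n + 1) fun c => [c, none])
    (.seq (.mv (n + 1) (n + 2)) (.mv (n + 2) n)))

/-- Turn the code of a list into a word, in reverse. -/
def unload (n : ℕ) : Prog (Cell (Tok A B)) :=
  .seq (.pump n (n + 1) tokens) (.seq (.mv (n + 1) (n + 2)) (.mv (n + 2) n))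

theorem does_load {O : List (Cell (Tok A B)) → List (Cell (Tok A B)) → ℕ → Prop}
    (s : ℕ → List (Cell (Tok A B))) (n : ℕ) (l : List (Tok A B)) :
    Does O (load n) (fr s n (l.map fun c => some (some c)).reverse [] [] [])
        (fr s n (cd (Tok A B) l) [] [] [])
      (21 * l.length + 12) := by
  have e : ((l.map fun c => some (some c)).reverse.flatMap fun c => [c, none]).reverse ++
      [some none] = cd (Tok A B) l := by
    induction l with
    | nil => rfl
    | cons c l ih =>
      rw [cd_cons, ← ih]
      simp [cd, TreeRep.enc, Dt.code]
  refine ((does_push1 ..).seq ((does_pump01 (K := 2) (by simp) ..).seq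
    ((does_mv12 ..).seq (does_mv20 ..)))).of_eq rfl ?_ ?_
  · simp [e]
  · have := sz_word (A := A) (B := B) l
    simp only [e, length_cd, List.length_reverse, List.length_append, List.length_nil, this,
      List.length_map]
    omega

theorem does_unload {O : List (Cell (Tok A B)) → List (Cell (Tok A B)) → ℕ → Prop}
    (s : ℕ → List (Cell (Tok A B))) (n : ℕ) (l : List (Tok A B)) :
    Does O (unload n) (fr s n (cd (Tok A B) l) [] [] [])
        (fr s n (l.map fun c => some (some c)).reverse [] [] [])
      (16 * l.length + 7) := by
  refine ((does_pump01 length_tokens_le ..).seq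
    ((does_mv12 ..).seq (does_mv20 ..))).of_eq rfl ?_ ?_
  · simp [flatMap_tokens]
  · have := sz_word (A := A) (B := B) l
    simp only [flatMap_tokens, length_cd, List.length_reverse, List.length_append, List.length_nil,
      this, List.length_map]
    omega

/-- A polynomial-time function from strings to strings yields a Turing machine. -/
theorem PTime.polyTime [Finite A] [Finite B] {D : Type} {eD : D → List B} {f : D × D → Bool}
    (M : TM2ComputableInPolyTime (encodePair eD) Computability.encodeBool f)
    {α β Δ : Type} {ea : α → List (Tok A B)} {eb : β → List Δ} {g : α → β}
    (out : Tok A B → Δ) {h : α → List (Tok A B)} (hh : ∀ a, (h a).map out = eb (g a))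
    (hp : PTime (cmpOracle (A := A) M) fun x : Written ea => h x.val) : PolyTime ea eb g := by
  obtain ⟨r, hr⟩ := hp.sz_le
  obtain ⟨p, q, hp⟩ := hp
  have := Fintype.ofFinite (Tok A B)
  refine Prog.polyTime (Γ := Cell (Tok A B)) (toIn := cmpIn M.inputAlphabet)
    (ofOut := cmpOut M.outputAlphabet) (fun c => Option.some (Option.some c))
    (fun c => out (c.join.getD .fin)) (.seq (load 0) (.seq (p 0) (unload 0)))
    (21 * .X + 12 + q.comp (2 * .X + 1) + 17 * r.comp (2 * .X + 1) + 7) fun a => ?_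
  obtain ⟨t, ht, h₁⟩ := (does_load (fun _ => []) 0 (ea a)).seq
    ((hp 0 (fun _ => []) ⟨a⟩).seq (does_unload (fun _ => []) 0 (h a)))
  have e : ∀ x : List (Cell (Tok A B)), fr (fun _ => []) 0 x [] [] [] =
      Function.update (fun _ => []) 0 x := by
    intro x
    funext i
    by_cases hi : i = 0 <;> simp [fr, hi]
  rw [e, e] at h₁
  have e₁ : sz (Tok A B) (⟨a⟩ : Written ea) = 2 * (ea a).length + 1 := sz_word _
  have e₂ := hr ⟨a⟩
  have e₃ := sz_word (h a)
  refine ⟨_, t, h₁, ?_, ?_⟩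
  · rw [← hh, List.map_reverse, List.reverse_reverse, List.map_map]
    rfl
  · simp only [e₁] at ht e₂
    simp only [Polynomial.eval_add, Polynomial.eval_mul, Polynomial.eval_X, Polynomial.eval_ofNat,
      Polynomial.eval_comp, Polynomial.eval_one, List.length_reverse, List.length_map]
    omega

end Machines

open NC in
theorem mainTheorem6 {P D A B : Type} {T : Type*} [LinearOrder T] [Nonempty T]
    [Fintype A] [Fintype B]
    (eP : Computability.Encoding P A) (eD : Computability.Encoding D B) (val : D → T)
    (hcmp : PolyTime (encodePair eD.encode) Computability.encodeBool (nameLE val)) :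
    -- Reg-Horn-NC-SAT is decidable in polynomial time
    PolyTime (fun φ : {φ : NC P D // NC.IsHNC φ} => NC.encodeWith eP.encode eD.encode φ.1)
      Computability.encodeBool (regHornNCSat val) ∧
    -- the calculus decides it, and every derivation has linearly many inferences
    (∀ (φ : NC P T) (φs : List (NC P T)), φ = NC.node Conn.and φs →
      NC.IsHNC φ → NC.ConstFree φ →
      (¬ NC.Sat φ ↔ NC.Derives φ (NC.node Conn.or [])) ∧
      (∀ ψ, NC.Derives φ ψ → NC.Irreducible ψ → (¬ NC.Sat φ ↔ ψ = NC.node Conn.or [])) ∧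
      (∀ (n : ℕ) (s : ℕ → NC P T), s 0 = φ → (∀ i < n, NC.Infer (s i) (s (i + 1))) →
        n ≤ NC.size φ)) ∧
    -- each inference can be found and carried out in polynomial time
    (∃ next : NC P D → Option (NC P D),
      PolyTime (NC.encodeWith eP.encode eD.encode) (NC.optEncodeWith eP.encode eD.encode) next ∧
      ∀ φ,
        (∀ ψ, next φ = some ψ → NC.Infer (NC.map val φ) (NC.map val ψ) ∧
          (NC.encodeWith eP.encode eD.encode ψ).length ≤
            (NC.encodeWith eP.encode eD.encode φ).length) ∧
        (next φ = none → NC.Irreducible (NC.map val φ))) := by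
  obtain ⟨M⟩ := hcmp
  let _ : TreeRep (Tok A B) P := ⟨fun X => TreeRep.enc ((eP.encode X).map (Tok.prop (B := B)))⟩
  let _ : TreeRep (Tok A B) D := ⟨fun v => TreeRep.enc ((eD.encode v).map (Tok.val (A := A)))⟩
  have hP : ∀ X : P, (TreeRep.enc X : Dt (Tok A B)) =
    TreeRep.enc ((eP.encode X).map (Tok.prop (B := B))) := fun _ => rfl
  have hD : ∀ v : D, (TreeRep.enc v : Dt (Tok A B)) =
    TreeRep.enc ((eD.encode v).map (Tok.val (A := A))) := fun _ => rfl
  let eq (X Y : P) : Bool := eqWord ((eP.encode X).map (Tok.prop (B := B)))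
    ((eP.encode Y).map (Tok.prop (B := B)))
  let le (v w : D) : Bool := nameLE val (v, w)
  have heq : ∀ X Y, eq X Y = true ↔ X = Y := fun X Y => by
    rw [eqWord_iff, (List.map_injective_iff.2 fun _ _ h => Tok.prop.inj h).eq_iff,
      eP.encode_injective.eq_iff]
  have hle : ∀ v w, le v w = true ↔ val v ≤ val w := fun v w => by simp [le, nameLE]
  have hl : PTime (cmpOracle (A := A) M) fun x : D × D => le x.1 x.2 := ptime_cmp hD M
  have he : PTime (cmpOracle (A := A) M) fun x : P × P => eq x.1 x.2 := by
    have h : PTime (cmpOracle (A := A) M) fun X : P => (eP.encode X).map (Tok.prop (B := B)) :=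
      .cast fun X => (hP X).symm
    exact .eqWord (h.comp .fst) (h.comp .snd)
  -- reading a formula: the parser yields the same tree
  have hread : ∀ {α : Type} (φ : α → NC P D), PTime (cmpOracle (A := A) M)
      fun x : Written fun a => encodeWith eP.encode eD.encode (φ a) => φ x.val := fun φ =>
    (PTime.parse .id).congr_enc (fun x => encodeWith eP.encode eD.encode (φ x.val))
      (fun _ => rfl) fun x => by rw [parse_encodeWith, enc_raw hP hD]
  refine ⟨?_, ?_, next eq le, ?_, ?_⟩
  · refine PTime.polyTime M (fun c => match c with | .const => true | _ => false)
      (h := fun φ => [bif regHornNCSat val φ then .const else .pos]) (fun φ => ?_) ?_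
    · cases regHornNCSat val φ <;> rfl
    · have h := PTime.decideSat heq hle he hl
        (hread fun φ : {φ : NC P D // NC.IsHNC φ} => φ.1)
      refine (PTime.cond h (.const [.const]) (.const [.pos])).of_eq fun x => ?_
      have h₁ := sat_iff_iterate_step hle heq x.val.2
        (size_le_sz (A := A) (B := B) (node .and [rmConst le x.val.1]))
      have h₂ : regHornNCSat val x.val = !isBot ((step eq le)^[sz (Tok A B)
          (node .and [rmConst le x.val.1])] (node .and [rmConst le x.val.1])) := by
        rw [Bool.eq_iff_iff, h₁]
        simp [regHornNCSat]
      rw [h₂]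
      cases isBot _ <;> rfl
  · rintro φ φs rfl hh hcf
    exact ⟨NC.not_sat_iff_derives hh hcf, fun ψ hd hirr => Derives.not_sat_iff hh hcf hd hirr,
      fun n s h₀ h => h₀ ▸ NC.length_le_size h⟩
  · refine PTime.polyTime M _root_.id
      (h := fun φ => optEncodeWith eP.encode eD.encode (next eq le φ)) (fun φ => List.map_id _) ?_
    have h := PTime.next heq hle he hl (hread fun φ : NC P D => φ)
    refine (PTime.optElim (g := fun _ => encodeWith eP.encode eD.encode) h (.const [])
      (PTime.encodeWith hP hD .fst)).of_eq fun x => ?_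
    cases next eq le x.val <;> rfl
  · exact NC.next_spec heq hle (w := 2) (e := 0) fun o φs => by
      simp only [encodeWith, List.length_append, List.length_cons, List.length_flatten,
        List.map_map,
        Function.comp_def, List.length_nil, zero_add]
      omega
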